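/- **Setting.** Regard the closed disk $D$ as the quotient of the sphere by a reflection, whose circle of fixed points becomes $\partial D$. A *quotient map on the disk* is the image in $D$ of a map on the sphere (a connected graph, loops and multiple edges allowed, embedded so that all faces are open $2$-cells) that is invariant under the reflection. Its edges are of three kinds: *complete edges*, whose interior lies in the interior of $D$ and which have a vertex at each end; *halfedges*, which join a vertex to a point of $\partial D$ that is not a vertex; and *boundary edges*, which lie on $\partial D$. A complete edge contributes $2$ to the number of darts of the map, a halfedge and a boundary edge contribute $1$ each. Equivalently, the number of darts is half the number of flags, the flags being the triangles obtained by joining vertices, edge midpoints and face centres. (Formally a map is given by its set of flags with the three adjacencies across their sides, which are involutions $r_0,r_1,r_2$ whose fixed points are the sides on $\partial D$, with $r_0r_2=r_2r_0$ and $r_0f\ne r_2f$ for all $f$. The surface is the disk if and only if it is connected and orientable with Euler characteristic $1$.) Rooted maps are counted up to isomorphism. A root is an end of an edge together with one of its sides, that is, a flag; on the disk and the sphere this amounts to choosing a root dart and counting up to orientation-preserving homeomorphisms. For $n,k\ge 0$ let * $s_{n,k}$ be the number of rooted maps on the sphere with $n$ darts (that is, $n/2$ edges) and root vertex of degree $k$;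 the map consisting of a single vertex is included, so $s_{0,0}=1$; * $d_{n,k}$ be the number of rooted quotient maps on the disk with $n$ darts whose root vertex lies in the interior of the disk and has degree $k$ (so $d_{0,0}=0$); * $d^{(i)}_{n,k}$, for $i=0,1,2$, be the number of quotient maps on the disk with $n$ darts rooted at a vertex on the boundary of the disk that is incident to exactly $i$ boundary darts (ends of boundary edges) and to exactly $k$ other darts, where the root is always the leftmost dart at the root vertex (so for $i=1$ the only boundary dart at the root vertex is the leftmost one); the map consisting of a single vertex on the boundary is included for $i=0$, so $d^{(0)}_{0,0}=1$. **Proposition.** For all integers $n\ge 1$ and $k\ge 1$, $$ d_{n,k}=d^{(0)}_{n-1,k-1}+\sum_{k'=0}^{n-k-1}d_{n-2,\,k+k'-1}+ 2\sum_{n'=0}^{n-2}\sum_{k'=0}^{k-2}d_{n',k'}\cdot s_{n-n'-2,\,k-k'-2} +\sum_{k'=0}^{n-k-1}\sum_{i_1=0}^{1}\sum_{i_2=0}^{1}(k'+1)\cdot d^{(i_1+i_2)}_{n-2,\,k+k'-1}, $$ where a sum whose upper limit is negative is $0$. -/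

import Mathlib

/-- A quotient map without branch points on a compact surface, possibly with boundary, given by its
set `F` of flags. The flags are the triangles into which the surface is cut by joining the centres
of the faces, the midpoints of the edges and the vertices of the map. The flag `r0 f` (resp. `r1 f`,
`r2 f`) is the flag on the other side of the side of `f` that is opposite to its vertex
(resp. edge midpoint, face centre); it is `f` itself when that side lies on the boundary of the
surface. So `r0` goes to the other end of an edge, `r1` to the other edge at a corner,
and `r2` to the other side of an edge.

The last two fields say that around the midpoint of an edge there are
* four flags, permuted freely by `r0` and `r2` (a complete edge),
* two flags fixed by `r0` and exchanged by `r2` (a halfedge, which ends on the boundary), or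
* two flags exchanged by `r0` and fixed by `r2` (a boundary edge, which lies on the boundary):

the field `r0_ne_r2` excludes edge midpoints that are branch points of index `2`
(two flags exchanged by both `r0` and `r2`) or corners of the surface (a single flag). -/
structure FlagMap (F : Type*) where
  r0 : F → F
  r1 : F → F
  r2 : F → F
  r0_invol : Function.Involutive r0
  r1_invol : Function.Involutive r1
  r2_invol : Function.Involutive r2
  r0_r2_comm : ∀ f, r0 (r2 f) = r2 (r0 f)
  r0_ne_r2 : ∀ f, r0 f ≠ r2 f

namespace FlagMap

variable {F : Type*} (M : FlagMap F)

/-- Two flags are at the same vertex iff a sequence of steps `r1`, `r2` joins them. -/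
def SameVertex : F → F → Prop := Relation.EqvGen fun f g => g = M.r1 f ∨ g = M.r2 f

/-- Two flags are at the same edge. -/
def SameEdge : F → F → Prop := Relation.EqvGen fun f g => g = M.r0 f ∨ g = M.r2 f

/-- Two flags are in the same face. -/
def SameFace : F → F → Prop := Relation.EqvGen fun f g => g = M.r0 f ∨ g = M.r1 f

/-- The surface is connected. -/
def Connected : Prop :=
  ∀ f g, Relation.EqvGen (fun f g => g = M.r0 f ∨ g = M.r1 f ∨ g = M.r2 f) f g

/-- The surface is orientable: the flags can be coloured with two colours so that flags on the two
sides of a common side have different colours. -/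
def Orientable : Prop :=
  ∃ c : F → Bool, ∀ f, (M.r0 f ≠ f → c (M.r0 f) ≠ c f) ∧ (M.r1 f ≠ f → c (M.r1 f) ≠ c f) ∧
    (M.r2 f ≠ f → c (M.r2 f) ≠ c f)

/-- The number of orbits of an involution `r`, that is, the number of sides of flags of one of the
three types; a side on the boundary corresponds to a fixed point of `r`. -/
noncomputable def numSides (r : F → F) : ℕ := Nat.card (Quot fun f g => g = r f)

/-- The Euler characteristic of the surface, computed from its partition into flags: points (the
vertices, the midpoints of the edges and the centres of the faces) minus sides plus triangles. -/
noncomputable def eulerChar : ℤ :=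
  ((Nat.card (Quot M.SameVertex) + Nat.card (Quot M.SameEdge) + Nat.card (Quot M.SameFace) : ℕ) : ℤ)
    - ((numSides M.r0 + numSides M.r1 + numSides M.r2 : ℕ) : ℤ) + (Nat.card F : ℤ)

/-- The surface is a sphere: by the classification of compact surfaces (with boundary), the sphere
is the only connected one of Euler characteristic `2`. -/
def IsSphere : Prop := M.Connected ∧ M.Orientable ∧ M.eulerChar = 2

/-- The surface is a disk: by the classification of compact surfaces (with boundary), the disk is
the only connected orientable one of Euler characteristic `1`. -/
def IsDisk : Prop := M.Connected ∧ M.Orientable ∧ M.eulerChar = 1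

/-- The vertex of the flag `f` lies in the interior of the surface: no side of a flag that is
incident to this vertex lies on the boundary. -/
def InteriorVertex (f : F) : Prop := ∀ g, M.SameVertex f g → M.r1 g ≠ g ∧ M.r2 g ≠ g

/-- The number of flags at the vertex of `f` that belong to darts not lying on the boundary. Each
such dart at this vertex has two flags there, one on either side of it. -/
noncomputable def innerFlags (f : F) : ℕ := Nat.card {g : F // M.SameVertex f g ∧ M.r2 g ≠ g}

/-- The number of boundary darts (ends of boundary edges) incident to the vertex of `f`. Each of
them has exactly one flag at this vertex. -/
noncomputable def boundaryDarts (f : F) : ℕ := Nat.card {g : F // M.SameVertex f g ∧ M.r2 g = g}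

end FlagMap

/-- The number of rooted maps with `n` darts, that is `2 * n` flags, that have the property `P`,
up to isomorphism. A root is a flag (an end of an edge with one of its sides). On an
orientable surface this is the same as rooting at a dart and counting up to
orientation-preserving isomorphisms. A complete edge has two darts, a halfedge and a boundary edge
have one each. -/
noncomputable def numRooted (n : ℕ) (P : FlagMap (Fin (2 * n)) → Fin (2 * n) → Prop) : ℕ :=
  Nat.card (Quot fun A B : {A : FlagMap (Fin (2 * n)) × Fin (2 * n) // P A.1 A.2} =>
    ∃ e : Fin (2 * n) ≃ Fin (2 * n), e A.1.2 = B.1.2 ∧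
      ∀ f, e (A.1.1.r0 f) = B.1.1.r0 (e f) ∧ e (A.1.1.r1 f) = B.1.1.r1 (e f) ∧
        e (A.1.1.r2 f) = B.1.1.r2 (e f))

/-- `s_{n,k}`: the number of rooted maps on the sphere with `n` darts and root vertex of
degree `k`. The map that consists of a single vertex has no flags and is counted separately. -/
noncomputable def sphereMaps (n k : ℕ) : ℕ :=
  numRooted n (fun M f => M.IsSphere ∧ M.innerFlags f = 2 * k) + if n = 0 ∧ k = 0 then 1 else 0

/-- `d_{n,k}`: the number of rooted quotient maps on the disk with `n` darts whose root vertex lies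
in the interior of the disk and has degree `k`. -/
noncomputable def diskMaps (n k : ℕ) : ℕ :=
  numRooted n fun M f => M.IsDisk ∧ M.InteriorVertex f ∧ M.innerFlags f = 2 * k

/-- `d^{(i)}_{n,k}`, `i = 0, 1, 2`: the number of quotient maps on the disk with `n` darts whose
root vertex lies on the boundary and is incident to exactly `i` boundary darts and to `k` other
darts, and whose root is leftmost at the root vertex. The last condition means that the root flag is
the first one at its vertex: the side of the root flag that starts at the vertex and is
not between two flags lies on the boundary, and it is part of an edge of the map (`r2` fixes the
root) if `i ≥ 1` and inside a face (`r1` fixes the root) if `i = 0`. So for `i = 1` the only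
boundary dart at the root vertex is the leftmost one.
For `i = 0` the map that consists of a single vertex on the boundary has no flags and is
counted separately. (A single vertex in the interior of the disk is not a quotient map.) -/
noncomputable def diskBoundaryMaps (i n k : ℕ) : ℕ :=
  numRooted n (fun M f => M.IsDisk ∧ (if i = 0 then M.r1 f = f else M.r2 f = f) ∧
      M.boundaryDarts f = i ∧ M.innerFlags f = 2 * k)
    + if i = 0 ∧ n = 0 ∧ k = 0 then 1 else 0

/-!
The recurrence classifies the rooted maps on the disk with root vertex in the interior by their
root edge and takes this edge away. All maps are treated as `RootedMap`s on arbitrary finite sets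
of flags, and `RootedMap.count P` is the number of isomorphism classes of those that have the
property `P`; `RootedMap.numRooted_eq_count` shows that these are the numbers in the statement.
With root flag `f`, there are three cases (`RootedMap.count_isInner`).

* The root edge is a halfedge, `r0 f = f`. Cutting the disk open along the halfedge moves the root
  vertex to the boundary, where it has no boundary darts and one dart less. Conversely, a halfedge
  can be attached at the two ends of such a boundary vertex in exactly one way
  (`RootedMap.count_isInner_halfedge`). This gives `d^{(0)}_{n-1,k-1}`.

* The root edge is complete and has both ends at the root vertex. The vertex is cut in two by
  exchanging the partners of the corner of `f` and the corner of `r0 f`. Orientability implies that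
  this does cut the vertex (`FlagMap.not_sameVertex_of_loop`), and it separates a face, so the
  Euler characteristic increases by `2`. A connected surface has Euler characteristic at most `2`,
  and at most `1` if it has a boundary (`FlagMap.eulerChar_le`). Hence the surface falls apart into
  a disk and a sphere (`RootedMap.exists_glue_of_loop`), and the maps correspond to pairs
  (`RootedMap.count_glue`). The root edge is left in one of the two parts as a loop around a single
  corner, from which it can be removed. This gives the double sum; the factor `2` tells which part
  is the sphere (`RootedMap.count_isInner_sameVertex`).

* The root edge is complete and has two different ends. Then a dart next to the root edge can be
  slid along the edge from one end to the other, which is reversible and changes neither the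
  surface nor the total number of darts at the two ends (`FlagMap.slide`, `FlagMap.Slidable`). Let
  `k'` be the number of inner darts at the other end, apart from the root edge. If the other end is
  in the interior, all darts except the root can be slid to it. The root edge is then pendant and
  is removed, which leaves a map counted by `d_{n-2,k+k'-1}` (`RootedMap.count_isEdge_interior`,
  `RootedMap.count_isEdge_one_interior`). If the other end is on the boundary, its darts are slid
  to the root vertex until the boundary is next to the root edge. There are `k' + 1` possible
  numbers of slides, and for each of them all darts can be slid back on the other side of the root
  edge, until the edge is pendant (`RootedMap.count_isEdge_boundary`). When it is removed, the
  sides of the boundary at its end may or may not be boundary darts, which gives the sum over `i₁`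
  and `i₂` (`RootedMap.count_isEdge_one_blocked`).

The bijections are set up on representatives: a construction has to respect isomorphism, and it has
to be injective up to isomorphism. Both hold because each construction is determined by flags that
are reached from the root by the adjacencies (`RootedMap.Natural`), and a map that has been taken
apart can be put together again by `FlagMap.joinCorners`.
-/

/-! ### Orbits of two involutions -/

/-- `f` and `g` are joined by a sequence of steps `a`, `b`. The vertices, edges and faces of a
`FlagMap` are the classes of `Orb r1 r2`, `Orb r0 r2` and `Orb r0 r1`. -/
def Orb {F : Type*} (a b : F → F) : F → F → Prop :=
  Relation.EqvGen fun f g => g = a f ∨ g = b f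

theorem eqvGen_lift {F G : Type*} {r : F → F → Prop} {s : G → G → Prop} (hs : Equivalence s)
    (α : F → G) (h : ∀ f g, r f g → s (α f) (α g)) {f g : F} (hfg : Relation.EqvGen r f g) :
    s (α f) (α g) := by
  induction hfg with
  | rel x y hxy => exact h x y hxy
  | refl x => exact hs.refl _
  | symm x y _ ih => exact hs.symm ih
  | trans x y z _ _ ih₁ ih₂ => exact hs.trans ih₁ ih₂

theorem eqvGen_equivalence {F : Type*} (r : F → F → Prop) : Equivalence (Relation.EqvGen r) :=
  Relation.EqvGen.is_equivalence r

namespace Orb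

variable {F G : Type*} {a b : F → F} {a' b' : G → G}

theorem equivalence (a b : F → F) : Equivalence (Orb a b) := eqvGen_equivalence _

@[refl] theorem refl (f : F) : Orb a b f f := Relation.EqvGen.refl f

@[symm] theorem symm {f g : F} (h : Orb a b f g) : Orb a b g f := Relation.EqvGen.symm _ _ h

@[trans] theorem trans {f g h : F} (h₁ : Orb a b f g) (h₂ : Orb a b g h) : Orb a b f h :=
  Relation.EqvGen.trans _ _ _ h₁ h₂

theorem left (f : F) : Orb a b f (a f) := Relation.EqvGen.rel _ _ (Or.inl rfl)

theorem right (f : F) : Orb a b f (b f) := Relation.EqvGen.rel _ _ (Or.inr rfl)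

theorem lift {s : G → G → Prop} (hs : Equivalence s) (α : F → G)
    (ha : ∀ f, s (α f) (α (a f))) (hb : ∀ f, s (α f) (α (b f))) {f g : F} (h : Orb a b f g) :
    s (α f) (α g) :=
  eqvGen_lift hs α (by rintro f g (rfl | rfl); exacts [ha f, hb f]) h

theorem map (α : F → G) (ha : ∀ f, Orb a' b' (α f) (α (a f)))
    (hb : ∀ f, Orb a' b' (α f) (α (b f))) {f g : F} (h : Orb a b f g) :
    Orb a' b' (α f) (α g) :=
  h.lift (equivalence a' b') α ha hb

theorem comm {f g : F} (h : Orb a b f g) : Orb b a f g :=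
  h.map id (fun f => right f) (fun f => left f)

theorem comm_iff {f g : F} : Orb a b f g ↔ Orb b a f g := ⟨comm, comm⟩

/-- A set that is closed under both involutions is a union of classes. -/
theorem mem_iff (ha : Function.Involutive a) (hb : Function.Involutive b) {S : Set F}
    (hSa : ∀ f ∈ S, a f ∈ S) (hSb : ∀ f ∈ S, b f ∈ S) {f g : F} (h : Orb a b f g) :
    f ∈ S ↔ g ∈ S := by
  refine h.lift (s := fun p q : F => p ∈ S ↔ q ∈ S)
    ⟨fun _ => Iff.rfl, Iff.symm, Iff.trans⟩ id (fun f => ⟨hSa f, fun h => ?_⟩)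
    (fun f => ⟨hSb f, fun h => ?_⟩)
  · simpa [ha f] using hSa _ h
  · simpa [hb f] using hSb _ h

theorem left_iff {f g : F} : Orb a b f (a g) ↔ Orb a b f g :=
  ⟨fun h => h.trans (left g).symm, fun h => h.trans (left g)⟩

theorem right_iff {f g : F} : Orb a b f (b g) ↔ Orb a b f g :=
  ⟨fun h => h.trans (right g).symm, fun h => h.trans (right g)⟩

end Orb

/-- In the class of an end `l` (a fixed point of `a`) of two involutions on a finite set there is
exactly one other end. This holds because `a` and `b` act on the class as reflections of the
regular polygon formed by the orbit of `l` under `a ∘ b`. -/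
theorem Orb.exists_other_end {F : Type*} [Finite F] {a b : F → F} (ha : Function.Involutive a)
    (hb : Function.Involutive b) {l : F} (hl : a l = l) :
    (∃ l', Orb a b l l' ∧ l' ≠ l ∧ a l' = l' ∧ (∀ g, Orb a b l g → b g ≠ g) ∧
        ∀ g, Orb a b l g → a g = g → g = l ∨ g = l') ∨
      ∃ l', Orb a b l l' ∧ b l' = l' ∧ (∀ g, Orb a b l g → b g = g → g = l') ∧
        ∀ g, Orb a b l g → a g = g → g = l := by
  set A : Equiv.Perm F := ha.toPerm with hA
  set B : Equiv.Perm F := hb.toPerm with hB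
  have hAa : ∀ f, A f = a f := fun f => rfl
  have hBb : ∀ f, B f = b f := fun f => rfl
  set τ : Equiv.Perm F := A * B with hτ
  have hAA : A * A = 1 := Equiv.ext fun f => ha f
  have hBB : B * B = 1 := Equiv.ext fun f => hb f
  have hAi : A⁻¹ = A := inv_eq_of_mul_eq_one_left hAA
  have hBi : B⁻¹ = B := inv_eq_of_mul_eq_one_left hBB
  have hconj : A * τ * A⁻¹ = τ⁻¹ := by
    rw [hτ, mul_inv_rev, hAi, hBi, ← mul_assoc, hAA, one_mul]
  -- on the orbit of `l` under the rotation `τ`, `a` is `j ↦ -j` and `b` is `j ↦ -(j + 1)`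
  have hAτ : ∀ j : ℤ, a ((τ ^ j) l) = (τ ^ (-j)) l := by
    intro j
    have h : A * τ ^ j * A⁻¹ = τ ^ (-j) := by rw [← conj_zpow, hconj, inv_zpow, zpow_neg]
    calc a ((τ ^ j) l) = (A * τ ^ j * A⁻¹) l := by
          rw [hAi, Equiv.Perm.mul_apply, Equiv.Perm.mul_apply, hAa, hAa, hl]
      _ = _ := by rw [h]
  have hBτ : ∀ j : ℤ, b ((τ ^ j) l) = (τ ^ (-(j + 1))) l := by
    intro j
    have : b ((τ ^ j) l) = a ((τ ^ (j + 1)) l) := by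
      rw [add_comm, zpow_add, zpow_one, Equiv.Perm.mul_apply, hτ, Equiv.Perm.mul_apply, hAa, hBb,
        ha]
    rw [this, hAτ]
  have hmem : ∀ g, Orb a b l g → ∃ j : ℤ, g = (τ ^ j) l := by
    intro g hg
    refine (Orb.mem_iff ha hb (S := {g | ∃ j : ℤ, g = (τ ^ j) l}) ?_ ?_ hg).1 ⟨0, by simp⟩
    · rintro _ ⟨j, rfl⟩; exact ⟨_, hAτ j⟩
    · rintro _ ⟨j, rfl⟩; exact ⟨_, hBτ j⟩
  have hτorb : ∀ g, Orb a b l g ↔ Orb a b l (τ g) := by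
    intro g
    rw [hτ, Equiv.Perm.mul_apply, hAa, hBb, Orb.left_iff, Orb.right_iff]
  have horb : ∀ j : ℤ, Orb a b l ((τ ^ j) l) := by
    intro j
    induction j with
    | zero => simpa using Orb.refl l
    | succ i ih =>
      rw [add_comm, zpow_add, zpow_one, Equiv.Perm.mul_apply]; exact (hτorb _).1 ih
    | pred i ih =>
      rw [hτorb, ← Equiv.Perm.mul_apply, ← zpow_one_add]
      simpa using ih
  -- the orbit has `m` elements, so the fixed points of `a` and `b` are the solutions `j` modulo `m`
  -- of `2 * j = 0` and `2 * j + 1 = 0`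
  set m := Function.minimalPeriod (τ • ·) l with hm
  have hm0 : 0 < m := by
    refine Function.IsPeriodicPt.minimalPeriod_pos (orderOf_pos τ) ?_
    change (τ • ·)^[orderOf τ] l = l
    rw [smul_iterate, pow_orderOf_eq_one]
    exact one_smul _ l
  have hdvd : ∀ j : ℤ, (τ ^ j) l = l ↔ (m : ℤ) ∣ j := fun j => by
    rw [← Equiv.Perm.smul_def, MulAction.zpow_smul_eq_iff_minimalPeriod_dvd]
  have heq : ∀ i j : ℤ, (τ ^ i) l = (τ ^ j) l ↔ (m : ℤ) ∣ i - j := by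
    intro i j
    rw [← hdvd, sub_eq_neg_add, zpow_add, Equiv.Perm.mul_apply, zpow_neg, Equiv.Perm.inv_eq_iff_eq,
      eq_comm]
  have hAfix : ∀ j : ℤ, a ((τ ^ j) l) = (τ ^ j) l ↔ (m : ℤ) ∣ 2 * j := by
    intro j
    rw [hAτ, heq, ← dvd_neg]; ring_nf
  have hBfix : ∀ j : ℤ, b ((τ ^ j) l) = (τ ^ j) l ↔ (m : ℤ) ∣ 2 * j + 1 := by
    intro j
    rw [hBτ, heq, ← dvd_neg]; ring_nf
  have heq0 : ∀ i : ℤ, (τ ^ i) l = l ↔ (m : ℤ) ∣ i := hdvd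
  rcases Nat.even_or_odd' m with ⟨c, hc | hc⟩
  · left
    refine ⟨(τ ^ (c : ℤ)) l, horb _, ?_, ?_, ?_, ?_⟩
    · rw [Ne, heq0]
      intro h
      have := Int.le_of_dvd (by omega) h
      omega
    · rw [hAfix]; exact ⟨1, by push_cast [hc]; ring⟩
    · intro g hg
      obtain ⟨j, rfl⟩ := hmem g hg
      rw [Ne, hBfix]
      rintro ⟨d, hd⟩
      rw [hc] at hd; push_cast at hd
      have : (2 : ℤ) * (c * d - j) = 1 := by linarith
      omega
    · intro g hg hga
      obtain ⟨j, rfl⟩ := hmem g hg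
      rw [hAfix] at hga
      obtain ⟨d, hd⟩ := hga
      rw [hc] at hd; push_cast at hd
      have hj : j = c * d := by linarith
      rw [heq0, heq]
      rcases Int.even_or_odd' d with ⟨e, he | he⟩
      · left; exact ⟨e, by rw [hj, hc, he]; push_cast; ring⟩
      · right; exact ⟨e, by rw [hj, hc, he]; push_cast; ring⟩
  · right
    refine ⟨(τ ^ (c : ℤ)) l, horb _, ?_, ?_, ?_⟩
    · rw [hBfix]; exact ⟨1, by push_cast [hc]; ring⟩
    · intro g hg hgb
      obtain ⟨j, rfl⟩ := hmem g hg
      rw [hBfix] at hgb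
      rw [heq]
      have h2 : (m : ℤ) ∣ 2 * (j - c) := by
        have := dvd_sub hgb (dvd_refl (m : ℤ))
        have h3 : (2 * j + 1 - (m : ℤ)) = 2 * (j - c) := by rw [hc]; push_cast; ring
        rwa [h3] at this
      refine (Int.isCoprime_iff_gcd_eq_one.2 ?_).dvd_of_dvd_mul_left h2
      have : Nat.Coprime m 2 := by
        rw [Nat.coprime_comm, Nat.coprime_two_left]; exact ⟨c, hc⟩
      exact_mod_cast this
    · intro g hg hga
      obtain ⟨j, rfl⟩ := hmem g hg
      rw [hAfix] at hga
      rw [heq0]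
      refine (Int.isCoprime_iff_gcd_eq_one.2 ?_).dvd_of_dvd_mul_left hga
      have : Nat.Coprime m 2 := by
        rw [Nat.coprime_comm, Nat.coprime_two_left]; exact ⟨c, hc⟩
      exact_mod_cast this

/-- If the only ends of a class are two fixed points of `a`, then they have different colours in
every colouring that `a` and `b` respect. -/
theorem Orb.color_ne_of_ends {F : Type*} [Finite F] {a b : F → F} (ha : Function.Involutive a)
    (hb : Function.Involutive b) {c : F → Bool} {l l' : F} (hll : l' ≠ l) (hl : a l = l)
    (hl' : a l' = l') (hor : Orb a b l l')
    (hca : ∀ g, Orb a b l g → a g ≠ g → c (a g) ≠ c g)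
    (hcb : ∀ g, Orb a b l g → c (b g) ≠ c g)
    (hends : ∀ g, Orb a b l g → a g = g → g = l ∨ g = l') : c l' ≠ c l := by
  classical
  have := Fintype.ofFinite F
  set s : F → ℤ := fun g => if c g then 1 else -1 with hs
  have hsne : ∀ f g : F, c f ≠ c g → s f + s g = 0 := by
    intro f g h
    simp only [hs]
    cases hf : c f <;> cases hg : c g <;> simp_all
  set P : Finset F := Finset.univ.filter fun g => Orb a b l g with hP
  -- `b` pairs off the two colours on the class, and `a` does so on the class without its two ends
  have hsum : ∑ g ∈ P, s g = 0 := by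
    refine Finset.sum_involution (fun g _ => b g) ?_ ?_ ?_ ?_
    · intro g hg
      exact hsne _ _ (hcb g (by simpa [hP] using hg)).symm
    · intro g hg _ h
      exact hcb g (by simpa [hP] using hg) (by rw [h])
    · intro g hg
      simpa [hP, Orb.right_iff] using hg
    · intro g _; exact hb g
  have hsum2 : ∑ g ∈ (P.erase l).erase l', s g = 0 := by
    refine Finset.sum_involution (fun g _ => a g) ?_ ?_ ?_ ?_
    · intro g hg
      simp only [Finset.mem_erase, hP, Finset.mem_filter, Finset.mem_univ, true_and] at hg
      refine hsne _ _ (hca g hg.2.2 fun h => ?_).symm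
      rcases hends g hg.2.2 h with h | h
      exacts [hg.2.1 h, hg.1 h]
    · intro g hg _ h
      simp only [Finset.mem_erase, hP, Finset.mem_filter, Finset.mem_univ, true_and] at hg
      rcases hends g hg.2.2 h with h | h
      exacts [hg.2.1 h, hg.1 h]
    · intro g hg
      simp only [Finset.mem_erase, hP, Finset.mem_filter, Finset.mem_univ, true_and] at hg ⊢
      refine ⟨fun h => hg.1 ?_, fun h => hg.2.1 ?_, Orb.left_iff.2 hg.2.2⟩
      · rw [← ha g, h, hl']
      · rw [← ha g, h, hl]
    · intro g _; exact ha g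
  have h1 : l ∈ P := by simp [hP, Orb.refl]
  have h2 : l' ∈ P.erase l := by simp [hP, hll, hor]
  rw [← Finset.add_sum_erase _ _ h1, ← Finset.add_sum_erase _ _ h2, hsum2] at hsum
  intro h
  simp only [hs, h] at hsum
  split_ifs at hsum <;> omega

/-! ### Counting classes -/

theorem card_quot_congr {F G : Type*} {r : F → F → Prop} {s : G → G → Prop} (α : F → G)
    (β : G → F) (hα : ∀ f g, r f g → Quot.mk s (α f) = Quot.mk s (α g))
    (hβ : ∀ f g, s f g → Quot.mk r (β f) = Quot.mk r (β g))
    (h₁ : ∀ f, Quot.mk r (β (α f)) = Quot.mk r f) (h₂ : ∀ g, Quot.mk s (α (β g)) = Quot.mk s g) :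
    Nat.card (Quot r) = Nat.card (Quot s) :=
  Nat.card_congr
    { toFun := Quot.lift (fun f => Quot.mk s (α f)) hα
      invFun := Quot.lift (fun g => Quot.mk r (β g)) hβ
      left_inv := by rintro ⟨f⟩; exact h₁ f
      right_inv := by rintro ⟨g⟩; exact h₂ g }

theorem Orb.card_quot_congr {F G : Type*} {a b : F → F} {a' b' : G → G} (α : F → G) (β : G → F)
    (hαa : ∀ f, Orb a' b' (α f) (α (a f))) (hαb : ∀ f, Orb a' b' (α f) (α (b f)))
    (hβa : ∀ f, Orb a b (β f) (β (a' f))) (hβb : ∀ f, Orb a b (β f) (β (b' f)))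
    (h₁ : ∀ f, Orb a b (β (α f)) f) (h₂ : ∀ g, Orb a' b' (α (β g)) g) :
    Nat.card (Quot (Orb a b)) = Nat.card (Quot (Orb a' b')) :=
  _root_.card_quot_congr α β (fun _ _ h => Quot.sound (h.map α hαa hαb))
    (fun _ _ h => Quot.sound (h.map β hβa hβb)) (fun f => Quot.sound (h₁ f))
    (fun g => Quot.sound (h₂ g))

/-- The classes on a disjoint union. -/
theorem Orb.card_quot_sum {S T : Type*} [Finite S] [Finite T] (a b : S → S) (a' b' : T → T) :
    Nat.card (Quot (Orb (Sum.map a a') (Sum.map b b'))) =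
      Nat.card (Quot (Orb a b)) + Nat.card (Quot (Orb a' b')) := by
  rw [← Nat.card_sum]
  refine Nat.card_congr
    { toFun := Quot.lift (Sum.map (Quot.mk _) (Quot.mk _)) fun f g h => ?_
      invFun := Sum.elim
        (Quot.lift (fun f => Quot.mk _ (Sum.inl f)) fun f g h => Quot.sound ?_)
        (Quot.lift (fun f => Quot.mk _ (Sum.inr f)) fun f g h => Quot.sound ?_)
      left_inv := by rintro ⟨f | f⟩ <;> rfl
      right_inv := by rintro (f | f) <;> induction f using Quot.ind <;> rfl }
  · refine h.lift (s := Eq) eq_equivalence (Sum.map (Quot.mk (Orb a b)) (Quot.mk (Orb a' b'))) ?_ ?_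
    · rintro (f | f)
      · exact congrArg Sum.inl (Quot.sound (Orb.left f))
      · exact congrArg Sum.inr (Quot.sound (Orb.left f))
    · rintro (f | f)
      · exact congrArg Sum.inl (Quot.sound (Orb.right f))
      · exact congrArg Sum.inr (Quot.sound (Orb.right f))
  · exact h.map Sum.inl (fun f => Orb.left (a := Sum.map a a') (Sum.inl f))
      (fun f => Orb.right (b := Sum.map b b') (Sum.inl f))
  · exact h.map Sum.inr (fun f => Orb.left (a := Sum.map a a') (Sum.inr f))
      (fun f => Orb.right (b := Sum.map b b') (Sum.inr f))

theorem Orb.sum_iff {S T : Type*} {a b : S → S} {a' b' : T → T} {p q : S ⊕ T} :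
    Orb (Sum.map a a') (Sum.map b b') p q ↔ Sum.LiftRel (Orb a b) (Orb a' b') p q := by
  constructor
  · refine fun h => h.lift (s := Sum.LiftRel (Orb a b) (Orb a' b')) ⟨?_, ?_, ?_⟩ id ?_ ?_
    · rintro (f | f)
      exacts [.inl (Orb.refl f), .inr (Orb.refl f)]
    · rintro _ _ (h | h)
      exacts [.inl h.symm, .inr h.symm]
    · rintro _ _ _ (h | h) (h' | h')
      exacts [.inl (h.trans h'), .inr (h.trans h')]
    · rintro (f | f)
      exacts [.inl (Orb.left f), .inr (Orb.left f)]
    · rintro (f | f)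
      exacts [.inl (Orb.right f), .inr (Orb.right f)]
  · rintro (h | h)
    · exact h.map Sum.inl (fun f => Orb.left (a := Sum.map a a') (Sum.inl f))
        (fun f => Orb.right (b := Sum.map b b') (Sum.inl f))
    · exact h.map Sum.inr (fun f => Orb.left (a := Sum.map a a') (Sum.inr f))
        (fun f => Orb.right (b := Sum.map b b') (Sum.inr f))

/-- The equivalence relation obtained from `r` by joining the classes of `x` and `t`. -/
def JoinRel {F : Type*} (r : F → F → Prop) (x t : F) (f g : F) : Prop :=
  r f g ∨ ((r f x ∨ r f t) ∧ (r g x ∨ r g t))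

theorem JoinRel.equivalence {F : Type*} {r : F → F → Prop} (hr : Equivalence r) (x t : F) :
    Equivalence (JoinRel r x t) where
  refl f := Or.inl (hr.refl f)
  symm := by
    rintro f g (h | h)
    exacts [Or.inl (hr.symm h), Or.inr h.symm]
  trans := by
    have key : ∀ {f g}, r f g → (r f x ∨ r f t) → (r g x ∨ r g t) := fun h =>
      Or.imp (hr.trans (hr.symm h)) (hr.trans (hr.symm h))
    rintro f g k (h | h) (h' | h')
    · exact Or.inl (hr.trans h h')
    · exact Or.inr ⟨key (hr.symm h) h'.1, h'.2⟩
    · exact Or.inr ⟨h.1, key h' h.2⟩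
    · exact Or.inr ⟨h.1, h'.2⟩

/-- Joining two classes lowers the number of classes by one. -/
theorem card_quot_join {F : Type*} [Finite F] {r s : F → F → Prop} (hr : Equivalence r)
    {x t : F} (hxt : ¬ r x t) (h : ∀ f g, s f g ↔ JoinRel r x t f g) :
    Nat.card (Quot r) = Nat.card (Quot s) + 1 := by
  classical
  obtain rfl : s = JoinRel r x t := funext fun f => funext fun g => propext (h f g)
  have hrs : ∀ f g, Quot.mk (JoinRel r x t) f = Quot.mk (JoinRel r x t) g ↔ JoinRel r x t f g :=
    fun f g => by rw [Quot.eq, (JoinRel.equivalence hr x t).eqvGen_iff]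
  have hrr : ∀ f g, Quot.mk r f = Quot.mk r g ↔ r f g := fun f g => by
    rw [Quot.eq, hr.eqvGen_iff]
  rw [← Finite.card_option]
  let φ : Quot r → Option (Quot (JoinRel r x t)) := Quot.lift
    (fun f => if r f x then none else some (Quot.mk _ f)) (by
      intro f g hfg
      have : r f x ↔ r g x := ⟨fun h => hr.trans (hr.symm hfg) h, fun h => hr.trans hfg h⟩
      by_cases hf : r f x
      · simp [hf, this.1 hf]
      · simp only [hf, if_false, mt this.2 hf, Option.some.injEq, hrs]
        exact Or.inl hfg)
  have hφ : ∀ f, φ (Quot.mk r f) = if r f x then none else some (Quot.mk _ f) := fun f => rfl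
  refine Nat.card_congr (Equiv.ofBijective φ ⟨?_, ?_⟩)
  · intro f g hfg
    induction f using Quot.ind with | mk f
    induction g using Quot.ind with | mk g
    rw [hφ, hφ] at hfg
    split_ifs at hfg with h1 h2 h2
    · exact (hrr _ _).2 (hr.trans h1 (hr.symm h2))
    · rw [Option.some.injEq, hrs] at hfg
      rcases hfg with h3 | h3
      · exact (hrr _ _).2 h3
      · exact (hrr _ _).2 (hr.trans (h3.1.resolve_left h1) (hr.symm (h3.2.resolve_left h2)))
  · rintro (_ | f)
    · exact ⟨Quot.mk r x, by rw [hφ, if_pos (hr.refl x)]⟩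
    · induction f using Quot.ind with | mk f
      by_cases hf : r f x
      · refine ⟨Quot.mk r t, ?_⟩
        rw [hφ, if_neg fun h => hxt (hr.symm h), Option.some.injEq]
        exact (hrs _ _).2 (Or.inr ⟨Or.inr (hr.refl t), Or.inl hf⟩)
      · exact ⟨Quot.mk r f, by rw [hφ, if_neg hf]⟩

theorem Function.Involutive.even_card_of_ne {F : Type*} [Finite F] {a : F → F}
    (ha : Function.Involutive a) (h : ∀ f, a f ≠ f) : Even (Nat.card F) := by
  classical
  have := Fintype.ofFinite F
  rw [Nat.card_eq_fintype_card]
  have h1 := Finset.sum_involution (s := Finset.univ) (f := fun _ : F => (1 : ZMod 2))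
    (fun f _ => a f) (fun _ _ => by decide) (fun f _ _ => h f) (fun _ _ => Finset.mem_univ _)
    (fun f _ => ha f)
  rw [Finset.sum_const, Finset.card_univ, nsmul_one, ZMod.natCast_eq_zero_iff] at h1
  exact even_iff_two_dvd.2 h1

/-! ### Euler's inequality -/

namespace FlagMap

/-- The relation "`g` is `f` or `r f`" for an involution `r`. -/
theorem side_eq_iff {F : Type*} {r : F → F} (hr : Function.Involutive r) {f g : F} :
    (Quot.mk (fun f g => g = r f) f = Quot.mk (fun f g => g = r f) g) ↔ g = f ∨ g = r f := by
  constructor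
  · intro h
    replace h := Quot.eqvGen_exact h
    induction h with
    | rel x y hxy => exact Or.inr hxy
    | refl x => exact Or.inl rfl
    | symm x y _ ih => rcases ih with rfl | rfl
                       · exact Or.inl rfl
                       · exact Or.inr (hr _).symm
    | trans x y z _ _ ih₁ ih₂ =>
      rcases ih₁ with rfl | rfl <;> rcases ih₂ with rfl | rfl
      · exact Or.inl rfl
      · exact Or.inr rfl
      · exact Or.inr rfl
      · exact Or.inl (hr _)
  · rintro (rfl | rfl)
    · rfl
    · exact Quot.sound rfl

variable {F : Type*} (M : FlagMap F)

/-- The three kinds of points (vertices, edge midpoints and face centres). -/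
abbrev Points : Type _ := Quot M.SameVertex ⊕ Quot M.SameEdge ⊕ Quot M.SameFace

/-- The three kinds of sides of flags. -/
abbrev Sides : Type _ := Quot (fun f g => g = M.r0 f) ⊕ Quot (fun f g => g = M.r1 f) ⊕
  Quot (fun f g => g = M.r2 f)

/-- The coboundary of a function on the points: on a side it is the sum of the values at the
two ends. -/
noncomputable def coboundary₀ : (M.Points → ZMod 2) →ₗ[ZMod 2] (M.Sides → ZMod 2) where
  toFun φ := Sum.elim
    (fun s => φ (.inr (.inl (Quot.mk _ s.out))) + φ (.inr (.inr (Quot.mk _ s.out))))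
    (Sum.elim (fun s => φ (.inl (Quot.mk _ s.out)) + φ (.inr (.inr (Quot.mk _ s.out))))
      (fun s => φ (.inl (Quot.mk _ s.out)) + φ (.inr (.inl (Quot.mk _ s.out)))))
  map_add' φ ψ := by
    ext (s | s | s) <;> simp <;> ring
  map_smul' c φ := by
    ext (s | s | s) <;> simp <;> ring

/-- The coboundary of a function on the sides: on a flag it is the sum of the values at its three
sides. -/
def coboundary₁ : (M.Sides → ZMod 2) →ₗ[ZMod 2] (F → ZMod 2) where
  toFun ψ f := ψ (.inl (Quot.mk _ f)) + ψ (.inr (.inl (Quot.mk _ f))) +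
    ψ (.inr (.inr (Quot.mk _ f)))
  map_add' φ ψ := by ext f; simp; ring
  map_smul' c φ := by ext f; simp; ring

theorem mk_out_eq {r : F → F} (hr : Function.Involutive r) {s : F → F → Prop}
    (h : ∀ f, s f (r f)) (f : F) :
    Quot.mk s (Quot.mk (fun f g => g = r f) f).out = Quot.mk s f := by
  have := Quot.out_eq (Quot.mk (fun f g => g = r f) f)
  rw [side_eq_iff hr] at this
  rcases this with h' | h'
  · rw [← h']
  · conv_rhs => rw [h']
    exact Quot.sound (h _)

theorem coboundary₀_side0 (φ : M.Points → ZMod 2) (f : F) :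
    M.coboundary₀ φ (.inl (Quot.mk _ f)) =
      φ (.inr (.inl (Quot.mk _ f))) + φ (.inr (.inr (Quot.mk _ f))) := by
  change φ (.inr (.inl (Quot.mk _ _))) + φ (.inr (.inr (Quot.mk _ _))) = _
  rw [mk_out_eq (s := M.SameEdge) M.r0_invol (fun f => Orb.left f),
    mk_out_eq (s := M.SameFace) M.r0_invol (fun f => Orb.left f)]

theorem coboundary₀_side1 (φ : M.Points → ZMod 2) (f : F) :
    M.coboundary₀ φ (.inr (.inl (Quot.mk _ f))) =
      φ (.inl (Quot.mk _ f)) + φ (.inr (.inr (Quot.mk _ f))) := by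
  change φ (.inl (Quot.mk _ _)) + φ (.inr (.inr (Quot.mk _ _))) = _
  rw [mk_out_eq (s := M.SameVertex) M.r1_invol (fun f => Orb.left f),
    mk_out_eq (s := M.SameFace) M.r1_invol (fun f => Orb.right f)]

theorem coboundary₀_side2 (φ : M.Points → ZMod 2) (f : F) :
    M.coboundary₀ φ (.inr (.inr (Quot.mk _ f))) =
      φ (.inl (Quot.mk _ f)) + φ (.inr (.inl (Quot.mk _ f))) := by
  change φ (.inl (Quot.mk _ _)) + φ (.inr (.inl (Quot.mk _ _))) = _
  rw [mk_out_eq (s := M.SameVertex) M.r2_invol (fun f => Orb.right f),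
    mk_out_eq (s := M.SameEdge) M.r2_invol (fun f => Orb.right f)]

theorem coboundary₁_coboundary₀ (φ : M.Points → ZMod 2) : M.coboundary₁ (M.coboundary₀ φ) = 0 := by
  ext f
  change M.coboundary₀ φ _ + M.coboundary₀ φ _ + M.coboundary₀ φ _ = 0
  rw [coboundary₀_side0, coboundary₀_side1, coboundary₀_side2]
  generalize φ (.inl (Quot.mk _ f)) = a
  generalize φ (.inr (.inl (Quot.mk _ f))) = b
  generalize φ (.inr (.inr (Quot.mk _ f))) = c
  revert a b c
  decide

open Module in
/-- A cocycle on the points of a connected map is determined by its value at one vertex. -/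
theorem finrank_ker_coboundary₀_le [Finite F] (hM : M.Connected) (f₀ : F) :
    finrank (ZMod 2) (LinearMap.ker M.coboundary₀) ≤ 1 := by
  classical
  have := Fintype.ofFinite F
  let ev : LinearMap.ker M.coboundary₀ →ₗ[ZMod 2] ZMod 2 :=
    (LinearMap.proj (.inl (Quot.mk _ f₀))).comp (Submodule.subtype _)
  have hinj : Function.Injective ev := by
    rw [← LinearMap.ker_eq_bot, LinearMap.ker_eq_bot']
    rintro ⟨φ, hφ⟩ h0
    replace h0 : φ (.inl (Quot.mk _ f₀)) = 0 := h0
    have hφ : M.coboundary₀ φ = 0 := hφ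
    have add0 : ∀ x y : ZMod 2, x + y = 0 → x = y := by decide
    have h0' : ∀ f, φ (.inr (.inl (Quot.mk _ f))) = φ (.inl (Quot.mk _ f)) := fun f => by
      refine (add0 _ _ ?_).symm
      rw [← coboundary₀_side2, hφ]; rfl
    have h0'' : ∀ f, φ (.inr (.inr (Quot.mk _ f))) = φ (.inl (Quot.mk _ f)) := fun f => by
      refine (add0 _ _ ?_).symm
      rw [← coboundary₀_side1, hφ]; rfl
    have hall : ∀ f, φ (.inl (Quot.mk _ f)) = 0 := by
      intro f
      rw [← h0]
      refine eqvGen_lift (s := fun p q : F => φ (.inl (Quot.mk _ q)) = φ (.inl (Quot.mk _ p)))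
        ⟨fun _ => rfl, Eq.symm, fun h1 h2 => h2.trans h1⟩ id ?_ (hM f₀ f)
      rintro f g (rfl | rfl | rfl)
      · rw [id, id, ← h0', ← h0']
        exact congrArg (fun e => φ (.inr (.inl e))) (Quot.sound (Orb.left f).symm)
      · exact congrArg (fun e => φ (.inl e)) (Quot.sound (Orb.left f).symm)
      · exact congrArg (fun e => φ (.inl e)) (Quot.sound (Orb.right f).symm)
    ext s
    rcases s with s | s | s <;> induction s using Quot.ind with | mk f
    · exact hall f
    · exact (h0' f).trans (hall f)
    · exact (h0'' f).trans (hall f)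
  simpa using LinearMap.finrank_le_finrank_of_injective hinj

/-- The indicator functions of any two neighbouring flags agree modulo coboundaries, and the
indicator function of a flag with a side on the boundary is a coboundary. -/
theorem exists_coboundary₁ [DecidableEq F] (f : F) {g : F}
    (hg : g = M.r0 f ∨ g = M.r1 f ∨ g = M.r2 f) :
    (if g = f then Pi.single f 1 else Pi.single f 1 + Pi.single g 1 : F → ZMod 2) ∈
      LinearMap.range M.coboundary₁ := by
  classical
  obtain ⟨s, hs⟩ : ∃ s : M.Sides, ∀ h, M.coboundary₁ (Pi.single s 1) h =
      if h = f ∨ h = g then 1 else 0 := by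
    rcases hg with rfl | rfl | rfl
    · refine ⟨.inl (Quot.mk _ f), fun h => ?_⟩
      change Pi.single (M := fun _ => ZMod 2) _ _ _ + Pi.single (M := fun _ => ZMod 2) _ _ _ +
        Pi.single (M := fun _ => ZMod 2) _ _ _ = _
      simp only [Pi.single_apply, Sum.inl.injEq, reduceCtorEq, if_false, add_zero]
      exact if_congr (eq_comm.trans (side_eq_iff M.r0_invol)) rfl rfl
    · refine ⟨.inr (.inl (Quot.mk _ f)), fun h => ?_⟩
      change Pi.single (M := fun _ => ZMod 2) _ _ _ + Pi.single (M := fun _ => ZMod 2) _ _ _ +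
        Pi.single (M := fun _ => ZMod 2) _ _ _ = _
      simp only [Pi.single_apply, Sum.inl.injEq, Sum.inr.injEq, reduceCtorEq, if_false, add_zero,
        zero_add]
      exact if_congr (eq_comm.trans (side_eq_iff M.r1_invol)) rfl rfl
    · refine ⟨.inr (.inr (Quot.mk _ f)), fun h => ?_⟩
      change Pi.single (M := fun _ => ZMod 2) _ _ _ + Pi.single (M := fun _ => ZMod 2) _ _ _ +
        Pi.single (M := fun _ => ZMod 2) _ _ _ = _
      simp only [Pi.single_apply, Sum.inr.injEq, reduceCtorEq, if_false, add_zero, zero_add]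
      exact if_congr (eq_comm.trans (side_eq_iff M.r2_invol)) rfl rfl
  refine ⟨Pi.single s 1, ?_⟩
  ext h
  rw [hs]
  split_ifs with h1 h2 h2
  · subst h2; simp at h1; simp [h1]
  · rcases h1 with rfl | rfl
    · simp [Ne.symm h2]
    · simp [h2]
  · subst h2; simp at h1; simp [h1]
  · simp only [not_or] at h1
    simp [h1.1, h1.2]

open Module in
/-- The top cohomology of a connected surface with coefficients in `ZMod 2` has dimension at most
`1`, and it vanishes if there is a boundary. -/
theorem card_le_finrank_range_coboundary₁ [Finite F] (hM : M.Connected) (f₀ : F) :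
    Nat.card F ≤ finrank (ZMod 2) (LinearMap.range M.coboundary₁) + 1 ∧
    ((M.r0 f₀ = f₀ ∨ M.r1 f₀ = f₀ ∨ M.r2 f₀ = f₀) →
      Nat.card F ≤ finrank (ZMod 2) (LinearMap.range M.coboundary₁)) := by
  classical
  have := Fintype.ofFinite F
  -- modulo coboundaries the indicator functions of all flags agree
  have key : ∀ W : Submodule (ZMod 2) (F → ZMod 2), LinearMap.range M.coboundary₁ ≤ W →
      Pi.single f₀ 1 ∈ W → W = ⊤ := by
    intro W hW h0
    have hall : ∀ f, (Pi.single f 1 : F → ZMod 2) ∈ W := by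
      intro f
      refine (eqvGen_lift (s := fun p q : F => ((Pi.single p 1 : F → ZMod 2) ∈ W ↔
        (Pi.single q 1 : F → ZMod 2) ∈ W)) ⟨fun _ => Iff.rfl, Iff.symm, Iff.trans⟩ id ?_
        (hM f₀ f)).1 h0
      intro f g hfg
      have h := hW (M.exists_coboundary₁ f hfg)
      split_ifs at h with h1
      · rw [h1]
      · exact ⟨fun h2 => (W.add_mem_iff_right h2).1 h, fun h2 => (W.add_mem_iff_left h2).1 h⟩
    rw [eq_top_iff]
    intro φ _
    rw [pi_eq_sum_univ' φ]
    refine W.sum_mem fun f _ => W.smul_mem _ ?_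
    convert hall f using 1
  constructor
  · have h := key (LinearMap.range M.coboundary₁ ⊔ Submodule.span (ZMod 2) {Pi.single f₀ 1})
      le_sup_left (Submodule.mem_sup_right (Submodule.mem_span_singleton_self _))
    have h1 := Submodule.finrank_add_le_finrank_add_finrank (LinearMap.range M.coboundary₁)
      (Submodule.span (ZMod 2) {(Pi.single f₀ 1 : F → ZMod 2)})
    rw [h, finrank_top, finrank_fintype_fun_eq_card, ← Nat.card_eq_fintype_card] at h1
    have h2 := finrank_span_singleton (K := ZMod 2) (v := (Pi.single f₀ 1 : F → ZMod 2)) (by simp)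
    omega
  · intro hf
    have h := key (LinearMap.range M.coboundary₁) le_rfl (by
      obtain ⟨g, hg, hgf⟩ : ∃ g, (g = M.r0 f₀ ∨ g = M.r1 f₀ ∨ g = M.r2 f₀) ∧ g = f₀ := by
        rcases hf with h | h | h
        exacts [⟨_, Or.inl rfl, h⟩, ⟨_, Or.inr (Or.inl rfl), h⟩, ⟨_, Or.inr (Or.inr rfl), h⟩]
      have := M.exists_coboundary₁ f₀ hg
      rwa [if_pos hgf] at this)
    rw [h, finrank_top, finrank_fintype_fun_eq_card, Nat.card_eq_fintype_card]

open Module in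
/-- Euler's inequality: the Euler characteristic of a connected surface is at most `2`, and at
most `1` if the surface has a boundary. With coefficients in `ZMod 2` the Euler characteristic is
`h⁰ - h¹ + h²`, where `h⁰ ≤ 1` and `h² ≤ 1`, and `h² = 0` if there is a boundary. -/
theorem eulerChar_le [Finite F] (hM : M.Connected) (f₀ : F) :
    M.eulerChar ≤ 2 ∧
    ((M.r0 f₀ = f₀ ∨ M.r1 f₀ = f₀ ∨ M.r2 f₀ = f₀) → M.eulerChar ≤ 1) := by
  classical
  have := Fintype.ofFinite F
  have := Fintype.ofFinite M.Points
  have := Fintype.ofFinite M.Sides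
  have h0 := LinearMap.finrank_range_add_finrank_ker M.coboundary₀
  have h1 := LinearMap.finrank_range_add_finrank_ker M.coboundary₁
  have hle : finrank (ZMod 2) (LinearMap.range M.coboundary₀) ≤
      finrank (ZMod 2) (LinearMap.ker M.coboundary₁) := by
    refine Submodule.finrank_mono ?_
    rintro _ ⟨φ, rfl⟩
    exact M.coboundary₁_coboundary₀ φ
  have hker := M.finrank_ker_coboundary₀_le hM f₀
  have hran := M.card_le_finrank_range_coboundary₁ hM f₀
  rw [finrank_fintype_fun_eq_card, ← Nat.card_eq_fintype_card] at h0 h1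
  have hP : Nat.card M.Points = Nat.card (Quot M.SameVertex) + Nat.card (Quot M.SameEdge) +
      Nat.card (Quot M.SameFace) := by
    rw [Nat.card_sum, Nat.card_sum, add_assoc]
  have hS : Nat.card M.Sides = numSides M.r0 + numSides M.r1 + numSides M.r2 := by
    rw [Nat.card_sum, Nat.card_sum, add_assoc]; rfl
  unfold eulerChar
  rw [← hP, ← hS]
  refine ⟨by have := hran.1; omega, fun h => by have := hran.2 h; omega⟩

end FlagMap

/-! ### Isomorphisms and isomorphism classes -/

namespace FlagMap

/-- An isomorphism of maps is a bijection of the flags that commutes with the adjacencies. -/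
structure Iso {F G : Type*} (M : FlagMap F) (N : FlagMap G) extends F ≃ G where
  map_r0 : ∀ f, toEquiv (M.r0 f) = N.r0 (toEquiv f)
  map_r1 : ∀ f, toEquiv (M.r1 f) = N.r1 (toEquiv f)
  map_r2 : ∀ f, toEquiv (M.r2 f) = N.r2 (toEquiv f)

namespace Iso

variable {F G H : Type*} {M : FlagMap F} {N : FlagMap G} {K : FlagMap H}

/-- The identity. -/
def refl (M : FlagMap F) : Iso M M := ⟨Equiv.refl F, fun _ => rfl, fun _ => rfl, fun _ => rfl⟩

/-- The inverse isomorphism. -/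
def symm (e : Iso M N) : Iso N M where
  toEquiv := e.toEquiv.symm
  map_r0 f := by rw [Equiv.symm_apply_eq, e.map_r0, Equiv.apply_symm_apply]
  map_r1 f := by rw [Equiv.symm_apply_eq, e.map_r1, Equiv.apply_symm_apply]
  map_r2 f := by rw [Equiv.symm_apply_eq, e.map_r2, Equiv.apply_symm_apply]

/-- The composition of isomorphisms. -/
def trans (e : Iso M N) (e' : Iso N K) : Iso M K where
  toEquiv := e.toEquiv.trans e'.toEquiv
  map_r0 f := by simp [e.map_r0, e'.map_r0]
  map_r1 f := by simp [e.map_r1, e'.map_r1]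
  map_r2 f := by simp [e.map_r2, e'.map_r2]

theorem symm_apply_apply (e : Iso M N) (f : F) : e.symm.toEquiv (e.toEquiv f) = f :=
  e.toEquiv.symm_apply_apply f

theorem apply_symm_apply (e : Iso M N) (f : G) : e.toEquiv (e.symm.toEquiv f) = f :=
  e.toEquiv.apply_symm_apply f

theorem sameVertex (e : Iso M N) {f g : F} (h : M.SameVertex f g) :
    N.SameVertex (e.toEquiv f) (e.toEquiv g) :=
  Orb.map e.toEquiv (fun f => e.map_r1 f ▸ Orb.left _) (fun f => e.map_r2 f ▸ Orb.right _) h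

theorem sameVertex_iff (e : Iso M N) {f g : F} :
    N.SameVertex (e.toEquiv f) (e.toEquiv g) ↔ M.SameVertex f g :=
  ⟨fun h => by simpa only [symm_apply_apply] using e.symm.sameVertex h, e.sameVertex⟩

theorem sameVertex_iff' (e : Iso M N) {f : F} {g : G} :
    N.SameVertex (e.toEquiv f) g ↔ M.SameVertex f (e.symm.toEquiv g) := by
  rw [← e.sameVertex_iff, e.apply_symm_apply]

theorem card_orb_eq (e : F ≃ G) {a b : F → F} {a' b' : G → G} (ha : ∀ f, e (a f) = a' (e f))
    (hb : ∀ f, e (b f) = b' (e f)) : Nat.card (Quot (Orb a b)) = Nat.card (Quot (Orb a' b')) :=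
  Orb.card_quot_congr e e.symm (fun f => ha f ▸ Orb.left _) (fun f => hb f ▸ Orb.right _)
    (fun f => by
      have : e.symm (a' f) = a (e.symm f) := by rw [Equiv.symm_apply_eq, ha, e.apply_symm_apply]
      exact this ▸ Orb.left _)
    (fun f => by
      have : e.symm (b' f) = b (e.symm f) := by rw [Equiv.symm_apply_eq, hb, e.apply_symm_apply]
      exact this ▸ Orb.right _)
    (fun f => by rw [e.symm_apply_apply]) (fun f => by rw [e.apply_symm_apply])

theorem numSides_eq (e : F ≃ G) {a : F → F} {a' : G → G} (ha : ∀ f, e (a f) = a' (e f)) :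
    numSides a = numSides a' :=
  card_quot_congr e e.symm (by rintro f _ rfl; exact Quot.sound (ha f))
    (by
      rintro f _ rfl
      refine Quot.sound ?_
      rw [Equiv.symm_apply_eq, ha, e.apply_symm_apply])
    (fun f => by rw [e.symm_apply_apply]) (fun f => by rw [e.apply_symm_apply])

theorem eulerChar_eq (e : Iso M N) : M.eulerChar = N.eulerChar := by
  have h1 : Nat.card (Quot M.SameVertex) = Nat.card (Quot N.SameVertex) :=
    card_orb_eq e.toEquiv e.map_r1 e.map_r2
  have h2 : Nat.card (Quot M.SameEdge) = Nat.card (Quot N.SameEdge) :=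
    card_orb_eq e.toEquiv e.map_r0 e.map_r2
  have h3 : Nat.card (Quot M.SameFace) = Nat.card (Quot N.SameFace) :=
    card_orb_eq e.toEquiv e.map_r0 e.map_r1
  rw [eulerChar, eulerChar, h1, h2, h3, numSides_eq e.toEquiv e.map_r0,
    numSides_eq e.toEquiv e.map_r1, numSides_eq e.toEquiv e.map_r2, Nat.card_congr e.toEquiv]

theorem connected (e : Iso M N) (h : M.Connected) : N.Connected := by
  intro f g
  rw [← e.apply_symm_apply f, ← e.apply_symm_apply g]
  refine eqvGen_lift (eqvGen_equivalence _) e.toEquiv ?_ (h _ _)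
  rintro f g (rfl | rfl | rfl)
  · exact .rel _ _ (.inl (e.map_r0 f))
  · exact .rel _ _ (.inr (.inl (e.map_r1 f)))
  · exact .rel _ _ (.inr (.inr (e.map_r2 f)))

theorem orientable (e : Iso M N) (h : M.Orientable) : N.Orientable := by
  obtain ⟨c, hc⟩ := h
  refine ⟨fun f => c (e.symm.toEquiv f), fun f => ?_⟩
  beta_reduce
  rw [e.symm.map_r0, e.symm.map_r1, e.symm.map_r2]
  obtain ⟨h0, h1, h2⟩ := hc (e.symm.toEquiv f)
  refine ⟨fun h => h0 fun h' => h ?_, fun h => h1 fun h' => h ?_, fun h => h2 fun h' => h ?_⟩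
  · rw [← e.apply_symm_apply (N.r0 f), e.symm.map_r0, h', e.apply_symm_apply]
  · rw [← e.apply_symm_apply (N.r1 f), e.symm.map_r1, h', e.apply_symm_apply]
  · rw [← e.apply_symm_apply (N.r2 f), e.symm.map_r2, h', e.apply_symm_apply]

theorem isDisk (e : Iso M N) (h : M.IsDisk) : N.IsDisk :=
  ⟨e.connected h.1, e.orientable h.2.1, e.eulerChar_eq ▸ h.2.2⟩

theorem isSphere (e : Iso M N) (h : M.IsSphere) : N.IsSphere :=
  ⟨e.connected h.1, e.orientable h.2.1, e.eulerChar_eq ▸ h.2.2⟩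

theorem interiorVertex (e : Iso M N) {f : F} (h : M.InteriorVertex f) :
    N.InteriorVertex (e.toEquiv f) := by
  intro g hg
  have := h _ (e.sameVertex_iff'.1 hg)
  rw [← e.symm.map_r1, ← e.symm.map_r2] at this
  exact ⟨fun h => this.1 (by rw [h]), fun h => this.2 (by rw [h])⟩

theorem innerFlags_eq (e : Iso M N) (f : F) : N.innerFlags (e.toEquiv f) = M.innerFlags f := by
  refine (Nat.card_congr (e.toEquiv.subtypeEquiv fun g => ?_)).symm
  rw [e.sameVertex_iff, ← e.map_r2, Ne, Ne, e.toEquiv.injective.eq_iff]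

theorem boundaryDarts_eq (e : Iso M N) (f : F) :
    N.boundaryDarts (e.toEquiv f) = M.boundaryDarts f := by
  refine (Nat.card_congr (e.toEquiv.subtypeEquiv fun g => ?_)).symm
  rw [e.sameVertex_iff, ← e.map_r2, e.toEquiv.injective.eq_iff]

end Iso

/-- The map on `G` obtained from a map on `F` by renaming the flags. -/
def transport {F G : Type*} (M : FlagMap F) (e : F ≃ G) : FlagMap G where
  r0 g := e (M.r0 (e.symm g))
  r1 g := e (M.r1 (e.symm g))
  r2 g := e (M.r2 (e.symm g))
  r0_invol g := by simp [M.r0_invol _]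
  r1_invol g := by simp [M.r1_invol _]
  r2_invol g := by simp [M.r2_invol _]
  r0_r2_comm g := by simp [M.r0_r2_comm]
  r0_ne_r2 g := by simpa using M.r0_ne_r2 _

/-- Renaming the flags is an isomorphism. -/
def transportIso {F G : Type*} (M : FlagMap F) (e : F ≃ G) : Iso M (M.transport e) where
  toEquiv := e
  map_r0 f := by simp [transport]
  map_r1 f := by simp [transport]
  map_r2 f := by simp [transport]

theorem card_even {F : Type*} [Finite F] (M : FlagMap F) : Even (Nat.card F) := by
  refine Function.Involutive.even_card_of_ne (a := fun f => M.r0 (M.r2 f)) (fun f => ?_) fun f h =>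
    M.r0_ne_r2 f ?_
  · beta_reduce
    rw [← M.r0_r2_comm, M.r0_invol, M.r2_invol]
  · rw [← M.r0_invol (M.r2 f), h]

theorem innerFlags_even {F : Type*} [Finite F] (M : FlagMap F) (f : F) :
    Even (M.innerFlags f) := by
  refine Function.Involutive.even_card_of_ne
    (a := fun g : {g // M.SameVertex f g ∧ M.r2 g ≠ g} =>
      ⟨M.r2 g, Orb.right_iff.2 g.2.1, fun h => g.2.2 (M.r2_invol.injective h)⟩)
    (fun g => Subtype.ext (M.r2_invol _)) fun g h => g.2.2 (congrArg Subtype.val h)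

instance {F : Type*} [Finite F] : Finite (FlagMap F) :=
  Finite.of_injective (fun M : FlagMap F => (M.r0, M.r1, M.r2)) (by
    rintro ⟨⟩ ⟨⟩ h
    simp only [Prod.mk.injEq] at h
    obtain ⟨rfl, rfl, rfl⟩ := h
    rfl)

end FlagMap

/-- A rooted map on an arbitrary finite set of flags. -/
structure RootedMap where
  F : Type
  fin : Finite F
  M : FlagMap F
  root : F

namespace RootedMap

instance (X : RootedMap) : Finite X.F := X.fin

/-- Rooted maps are isomorphic if an isomorphism takes root to root. -/
instance setoid : Setoid RootedMap where
  r X Y := ∃ e : X.M.Iso Y.M, e.toEquiv X.root = Y.root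
  iseqv :=
    { refl := fun X => ⟨.refl _, rfl⟩
      symm := fun ⟨e, he⟩ => ⟨e.symm, by rw [← he, e.symm_apply_apply]⟩
      trans := fun ⟨e, he⟩ ⟨e', he'⟩ => ⟨e.trans e', by rw [← he', ← he]; rfl⟩ }

/-- The isomorphism class of a rooted map. -/
def cls (X : RootedMap) : Quotient setoid := Quotient.mk _ X

theorem cls_eq_iff {X Y : RootedMap} :
    X.cls = Y.cls ↔ ∃ e : X.M.Iso Y.M, e.toEquiv X.root = Y.root :=
  Quotient.eq (r := setoid)

/-- The number of darts. -/
noncomputable def darts (X : RootedMap) : ℕ := Nat.card X.F / 2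

theorem two_mul_darts (X : RootedMap) : 2 * X.darts = Nat.card X.F :=
  Nat.mul_div_cancel' X.M.card_even.two_dvd

/-- Half the number of flags of inner darts at the root vertex, that is, the number of inner
darts there. -/
noncomputable def degree (X : RootedMap) : ℕ := X.M.innerFlags X.root / 2

theorem two_mul_degree (X : RootedMap) : 2 * X.degree = X.M.innerFlags X.root :=
  Nat.mul_div_cancel' (X.M.innerFlags_even _).two_dvd

theorem darts_congr {X Y : RootedMap} (h : X.cls = Y.cls) : X.darts = Y.darts := by
  obtain ⟨e, -⟩ := cls_eq_iff.1 h
  rw [darts, darts, Nat.card_congr e.toEquiv]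

theorem degree_congr {X Y : RootedMap} (h : X.cls = Y.cls) : X.degree = Y.degree := by
  obtain ⟨e, he⟩ := cls_eq_iff.1 h
  rw [degree, degree, ← he, e.innerFlags_eq]

/-- The number of isomorphism classes of rooted maps with the property `P`. -/
noncomputable def count (P : RootedMap → Prop) : ℕ := (cls '' {X | P X}).ncard

theorem finite_classes (n : ℕ) : (cls '' {X | X.darts = n}).Finite := by
  refine (Set.finite_range fun p : FlagMap (Fin (2 * n)) × Fin (2 * n) =>
    cls ⟨Fin (2 * n), inferInstance, p.1, p.2⟩).subset ?_
  rintro _ ⟨X, hX, rfl⟩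
  have hc : Nat.card X.F = 2 * n := by rw [← X.two_mul_darts, hX]
  let e := Finite.equivFinOfCardEq hc
  exact ⟨(X.M.transport e, e X.root), (cls_eq_iff.2 ⟨X.M.transportIso e, rfl⟩).symm⟩

theorem finite_of_darts {P : RootedMap → Prop} {n : ℕ} (h : ∀ X, P X → X.darts = n) :
    (cls '' {X | P X}).Finite :=
  (finite_classes n).subset (Set.image_mono h)

/-- Counting rooted maps on the standard sets of flags is counting isomorphism classes. -/
theorem numRooted_eq_count (n : ℕ) (P : RootedMap → Prop)
    (hP : ∀ X Y : RootedMap, X.cls = Y.cls → P X → P Y) :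
    numRooted n (fun M f => P ⟨Fin (2 * n), inferInstance, M, f⟩) =
      count fun X => X.darts = n ∧ P X := by
  have hcard : ∀ (M : FlagMap (Fin (2 * n))) (f : Fin (2 * n)),
      RootedMap.darts ⟨Fin (2 * n), inferInstance, M, f⟩ = n := fun M f => by
    simp [darts]
  rw [count, ← Nat.card_coe_set_eq, numRooted]
  refine Nat.card_congr (Equiv.ofBijective (Quot.lift
    (fun A => ⟨cls ⟨Fin (2 * n), inferInstance, A.1.1, A.1.2⟩, _, ⟨hcard _ _, A.2⟩, rfl⟩) ?_)
    ⟨?_, ?_⟩)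
  · rintro A B ⟨e, he, h⟩
    exact Subtype.ext (cls_eq_iff.2 ⟨⟨e, fun f => (h f).1, fun f => (h f).2.1,
      fun f => (h f).2.2⟩, he⟩)
  · rintro ⟨A⟩ ⟨B⟩ h
    obtain ⟨e, he⟩ := cls_eq_iff.1 (congrArg Subtype.val h)
    exact Quot.sound ⟨e.toEquiv, he, fun f => ⟨e.map_r0 f, e.map_r1 f, e.map_r2 f⟩⟩
  · rintro ⟨_, X, ⟨hX, hPX⟩, rfl⟩
    have hc : Nat.card X.F = 2 * n := by rw [← X.two_mul_darts, hX]
    let e := Finite.equivFinOfCardEq hc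
    have he : X.cls = cls ⟨Fin (2 * n), inferInstance, X.M.transport e, e X.root⟩ :=
      cls_eq_iff.2 ⟨X.M.transportIso e, rfl⟩
    exact ⟨Quot.mk _ ⟨(X.M.transport e, e X.root), hP _ _ he hPX⟩, Subtype.ext he.symm⟩

end RootedMap

/-! ### Counting up to a relation -/

/-- A relation that matches the elements with the property `P` with those with the property `Q`,
and equal images under `u` with equal images under `v`, is a bijection between these images. -/
theorem ncard_image_eq_of_rel {A B U W : Type*} (u : A → U) (v : B → W) {P : A → Prop}
    {Q : B → Prop} (R : A → B → Prop) (h₁ : ∀ a, P a → ∃ b, Q b ∧ R a b)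
    (h₂ : ∀ b, Q b → ∃ a, P a ∧ R a b)
    (h₃ : ∀ a a' b b', P a → P a' → Q b → Q b' → R a b → R a' b' → (u a = u a' ↔ v b = v b')) :
    (u '' {a | P a}).ncard = (v '' {b | Q b}).ncard := by
  let Γ : Set (U × W) := {p | ∃ a b, P a ∧ Q b ∧ R a b ∧ p = (u a, v b)}
  have hf : Prod.fst '' Γ = u '' {a | P a} := by
    ext x
    constructor
    · rintro ⟨_, ⟨a, b, ha, hb, hab, rfl⟩, rfl⟩
      exact ⟨a, ha, rfl⟩
    · rintro ⟨a, ha, rfl⟩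
      obtain ⟨b, hb, hab⟩ := h₁ a ha
      exact ⟨_, ⟨a, b, ha, hb, hab, rfl⟩, rfl⟩
  have hs : Prod.snd '' Γ = v '' {b | Q b} := by
    ext x
    constructor
    · rintro ⟨_, ⟨a, b, ha, hb, hab, rfl⟩, rfl⟩
      exact ⟨b, hb, rfl⟩
    · rintro ⟨b, hb, rfl⟩
      obtain ⟨a, ha, hab⟩ := h₂ b hb
      exact ⟨_, ⟨a, b, ha, hb, hab, rfl⟩, rfl⟩
  rw [← hf, ← hs, Set.InjOn.ncard_image, Set.InjOn.ncard_image]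
  · rintro _ ⟨a, b, ha, hb, hab, rfl⟩ _ ⟨a', b', ha', hb', hab', rfl⟩ h
    exact Prod.ext ((h₃ a a' b b' ha ha' hb hb' hab hab').2 h) h
  · rintro _ ⟨a, b, ha, hb, hab, rfl⟩ _ ⟨a', b', ha', hb', hab', rfl⟩ h
    exact Prod.ext h ((h₃ a a' b b' ha ha' hb hb' hab hab').1 h)

theorem ncard_image_eq_sum {A U ι : Type*} [DecidableEq ι] (u : A → U) {P : A → Prop} (s : Finset ι)
    (inv : A → ι) (hfin : (u '' {a | P a}).Finite) (hs : ∀ a, P a → inv a ∈ s)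
    (hu : ∀ a a', P a → P a' → u a = u a' → inv a = inv a') :
    (u '' {a | P a}).ncard = ∑ i ∈ s, (u '' {a | P a ∧ inv a = i}).ncard := by
  have key : ∀ t : Finset ι, (u '' {a | P a ∧ inv a ∈ t}).ncard =
      ∑ i ∈ t, (u '' {a | P a ∧ inv a = i}).ncard := by
    intro t
    induction t using Finset.induction_on with
    | empty => simp
    | insert i t hi ih =>
      rw [Finset.sum_insert hi, ← ih, ← Set.ncard_union_eq ?_ (hfin.subset ?_) (hfin.subset ?_)]
      · rw [← Set.image_union]
        congr 2
        ext a
        simp only [Finset.mem_insert, Set.mem_ofPred_eq, Set.mem_union]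
        tauto
      · rw [Set.disjoint_left]
        rintro _ ⟨a, ⟨ha, hai⟩, rfl⟩ ⟨a', ⟨ha', hat⟩, h⟩
        rw [hu a' a ha' ha h, hai] at hat
        exact hi hat
      · exact Set.image_mono fun a ha => ha.1
      · exact Set.image_mono fun a ha => ha.1
  rw [← key]
  congr 2
  ext a
  exact ⟨fun h => ⟨h, hs a h⟩, fun h => h.1⟩

namespace RootedMap

theorem count_congr {P Q : RootedMap → Prop} (h : ∀ X, P X ↔ Q X) : count P = count Q := by
  rw [funext fun X => propext (h X)]

theorem count_eq_zero {P : RootedMap → Prop} (h : ∀ X, ¬ P X) : count P = 0 := by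
  rw [count, Set.eq_empty_of_forall_notMem (s := {X | P X}) h, Set.image_empty, Set.ncard_empty]

/-- Mutually inverse constructions that respect isomorphism show that two counts are equal. -/
theorem count_eq_of_maps {P Q : RootedMap → Prop} (φ ψ : RootedMap → RootedMap)
    (hφ : ∀ X, P X → Q (φ X)) (hψ : ∀ Y, Q Y → P (ψ Y))
    (iφ : ∀ X X', X.cls = X'.cls → (φ X).cls = (φ X').cls)
    (iψ : ∀ Y Y', Y.cls = Y'.cls → (ψ Y).cls = (ψ Y').cls)
    (h₁ : ∀ X, P X → ψ (φ X) = X) (h₂ : ∀ Y, Q Y → φ (ψ Y) = Y) : count P = count Q := by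
  refine ncard_image_eq_of_rel cls cls (fun X Y => φ X = Y) (fun X hX => ⟨_, hφ X hX, rfl⟩)
    (fun Y hY => ⟨_, hψ Y hY, h₂ Y hY⟩) ?_
  rintro X X' _ _ hX hX' - - rfl rfl
  exact ⟨iφ X X', fun h => by rw [← h₁ X hX, ← h₁ X' hX', iψ _ _ h]⟩

theorem count_add {P : RootedMap → Prop} {n : ℕ} (A : RootedMap → Prop)
    (hP : ∀ X, P X → X.darts = n) (hA : ∀ X Y : RootedMap, X.cls = Y.cls → A X → A Y) :
    count P = count (fun X => P X ∧ A X) + count (fun X => P X ∧ ¬ A X) := by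
  rw [count, count, count, ← Set.ncard_union_eq ?_ (finite_of_darts (n := n) fun X hX => hP X hX.1)
    (finite_of_darts (n := n) fun X hX => hP X hX.1), ← Set.image_union]
  · congr 2
    ext X
    simp only [Set.mem_ofPred_eq, Set.mem_union]
    tauto
  · rw [Set.disjoint_left]
    rintro _ ⟨a, ⟨_, ha⟩, rfl⟩ ⟨a', ⟨_, ha'⟩, h⟩
    exact ha' (hA _ _ h.symm ha)

theorem count_eq_sum {P : RootedMap → Prop} {n : ℕ} (s : Finset ℕ) (inv : RootedMap → ℕ)
    (hP : ∀ X, P X → X.darts = n) (hs : ∀ X, P X → inv X ∈ s)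
    (hinv : ∀ X Y : RootedMap, X.cls = Y.cls → inv X = inv Y) :
    count P = ∑ i ∈ s, count (fun X => P X ∧ inv X = i) :=
  ncard_image_eq_sum cls s inv (finite_of_darts hP) hs fun a a' _ _ h => hinv a a' h

end RootedMap

namespace FlagMap

variable {F : Type*} {M : FlagMap F} {f g h : F}

theorem SameVertex.symm (h₁ : M.SameVertex f g) : M.SameVertex g f := Orb.symm h₁

theorem SameVertex.trans (h₁ : M.SameVertex f g) (h₂ : M.SameVertex g h) : M.SameVertex f h :=
  Orb.trans h₁ h₂

theorem SameFace.symm (h₁ : M.SameFace f g) : M.SameFace g f := Orb.symm h₁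

theorem SameFace.trans (h₁ : M.SameFace f g) (h₂ : M.SameFace g h) : M.SameFace f h :=
  Orb.trans h₁ h₂

theorem sameVertex_r2_iff : M.SameVertex f (M.r2 g) ↔ M.SameVertex f g := Orb.right_iff

end FlagMap

/-! ### Changing the corners of a map -/

namespace FlagMap

variable {F : Type*} (M : FlagMap F)

/-- The map with the same edges in which the corners, that is, the pairs of flags exchanged by `r1`,
are moved by a permutation of the flags. -/
def conj (π : Equiv.Perm F) : FlagMap F where
  r0 := M.r0
  r1 g := π (M.r1 (π.symm g))
  r2 := M.r2
  r0_invol := M.r0_invol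
  r1_invol g := by simp [M.r1_invol _]
  r2_invol := M.r2_invol
  r0_r2_comm := M.r0_r2_comm
  r0_ne_r2 := M.r0_ne_r2

theorem conj_r1 (π : Equiv.Perm F) (f : F) : (M.conj π).r1 f = π (M.r1 (π.symm f)) := rfl

theorem conj_conj {π ρ : Equiv.Perm F} (h : ρ * π = 1) : (M.conj π).conj ρ = M := by
  have h1 : ∀ g, ρ (π g) = g := fun g => by rw [← Equiv.Perm.mul_apply, h, Equiv.Perm.one_apply]
  have h2 : ∀ g, π.symm (ρ.symm g) = g := fun g => by
    rw [Equiv.symm_apply_eq, Equiv.symm_apply_eq, h1]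
  have h3 : (fun g => ρ (π (M.r1 (π.symm (ρ.symm g))))) = M.r1 := by
    funext g; rw [h1, h2]
  unfold conj
  congr 1

theorem eulerChar_conj (π : Equiv.Perm F) : (M.conj π).eulerChar = M.eulerChar +
    ((Nat.card (Quot (M.conj π).SameVertex) : ℤ) - Nat.card (Quot M.SameVertex)) +
    ((Nat.card (Quot (M.conj π).SameFace) : ℤ) - Nat.card (Quot M.SameFace)) := by
  have h1 : numSides (M.conj π).r1 = numSides M.r1 :=
    (Iso.numSides_eq π fun f => by rw [conj_r1, π.symm_apply_apply]).symm
  have h2 : Nat.card (Quot (M.conj π).SameEdge) = Nat.card (Quot M.SameEdge) := rfl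
  unfold eulerChar
  rw [h1, h2]
  have h3 : numSides (M.conj π).r0 = numSides M.r0 := rfl
  have h4 : numSides (M.conj π).r2 = numSides M.r2 := rfl
  rw [h3, h4]
  push_cast
  ring

/-- Moving the corners is natural. -/
theorem Iso.conj {G : Type*} {N : FlagMap G} (e : Iso M N) {π : Equiv.Perm F} {ρ : Equiv.Perm G}
    (h : ∀ f, e.toEquiv (π f) = ρ (e.toEquiv f)) :
    ∃ e' : Iso (M.conj π) (N.conj ρ), e'.toEquiv = e.toEquiv := by
  refine ⟨⟨e.toEquiv, e.map_r0, fun f => ?_, e.map_r2⟩, rfl⟩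
  have : ρ.symm (e.toEquiv f) = e.toEquiv (π.symm f) := by
    rw [Equiv.symm_apply_eq, ← h, π.apply_symm_apply]
  rw [conj_r1, conj_r1, h, e.map_r1, this]

/-! ### Sliding a dart along an edge -/

open Classical in
/-- The permutation of the flags that describes the slide of the dart next to `f`. -/
noncomputable def slidePerm (f : F) : Equiv.Perm F :=
  Equiv.swap f (M.r2 (M.r1 f)) * Equiv.swap (M.r1 f) (M.r0 f)

/-- The map obtained by sliding the dart that follows `f` at its vertex along the edge of `f` to the
other end of this edge: with `x = r1 f`, the corners `{f, x}`, `{r2 x, z}`, `{r0 f, y}` are replaced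
with `{f, z}`, `{r0 f, r2 x}`, `{x, y}`. -/
noncomputable def slide (f : F) : FlagMap F := M.conj (M.slidePerm f)

/-- The dart that follows `f` at its vertex can be slid along the edge of `f`: this edge has two
different ends, and the dart is inner and is not the dart of `f`. -/
structure Slidable (f : F) : Prop where
  complete : M.r0 f ≠ f
  corner : M.r1 f ≠ f
  inner : M.r2 (M.r1 f) ≠ M.r1 f
  next_ne : M.r1 f ≠ M.r2 f
  not_loop : ¬ M.SameVertex f (M.r0 f)

theorem slide_r0 (f g : F) : (M.slide f).r0 g = M.r0 g := rfl

theorem slide_r2 (f g : F) : (M.slide f).r2 g = M.r2 g := rfl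

namespace Slidable

variable {M} {f : F}

theorem sameVertex_next (_ : M.Slidable f) : M.SameVertex f (M.r1 f) := Orb.left f

theorem sameVertex_next' (_ : M.Slidable f) : M.SameVertex f (M.r2 (M.r1 f)) :=
  Orb.right_iff.2 (Orb.left f)

theorem r2r1_ne (h : M.Slidable f) : M.r2 (M.r1 f) ≠ f := fun h' => h.next_ne (by
  rw [← M.r2_invol (M.r1 f), h'])

theorem r1_ne_r0 (h : M.Slidable f) : M.r1 f ≠ M.r0 f := fun h' =>
  h.not_loop (h' ▸ Orb.left f)

theorem r2r1_ne_r0 (h : M.Slidable f) : M.r2 (M.r1 f) ≠ M.r0 f := fun h' =>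
  h.not_loop (h' ▸ h.sameVertex_next')

theorem perm_f (h : M.Slidable f) : M.slidePerm f f = M.r2 (M.r1 f) := by
  classical
  rw [slidePerm, Equiv.Perm.mul_apply, Equiv.swap_apply_of_ne_of_ne h.corner.symm h.complete.symm,
    Equiv.swap_apply_left]

theorem perm_x (h : M.Slidable f) : M.slidePerm f (M.r1 f) = M.r0 f := by
  classical
  rw [slidePerm, Equiv.Perm.mul_apply, Equiv.swap_apply_left,
    Equiv.swap_apply_of_ne_of_ne h.complete h.r2r1_ne_r0.symm]

theorem perm_x' (h : M.Slidable f) : M.slidePerm f (M.r2 (M.r1 f)) = f := by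
  classical
  rw [slidePerm, Equiv.Perm.mul_apply, Equiv.swap_apply_of_ne_of_ne h.inner h.r2r1_ne_r0,
    Equiv.swap_apply_right]

theorem perm_v (h : M.Slidable f) : M.slidePerm f (M.r0 f) = M.r1 f := by
  classical
  rw [slidePerm, Equiv.Perm.mul_apply, Equiv.swap_apply_right,
    Equiv.swap_apply_of_ne_of_ne h.corner h.inner.symm]

theorem perm_of_ne {g : F} (h1 : g ≠ f) (h2 : g ≠ M.r1 f) (h3 : g ≠ M.r2 (M.r1 f))
    (h4 : g ≠ M.r0 f) : M.slidePerm f g = g := by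
  classical
  rw [slidePerm, Equiv.Perm.mul_apply, Equiv.swap_apply_of_ne_of_ne h2 h4,
    Equiv.swap_apply_of_ne_of_ne h1 h3]

theorem perm_perm (h : M.Slidable f) (g : F) : M.slidePerm f (M.slidePerm f g) = g := by
  by_cases h1 : g = f
  · rw [h1, h.perm_f, h.perm_x']
  by_cases h2 : g = M.r1 f
  · rw [h2, h.perm_x, h.perm_v]
  by_cases h3 : g = M.r2 (M.r1 f)
  · rw [h3, h.perm_x', h.perm_f]
  by_cases h4 : g = M.r0 f
  · rw [h4, h.perm_v, h.perm_x]
  rw [perm_of_ne h1 h2 h3 h4, perm_of_ne h1 h2 h3 h4]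

theorem perm_symm (h : M.Slidable f) : (M.slidePerm f).symm = M.slidePerm f :=
  Equiv.ext fun g => by rw [Equiv.symm_apply_eq, h.perm_perm]

theorem r1_slide (h : M.Slidable f) (g : F) :
    (M.slide f).r1 g = M.slidePerm f (M.r1 (M.slidePerm f g)) := by
  rw [slide, conj_r1, h.perm_symm]

theorem r1_x' (h : M.Slidable f) : (M.slide f).r1 (M.r2 (M.r1 f)) = M.r0 f := by
  rw [h.r1_slide, h.perm_x', h.perm_x]

theorem r1_v (h : M.Slidable f) : (M.slide f).r1 (M.r0 f) = M.r2 (M.r1 f) := by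
  rw [h.r1_slide, h.perm_v, M.r1_invol, h.perm_f]

theorem r1_f (h : M.Slidable f) (hz : M.r1 (M.r2 (M.r1 f)) ≠ M.r2 (M.r1 f)) :
    (M.slide f).r1 f = M.r1 (M.r2 (M.r1 f)) := by
  rw [h.r1_slide, h.perm_f]
  refine perm_of_ne (fun h' => h.inner ?_) (fun h' => h.r2r1_ne (M.r1_invol.injective h')) hz
    fun h' => h.not_loop (h' ▸ ?_)
  · rw [← M.r1_invol (M.r2 (M.r1 f)), h']
  · exact Orb.left_iff.2 h.sameVertex_next'

theorem r1_f' (h : M.Slidable f) (hz : M.r1 (M.r2 (M.r1 f)) = M.r2 (M.r1 f)) :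
    (M.slide f).r1 f = f := by
  rw [h.r1_slide, h.perm_f, hz, h.perm_x']

theorem r1_x (h : M.Slidable f) (hy : M.r1 (M.r0 f) ≠ M.r0 f) :
    (M.slide f).r1 (M.r1 f) = M.r1 (M.r0 f) := by
  rw [h.r1_slide, h.perm_x]
  refine perm_of_ne (fun h' => ?_) (fun h' => h.complete (M.r1_invol.injective h'))
    (fun h' => h.not_loop ?_) hy
  · exact h.r1_ne_r0 (M.r1_invol.eq_iff.1 h').symm
  · exact Orb.left_iff.1 (h'.symm ▸ h.sameVertex_next')

theorem r1_of_ne {g : F} (h : M.Slidable f) (h1 : g ≠ f) (h2 : g ≠ M.r1 f)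
    (h3 : g ≠ M.r2 (M.r1 f)) (h4 : g ≠ M.r0 f) (h5 : M.r1 g ≠ M.r2 (M.r1 f))
    (h6 : M.r1 g ≠ M.r0 f) : (M.slide f).r1 g = M.r1 g := by
  rw [h.r1_slide, perm_of_ne h1 h2 h3 h4]
  exact perm_of_ne (fun h' => h2 (by rw [← h', M.r1_invol]))
    (fun h' => h1 (M.r1_invol.injective h'))
    h5 h6

/-- For a relation that is symmetric, the pairs exchanged by `r1` can be checked one by one. -/
theorem forall_r1 (h : M.Slidable f) {s : F → F → Prop} (hs : Equivalence s)
    (h1 : s f (M.r1 f)) (h2 : M.r1 (M.r2 (M.r1 f)) ≠ M.r2 (M.r1 f) →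
      (M.slide f).r1 f = M.r1 (M.r2 (M.r1 f)) → s (M.r2 (M.r1 f)) (M.r1 (M.r2 (M.r1 f))))
    (h3 : M.r1 (M.r0 f) ≠ M.r0 f → (M.slide f).r1 (M.r1 f) = M.r1 (M.r0 f) →
      s (M.r0 f) (M.r1 (M.r0 f)))
    (h4 : ∀ g, g ≠ f → g ≠ M.r1 f → g ≠ M.r2 (M.r1 f) → g ≠ M.r0 f → M.r1 g ≠ M.r2 (M.r1 f) →
      M.r1 g ≠ M.r0 f → (M.slide f).r1 g = M.r1 g → s g (M.r1 g)) (g : F) : s g (M.r1 g) := by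
  have h2' : s (M.r2 (M.r1 f)) (M.r1 (M.r2 (M.r1 f))) := by
    by_cases hz : M.r1 (M.r2 (M.r1 f)) = M.r2 (M.r1 f)
    · rw [hz]; exact hs.refl _
    · exact h2 hz (h.r1_f hz)
  have h3' : s (M.r0 f) (M.r1 (M.r0 f)) := by
    by_cases hy : M.r1 (M.r0 f) = M.r0 f
    · rw [hy]; exact hs.refl _
    · exact h3 hy (h.r1_x hy)
  by_cases g1 : g = f
  · rwa [g1]
  by_cases g2 : g = M.r1 f
  · rw [g2, M.r1_invol]; exact hs.symm h1
  by_cases g3 : g = M.r2 (M.r1 f)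
  · rwa [g3]
  by_cases g4 : g = M.r0 f
  · rwa [g4]
  by_cases g5 : M.r1 g = M.r2 (M.r1 f)
  · rw [← g5, M.r1_invol] at h2'; exact hs.symm h2'
  by_cases g6 : M.r1 g = M.r0 f
  · rw [← g6, M.r1_invol] at h3'; exact hs.symm h3'
  exact h4 g g1 g2 g3 g4 g5 g6 (h.r1_of_ne g1 g2 g3 g4 g5 g6)

open Classical in
/-- Sliding does not affect which flags are at the same vertex, apart from the dart that is slid,
which belongs to the vertex of `f` before the slide. -/
theorem sameVertex_slide (h : M.Slidable f) {g k : F} (hgk : M.SameVertex g k) :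
    (M.slide f).SameVertex (if g = M.r1 f ∨ g = M.r2 (M.r1 f) then f else g)
      (if k = M.r1 f ∨ k = M.r2 (M.r1 f) then f else k) := by
  refine Orb.map (fun g => if g = M.r1 f ∨ g = M.r2 (M.r1 f) then f else g) ?_ ?_ hgk
  · refine h.forall_r1 (s := fun g k =>
      (M.slide f).SameVertex (if g = M.r1 f ∨ g = M.r2 (M.r1 f) then f else g)
      (if k = M.r1 f ∨ k = M.r2 (M.r1 f) then f else k))
      ⟨fun _ => Orb.refl _, Orb.symm, Orb.trans⟩ ?_ ?_ ?_ ?_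
    · rw [if_pos (Or.inl rfl), if_neg (by simp [h.corner.symm, h.r2r1_ne.symm])]
      exact Orb.refl f
    · intro hz hr
      rw [if_pos (Or.inr rfl), if_neg, ← hr]
      · exact Orb.left f
      · rintro (h' | h')
        · exact h.r2r1_ne (M.r1_invol.injective h')
        · exact hz h'
    · intro hy hr
      rw [if_neg (by simp [h.r1_ne_r0.symm, h.r2r1_ne_r0.symm]), if_neg, ← hr]
      · refine Orb.trans (g := M.r2 (M.r1 f)) ?_ (Orb.trans (g := M.r1 f) ?_ (Orb.left _))
        · rw [← h.r1_v]; exact Orb.left _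
        · exact (Orb.right (b := M.r2) (M.r1 f)).symm
      · rintro (h' | h')
        · exact h.complete (M.r1_invol.injective h')
        · exact h.not_loop (Orb.left_iff.1 (h'.symm ▸ h.sameVertex_next'))
    · intro g g1 g2 g3 g4 g5 g6 hr
      rw [if_neg (by simp [g2, g3]), if_neg, ← hr]
      · exact Orb.left _
      · rintro (h' | h')
        · exact g1 (M.r1_invol.injective h')
        · exact g5 h'
  · intro g
    have : (M.r2 g = M.r1 f ∨ M.r2 g = M.r2 (M.r1 f)) ↔ (g = M.r1 f ∨ g = M.r2 (M.r1 f)) := by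
      rw [M.r2_invol.injective.eq_iff, M.r2_invol.eq_iff, or_comm]
    by_cases hg : g = M.r1 f ∨ g = M.r2 (M.r1 f)
    · rw [if_pos hg, if_pos (this.2 hg)]
    · rw [if_neg hg, if_neg (mt this.1 hg)]; exact Orb.right (b := M.r2) g

open Classical in
/-- Sliding does not affect which flags are in the same face, apart from the side of the edge along
which the dart is slid. -/
theorem sameFace_slide (h : M.Slidable f) {g k : F} (hgk : M.SameFace g k) :
    (M.slide f).SameFace (if g = f ∨ g = M.r0 f then M.r1 f else g)
      (if k = f ∨ k = M.r0 f then M.r1 f else k) := by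
  refine Orb.map (fun g => if g = f ∨ g = M.r0 f then M.r1 f else g) ?_ ?_ hgk
  · intro g
    have : (M.r0 g = f ∨ M.r0 g = M.r0 f) ↔ (g = f ∨ g = M.r0 f) := by
      rw [M.r0_invol.injective.eq_iff, M.r0_invol.eq_iff, or_comm]
    by_cases hg : g = f ∨ g = M.r0 f
    · rw [if_pos hg, if_pos (this.2 hg)]
    · rw [if_neg hg, if_neg (mt this.1 hg)]; exact Orb.left (a := M.r0) g
  · refine h.forall_r1 (s := fun g k =>
      (M.slide f).SameFace (if g = f ∨ g = M.r0 f then M.r1 f else g)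
      (if k = f ∨ k = M.r0 f then M.r1 f else k))
      ⟨fun _ => Orb.refl _, Orb.symm, Orb.trans⟩ ?_ ?_ ?_ ?_
    · rw [if_pos (Or.inl rfl), if_neg (by simp [h.corner, h.r1_ne_r0])]
      exact Orb.refl _
    · intro hz hr
      rw [if_neg (by simp [h.r2r1_ne, h.r2r1_ne_r0]), if_neg, ← hr]
      · refine Orb.trans (g := M.r0 f) ?_ (Orb.trans (g := f) ?_ (Orb.right f))
        · rw [← h.r1_x']; exact Orb.right _
        · exact (Orb.left (a := M.r0) f).symm
      · rintro (h' | h')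
        · exact h.inner (by rw [← M.r1_invol (M.r2 (M.r1 f)), h'])
        · exact h.not_loop (h' ▸ Orb.left_iff.2 h.sameVertex_next')
    · intro hy hr
      rw [if_pos (Or.inr rfl), if_neg, ← hr]
      · exact Orb.right _
      · rintro (h' | h')
        · exact h.r1_ne_r0 (M.r1_invol.eq_iff.1 h').symm
        · exact hy h'
    · intro g g1 g2 g3 g4 g5 g6 hr
      rw [if_neg (by simp [g1, g4]), if_neg, ← hr]
      · exact Orb.right _
      · rintro (h' | h')
        · exact g2 (by rw [← h', M.r1_invol])
        · exact g6 h'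

theorem connected_slide (h : M.Slidable f) (hM : M.Connected) : (M.slide f).Connected := by
  set r := fun f' g : F => g = (M.slide f).r0 f' ∨ g = (M.slide f).r1 f' ∨ g = (M.slide f).r2 f'
  have e0 : ∀ g, Relation.EqvGen r g (M.r0 g) := fun g => .rel _ _ (Or.inl rfl)
  have e1 : ∀ g k, (M.slide f).r1 g = k → Relation.EqvGen r g k := fun g k h =>
    .rel _ _ (Or.inr (Or.inl h.symm))
  have e2 : ∀ g, Relation.EqvGen r g (M.r2 g) := fun g => .rel _ _ (Or.inr (Or.inr rfl))
  have hxv : Relation.EqvGen r (M.r1 f) (M.r0 f) := (e2 _).trans _ _ _ (e1 _ _ h.r1_x')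
  refine fun g k => eqvGen_lift (eqvGen_equivalence r) id ?_ (hM g k)
  rintro g k (rfl | rfl | rfl)
  · exact e0 g
  · refine h.forall_r1 (s := Relation.EqvGen r) (eqvGen_equivalence r) ?_ ?_ ?_ ?_ g
    · exact (e0 f).trans _ _ _ hxv.symm
    · exact fun _ hr => (e1 _ _ h.r1_x').trans _ _ _ ((e0 f).symm.trans _ _ _ (e1 _ _ hr))
    · exact fun _ hr => hxv.symm.trans _ _ _ (e1 _ _ hr)
    · exact fun g _ _ _ _ _ _ hr => e1 _ _ hr
  · exact e2 g

theorem orientable_slide (h : M.Slidable f) (hM : M.Orientable) : (M.slide f).Orientable := by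
  obtain ⟨c, hc⟩ := hM
  have tri : ∀ {p q r : Bool}, p ≠ q → r ≠ q → p = r := by decide
  have h0 := fun g => (hc g).1
  have h1 := fun g => (hc g).2.1
  have h2 := fun g => (hc g).2.2
  have hx : c (M.r1 f) ≠ c f := h1 f h.corner
  have hx' : c (M.r2 (M.r1 f)) = c f := tri (h2 _ h.inner) hx.symm
  have hv : c (M.r0 f) = c (M.r1 f) := tri (h0 f h.complete) hx
  refine ⟨c, fun g => ⟨h0 g, ?_, h2 g⟩⟩
  -- the colour of a flag and of its image under the permutation of the slide are related
  have hπ : ∀ g, c (M.slidePerm f g) = c g := by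
    intro g
    by_cases g1 : g = f
    · rw [g1, h.perm_f, hx']
    by_cases g2 : g = M.r1 f
    · rw [g2, h.perm_x, hv]
    by_cases g3 : g = M.r2 (M.r1 f)
    · rw [g3, h.perm_x', hx']
    by_cases g4 : g = M.r0 f
    · rw [g4, h.perm_v, hv]
    rw [perm_of_ne g1 g2 g3 g4]
  intro hg
  rw [h.r1_slide, hπ, ← hπ g]
  refine h1 _ fun h' => hg ?_
  rw [h.r1_slide, h', h.perm_perm]

/-- The dart that has been slid can be slid back from the other end of the edge. -/
theorem slidable_slide (h : M.Slidable f) : (M.slide f).Slidable (M.r0 f) where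
  complete := by rw [slide_r0, M.r0_invol]; exact h.complete.symm
  corner := by rw [h.r1_v]; exact h.r2r1_ne_r0
  inner := by rw [h.r1_v, slide_r2, M.r2_invol]; exact h.inner.symm
  next_ne := by
    rw [h.r1_v, slide_r2]
    exact fun h' => h.r1_ne_r0 (M.r2_invol.injective h')
  not_loop := by
    classical
    rw [slide_r0, M.r0_invol]
    -- before the slide, the vertex of `f` without the dart is a union of classes
    have hS : ∀ g k, (M.slide f).SameVertex g k →
        (M.SameVertex f g ∧ g ≠ M.r1 f ∧ g ≠ M.r2 (M.r1 f) ↔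
        M.SameVertex f k ∧ k ≠ M.r1 f ∧ k ≠ M.r2 (M.r1 f)) := by
      intro g k hgk
      have key := Orb.mem_iff (M.slide f).r1_invol (M.slide f).r2_invol
        (S := {g | M.SameVertex f g ∧ g ≠ M.r1 f ∧ g ≠ M.r2 (M.r1 f)}) ?_ ?_ hgk
      · exact key
      · rintro g ⟨hg, g2, g3⟩
        by_cases g1 : g = f
        · rw [g1]
          by_cases hz : M.r1 (M.r2 (M.r1 f)) = M.r2 (M.r1 f)
          · rw [h.r1_f' hz]; exact ⟨Orb.refl f, h.corner.symm, h.r2r1_ne.symm⟩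
          · rw [h.r1_f hz]
            exact ⟨Orb.left_iff.2 h.sameVertex_next', fun h' => h.r2r1_ne (M.r1_invol.injective h'),
              hz⟩
        have g4 : g ≠ M.r0 f := fun h' => h.not_loop (h' ▸ hg)
        by_cases g5 : M.r1 g = M.r2 (M.r1 f)
        · rw [h.r1_slide, perm_of_ne g1 g2 g3 g4, g5, h.perm_x']
          exact ⟨Orb.refl f, h.corner.symm, h.r2r1_ne.symm⟩
        · have g6 : M.r1 g ≠ M.r0 f := fun h' => h.not_loop (h' ▸ Orb.left_iff.2 hg)
          rw [h.r1_of_ne g1 g2 g3 g4 g5 g6]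
          exact ⟨Orb.left_iff.2 hg, fun h' => g1 (M.r1_invol.injective h'), g5⟩
      · rintro g ⟨hg, g2, g3⟩
        refine ⟨Orb.right_iff.2 hg, fun h' => g3 ?_, fun h' => g2 (M.r2_invol.injective h')⟩
        rw [← h', slide_r2, M.r2_invol]
    intro h'
    exact h.not_loop ((hS _ _ h').2 ⟨Orb.refl f, h.corner.symm, h.r2r1_ne.symm⟩).1

theorem r1_slide_v (h : M.Slidable f) :
    M.r2 ((M.slide f).r1 (M.r0 f)) = M.r1 f := by rw [h.r1_v, M.r2_invol]

theorem slidePerm_slide (h : M.Slidable f) : (M.slide f).slidePerm (M.r0 f) = M.slidePerm f := by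
  have h' := h.slidable_slide
  have e1 : (M.slide f).r1 (M.r0 f) = M.r2 (M.r1 f) := h.r1_v
  have e2 : (M.slide f).r2 ((M.slide f).r1 (M.r0 f)) = M.r1 f := h.r1_slide_v
  have e3 : (M.slide f).r0 (M.r0 f) = f := M.r0_invol f
  ext g
  by_cases g1 : g = f
  · rw [g1, h.perm_f]
    have := h'.perm_v
    rwa [e1, e3] at this
  by_cases g2 : g = M.r1 f
  · rw [g2, h.perm_x]
    have := h'.perm_x'
    rwa [e2] at this
  by_cases g3 : g = M.r2 (M.r1 f)
  · rw [g3, h.perm_x']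
    have := h'.perm_x
    rwa [e1, e3] at this
  by_cases g4 : g = M.r0 f
  · rw [g4, h.perm_v]
    have := h'.perm_f
    rwa [e2] at this
  rw [perm_of_ne g1 g2 g3 g4]
  exact perm_of_ne g4 (by rwa [e1]) (by rwa [e2]) (by rwa [e3])

/-- Sliding the dart back restores the map. -/
theorem slide_slide (h : M.Slidable f) : (M.slide f).slide (M.r0 f) = M := by
  rw [slide, h.slidePerm_slide, slide]
  exact M.conj_conj (Equiv.ext fun g => h.perm_perm g)

theorem sameVertex_slide_iff (h : M.Slidable f) {g k : F} (hg1 : g ≠ M.r1 f)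
    (hg2 : g ≠ M.r2 (M.r1 f)) (hk1 : k ≠ M.r1 f) (hk2 : k ≠ M.r2 (M.r1 f)) :
    (M.slide f).SameVertex g k ↔ M.SameVertex g k := by
  constructor
  · intro h'
    have := h.slidable_slide.sameVertex_slide h'
    rw [h.slide_slide, slide_r2, h.r1_slide_v, h.r1_v] at this
    rwa [if_neg (by simp [hg1, hg2]), if_neg (by simp [hk1, hk2])] at this
  · intro h'
    have := h.sameVertex_slide h'
    rwa [if_neg (by simp [hg1, hg2]), if_neg (by simp [hk1, hk2])] at this

theorem sameVertex_v_x (h : M.Slidable f) : (M.slide f).SameVertex (M.r0 f) (M.r2 (M.r1 f)) :=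
  h.r1_v ▸ Orb.left _

theorem sameVertex_v_x' (h : M.Slidable f) : (M.slide f).SameVertex (M.r0 f) (M.r1 f) :=
  h.sameVertex_v_x.trans (Orb.right (b := M.r2) (M.r1 f)).symm

/-- Sliding changes neither the number of vertices nor the number of faces. -/
theorem eulerChar_slide (h : M.Slidable f) : (M.slide f).eulerChar = M.eulerChar := by
  classical
  have h' := h.slidable_slide
  have e1 : (M.slide f).r1 (M.r0 f) = M.r2 (M.r1 f) := h.r1_v
  have e2 : (M.slide f).r2 ((M.slide f).r1 (M.r0 f)) = M.r1 f := h.r1_slide_v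
  have e3 : (M.slide f).r0 (M.r0 f) = f := M.r0_invol f
  -- the slide induces a bijection of the vertices whose inverse is induced by the slide back, and
  -- likewise for the faces
  have hV : Nat.card (Quot M.SameVertex) = Nat.card (Quot (M.slide f).SameVertex) := by
    refine card_quot_congr (fun g => if g = M.r1 f ∨ g = M.r2 (M.r1 f) then f else g)
      (fun g => if g = M.r2 (M.r1 f) ∨ g = M.r1 f then M.r0 f else g)
      (fun g k hgk => Quot.sound (h.sameVertex_slide hgk)) (fun g k hgk => Quot.sound ?_) ?_ ?_
    · have := h'.sameVertex_slide hgk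
      rwa [h.slide_slide, e2, e1] at this
    · intro g
      refine Quot.sound ?_
      by_cases hg : g = M.r1 f ∨ g = M.r2 (M.r1 f)
      · rw [if_pos hg, if_neg (by simp [h.corner.symm, h.r2r1_ne.symm])]
        rcases hg with rfl | rfl
        exacts [h.sameVertex_next, h.sameVertex_next']
      · rw [if_neg hg, if_neg (by tauto)]
        exact Orb.refl g
    · intro g
      refine Quot.sound ?_
      by_cases hg : g = M.r2 (M.r1 f) ∨ g = M.r1 f
      · rw [if_pos hg, if_neg (by simp [h.r1_ne_r0.symm, h.r2r1_ne_r0.symm])]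
        rcases hg with rfl | rfl
        exacts [h.sameVertex_v_x, h.sameVertex_v_x']
      · rw [if_neg hg, if_neg (by tauto)]
        exact Orb.refl g
  have hF : Nat.card (Quot M.SameFace) = Nat.card (Quot (M.slide f).SameFace) := by
    refine card_quot_congr (fun g => if g = f ∨ g = M.r0 f then M.r1 f else g)
      (fun g => if g = M.r0 f ∨ g = f then M.r2 (M.r1 f) else g)
      (fun g k hgk => Quot.sound (h.sameFace_slide hgk)) (fun g k hgk => Quot.sound ?_) ?_ ?_
    · have := h'.sameFace_slide hgk
      rwa [h.slide_slide, e3, e1] at this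
    · intro g
      refine Quot.sound ?_
      by_cases hg : g = f ∨ g = M.r0 f
      · rw [if_pos hg, if_neg (by simp [h.corner, h.r1_ne_r0])]
        have : M.SameFace (M.r1 f) f := (Orb.right (a := M.r0) (b := M.r1) f).symm
        rcases hg with rfl | rfl
        exacts [this, this.trans (Orb.left f)]
      · rw [if_neg hg, if_neg (by tauto)]
        exact Orb.refl g
    · intro g
      refine Quot.sound ?_
      by_cases hg : g = M.r0 f ∨ g = f
      · rw [if_pos hg, if_neg (by simp [h.r2r1_ne, h.r2r1_ne_r0])]
        have : (M.slide f).SameFace (M.r2 (M.r1 f)) (M.r0 f) := h.r1_x' ▸ Orb.right _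
        rcases hg with rfl | rfl
        exacts [this, this.trans (Orb.left (a := M.r0) g).symm]
      · rw [if_neg hg, if_neg (by tauto)]
        exact Orb.refl g
  rw [slide, eulerChar_conj, ← slide, hV, hF]
  ring

theorem isDisk_slide (h : M.Slidable f) (hM : M.IsDisk) : (M.slide f).IsDisk :=
  ⟨h.connected_slide hM.1, h.orientable_slide hM.2.1, h.eulerChar_slide ▸ hM.2.2⟩

theorem innerFlags_slide [Finite F] (h : M.Slidable f) :
    (M.slide f).innerFlags f + 2 = M.innerFlags f := by
  have hset : {g | M.SameVertex f g ∧ M.r2 g ≠ g} = insert (M.r1 f) (insert (M.r2 (M.r1 f))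
      {g | (M.slide f).SameVertex f g ∧ M.r2 g ≠ g}) := by
    ext g
    simp only [Set.mem_insert_iff, Set.mem_ofPred_eq]
    by_cases g1 : g = M.r1 f
    · simp only [g1, true_or, iff_true]; exact ⟨h.sameVertex_next, h.inner⟩
    by_cases g2 : g = M.r2 (M.r1 f)
    · simp only [g2, true_or, or_true, iff_true]
      exact ⟨h.sameVertex_next', by rw [M.r2_invol]; exact h.inner.symm⟩
    rw [h.sameVertex_slide_iff h.corner.symm h.r2r1_ne.symm g1 g2]
    simp [g1, g2]
  have hloop : ¬ (M.slide f).SameVertex f (M.r0 f) := by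
    have := h.slidable_slide.not_loop
    rw [slide_r0, M.r0_invol] at this
    exact fun h => this h.symm
  unfold innerFlags
  change Set.ncard {g | (M.slide f).SameVertex f g ∧ M.r2 g ≠ g} + 2 =
    Set.ncard {g | M.SameVertex f g ∧ M.r2 g ≠ g}
  rw [hset, Set.ncard_insert_of_notMem, Set.ncard_insert_of_notMem]
  · exact fun h' => hloop (h'.1.trans h.sameVertex_v_x.symm)
  · rw [Set.mem_insert_iff, not_or]
    exact ⟨h.inner.symm, fun h' => hloop (h'.1.trans h.sameVertex_v_x'.symm)⟩

theorem interiorVertex_slide (h : M.Slidable f) (hf : M.InteriorVertex f) :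
    (M.slide f).InteriorVertex f := by
  intro g hg
  have hloop : ¬ (M.slide f).SameVertex f (M.r0 f) := by
    have := h.slidable_slide.not_loop
    rw [slide_r0, M.r0_invol] at this
    exact fun h => this h.symm
  have g1 : g ≠ M.r1 f := fun h' => hloop ((h' ▸ hg).trans h.sameVertex_v_x'.symm)
  have g2 : g ≠ M.r2 (M.r1 f) := fun h' => hloop ((h' ▸ hg).trans h.sameVertex_v_x.symm)
  have hg' := (h.sameVertex_slide_iff h.corner.symm h.r2r1_ne.symm g1 g2).1 hg
  refine ⟨fun h' => ?_, (hf g hg').2⟩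
  rw [h.r1_slide] at h'
  have h'' : M.r1 (M.slidePerm f g) = M.slidePerm f g := by
    conv_rhs => rw [← h', h.perm_perm]
  by_cases g3 : g = f
  · rw [g3, h.perm_f] at h''
    exact (hf _ h.sameVertex_next').1 h''
  · have g4 : g ≠ M.r0 f := fun h' => hloop (h' ▸ hg)
    rw [perm_of_ne g3 g1 g2 g4] at h''
    exact (hf g hg').1 h''

theorem interiorVertex_other_slide (h : M.Slidable f) (hv : M.InteriorVertex (M.r0 f)) :
    (M.slide f).InteriorVertex (M.r0 f) := by
  intro g hg
  by_cases g1 : g = M.r1 f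
  · rw [g1]
    refine ⟨fun h' => ?_, h.inner⟩
    have := (hv _ (Orb.refl _)).1
    rw [h.r1_x this] at h'
    exact h.complete (M.r1_invol.injective h')
  by_cases g2 : g = M.r2 (M.r1 f)
  · rw [g2, h.r1_x', slide_r2, M.r2_invol]
    exact ⟨h.r2r1_ne_r0.symm, h.inner.symm⟩
  have hg' := (h.sameVertex_slide_iff h.r1_ne_r0.symm h.r2r1_ne_r0.symm g1 g2).1 hg
  refine ⟨fun h' => ?_, (hv g hg').2⟩
  rw [h.r1_slide] at h'
  have h'' : M.r1 (M.slidePerm f g) = M.slidePerm f g := by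
    conv_rhs => rw [← h', h.perm_perm]
  by_cases g3 : g = M.r0 f
  · rw [g3, h.perm_v, M.r1_invol] at h''
    exact h.corner h''.symm
  · have g4 : g ≠ f := fun h' => h.not_loop (h' ▸ hg').symm
    rw [perm_of_ne g4 g1 g2 g3] at h''
    exact (hv g hg').1 h''

end Slidable

/-- Sliding is natural. -/
theorem Iso.slide {G : Type*} {N : FlagMap G} (e : Iso M N) (f : F) :
    ∃ e' : Iso (M.slide f) (N.slide (e.toEquiv f)), e'.toEquiv = e.toEquiv := by
  classical
  refine e.conj M fun g => ?_
  simp only [slidePerm, Equiv.Perm.mul_apply]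
  rw [← e.map_r1, ← e.map_r2, ← e.map_r0, e.toEquiv.injective.swap_apply,
    e.toEquiv.injective.swap_apply]

end FlagMap

/-! ### Joining two corners -/

namespace FlagMap

variable {F : Type*} (M : FlagMap F)

open Classical in
/-- The transposition of two flags. -/
noncomputable def flagSwap (x y : F) : Equiv.Perm F := Equiv.swap x y

theorem flagSwap_left (x y : F) : flagSwap x y x = y := by
  classical exact Equiv.swap_apply_left x y

theorem flagSwap_right (x y : F) : flagSwap x y y = x := by
  classical exact Equiv.swap_apply_right x y

theorem flagSwap_of_ne {x y g : F} (h : g ≠ x) (h' : g ≠ y) : flagSwap x y g = g := by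
  classical exact Equiv.swap_apply_of_ne_of_ne h h'

theorem flagSwap_symm (x y : F) : (flagSwap x y).symm = flagSwap x y := by
  classical exact Equiv.symm_swap x y

theorem flagSwap_mul_self (x y : F) : flagSwap x y * flagSwap x y = 1 := by
  classical exact Equiv.swap_mul_self x y

theorem apply_flagSwap {G : Type*} (e : F ≃ G) (x y g : F) :
    e (flagSwap x y g) = flagSwap (e x) (e y) (e g) := by
  classical exact (e.injective.swap_apply x y g).symm

/-- The corners `{x, r1 x}` and `{t, r1 t}` are replaced with `{x, t}` and `{r1 x, r1 t}`. If `r1`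
fixes `x` then `r1 t` becomes a fixed point instead. -/
noncomputable def joinCorners (x t : F) : FlagMap F := M.conj (flagSwap x (M.r1 t))

/-- The flags `x` and `t` lie in different corners, and the corner of `t` is not cut by the
boundary. -/
structure Joinable (x t : F) : Prop where
  corner : M.r1 t ≠ t
  ne : x ≠ t
  ne' : x ≠ M.r1 t

namespace Joinable

variable {M} {x t : F}

theorem r1_x (h : M.Joinable x t) : (M.joinCorners x t).r1 x = t := by
  rw [joinCorners, conj_r1, flagSwap_symm, flagSwap_left, M.r1_invol,
    flagSwap_of_ne h.ne.symm h.corner.symm]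

theorem r1_t (h : M.Joinable x t) : (M.joinCorners x t).r1 t = x :=
  (M.joinCorners x t).r1_invol.eq_iff.2 h.r1_x.symm

theorem r1_t' (h : M.Joinable x t) (hx : M.r1 x ≠ x) :
    (M.joinCorners x t).r1 (M.r1 t) = M.r1 x := by
  rw [joinCorners, conj_r1, flagSwap_symm, flagSwap_right,
    flagSwap_of_ne hx (fun h' => h.ne (M.r1_invol.injective h'))]

theorem r1_t'' (_ : M.Joinable x t) (hx : M.r1 x = x) :
    (M.joinCorners x t).r1 (M.r1 t) = M.r1 t := by
  rw [joinCorners, conj_r1, flagSwap_symm, flagSwap_right, hx, flagSwap_left]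

theorem r1_x' (h : M.Joinable x t) (hx : M.r1 x ≠ x) :
    (M.joinCorners x t).r1 (M.r1 x) = M.r1 t :=
  (M.joinCorners x t).r1_invol.eq_iff.2 (h.r1_t' hx).symm

theorem r1_of_ne {g : F} (h1 : g ≠ x) (h2 : g ≠ M.r1 t) (h3 : M.r1 g ≠ x) (h4 : g ≠ t) :
    (M.joinCorners x t).r1 g = M.r1 g := by
  rw [joinCorners, conj_r1, flagSwap_symm, flagSwap_of_ne h1 h2,
    flagSwap_of_ne h3 (fun h' => h4 (M.r1_invol.injective h'))]

/-- The pairs exchanged by `r1`, in terms of those after the join. -/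
theorem forall_r1 (h : M.Joinable x t) {s : F → F → Prop} (hs : Equivalence s)
    (h1 : M.r1 x ≠ x → (M.joinCorners x t).r1 (M.r1 t) = M.r1 x → s x (M.r1 x))
    (h2 : s t (M.r1 t))
    (h3 : ∀ g, g ≠ x → g ≠ M.r1 t → M.r1 g ≠ x → g ≠ t → (M.joinCorners x t).r1 g = M.r1 g →
      s g (M.r1 g)) (g : F) : s g (M.r1 g) := by
  have h1' : s x (M.r1 x) := by
    by_cases hx : M.r1 x = x
    · rw [hx]; exact hs.refl _
    · exact h1 hx (h.r1_t' hx)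
  by_cases g1 : g = x
  · rwa [g1]
  by_cases g2 : g = M.r1 t
  · rw [g2, M.r1_invol]; exact hs.symm h2
  by_cases g3 : M.r1 g = x
  · rw [← g3, M.r1_invol] at h1'; exact hs.symm h1'
  by_cases g4 : g = t
  · rwa [g4]
  exact h3 g g1 g2 g3 g4 (r1_of_ne g1 g2 g3 g4)

/-- The pairs exchanged by `r1` after the join, in terms of those before. -/
theorem forall_r1_joinCorners (h : M.Joinable x t) {s : F → F → Prop} (hs : Equivalence s)
    (h1 : s x t) (h2 : M.r1 x ≠ x → s (M.r1 t) (M.r1 x))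
    (h3 : ∀ g, s g (M.r1 g) ∨ g = x ∨ g = t ∨ g = M.r1 t ∨ g = M.r1 x) (g : F) :
    s g ((M.joinCorners x t).r1 g) := by
  by_cases g1 : g = x
  · rwa [g1, h.r1_x]
  by_cases g2 : g = M.r1 t
  · rw [g2]
    by_cases hx : M.r1 x = x
    · rw [h.r1_t'' hx]; exact hs.refl _
    · rw [h.r1_t' hx]; exact h2 hx
  by_cases g3 : M.r1 g = x
  · have hx : M.r1 x ≠ x := fun hx => g1 (by rw [← M.r1_invol g, g3, hx])
    have : g = M.r1 x := by rw [← g3, M.r1_invol]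
    rw [this, h.r1_x' hx]; exact hs.symm (h2 hx)
  by_cases g4 : g = t
  · rw [g4, h.r1_t]; exact hs.symm h1
  rw [r1_of_ne g1 g2 g3 g4]
  rcases h3 g with h' | h' | h' | h' | h'
  · exact h'
  · exact absurd h' g1
  · exact absurd h' g4
  · exact absurd h' g2
  · exact absurd (by rw [h', M.r1_invol]) g3

/-- Joining corners joins the classes of `x` and `t`, provided `t` and `r1 t` stay in one
class. -/
theorem orb_joinCorners (h : M.Joinable x t) {a : F → F}
    (hrob : Orb a (M.joinCorners x t).r1 t (M.r1 t)) {g k : F} :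
    Orb a (M.joinCorners x t).r1 g k ↔ JoinRel (Orb a M.r1) x t g k := by
  have hxt : Orb a (M.joinCorners x t).r1 x t := by
    have := Orb.right (a := a) (b := (M.joinCorners x t).r1) x
    rwa [h.r1_x] at this
  have hle : ∀ g k, Orb a M.r1 g k → Orb a (M.joinCorners x t).r1 g k := by
    intro g k hgk
    refine hgk.map id (fun g => Orb.left g) ?_
    refine h.forall_r1 (s := Orb a (M.joinCorners x t).r1) (Orb.equivalence _ _) ?_ hrob ?_
    · intro _ hr
      exact hxt.trans (hrob.trans (hr ▸ Orb.right _))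
    · intro g _ _ _ _ hr
      exact hr ▸ Orb.right g
  constructor
  · intro hgk
    have hE := JoinRel.equivalence (Orb.equivalence a M.r1) x t
    refine hgk.lift hE id (fun g => Or.inl (Orb.left g)) ?_
    refine h.forall_r1_joinCorners hE ?_ ?_ ?_
    · exact Or.inr ⟨Or.inl (Orb.refl x), Or.inr (Orb.refl t)⟩
    · intro _
      exact Or.inr ⟨Or.inr (Orb.right t).symm, Or.inl (Orb.right x).symm⟩
    · intro g
      exact Or.inl (Or.inl (Orb.right g))
  · rintro (h' | ⟨h1, h2⟩)
    · exact hle _ _ h'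
    · have key : ∀ g, (Orb a M.r1 g x ∨ Orb a M.r1 g t) → Orb a (M.joinCorners x t).r1 g t := by
        rintro g (h' | h')
        exacts [(hle _ _ h').trans hxt, hle _ _ h']
      exact (key g h1).trans (key k h2).symm

theorem sameVertex_joinCorners (h : M.Joinable x t)
    (hrob : (M.joinCorners x t).SameVertex t (M.r1 t)) {g k : F} :
    (M.joinCorners x t).SameVertex g k ↔ JoinRel M.SameVertex x t g k := by
  have := h.orb_joinCorners (a := M.r2) (Orb.comm hrob) (g := g) (k := k)
  rw [Orb.comm_iff] at this
  refine this.trans ?_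
  simp only [JoinRel, Orb.comm_iff (a := M.r2) (b := M.r1)]
  rfl

theorem eulerChar_joinCorners [Finite F] (h : M.Joinable x t)
    (hV : (M.joinCorners x t).SameVertex t (M.r1 t)) (hF : (M.joinCorners x t).SameFace t (M.r1 t))
    (hV' : ¬ M.SameVertex x t) (hF' : ¬ M.SameFace x t) :
    (M.joinCorners x t).eulerChar + 2 = M.eulerChar := by
  have h1 := card_quot_join (s := (M.joinCorners x t).SameVertex) (Orb.equivalence M.r1 M.r2) hV'
    fun f g => h.sameVertex_joinCorners hV
  have h2 := card_quot_join (s := (M.joinCorners x t).SameFace) (Orb.equivalence M.r0 M.r1) hF'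
    fun f g => h.orb_joinCorners hF
  have h1' : Nat.card (Quot M.SameVertex) = Nat.card (Quot (M.joinCorners x t).SameVertex) + 1 := h1
  have h2' : Nat.card (Quot M.SameFace) = Nat.card (Quot (M.joinCorners x t).SameFace) + 1 := h2
  have h3 := M.eulerChar_conj (flagSwap x (M.r1 t))
  rw [← joinCorners, h1', h2'] at h3
  rw [h3]
  push_cast
  ring

/-- The corners can be separated again. -/
theorem joinCorners_conj {t' : F} (ht' : t' = M.r1 t) :
    (M.joinCorners x t).conj (flagSwap x t') = M := by
  subst ht'
  exact M.conj_conj (flagSwap_mul_self _ _)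

theorem orientable_iff_of_color (h : M.Joinable x t) {c : F → Bool} (hc : c x ≠ c t) :
    (∀ f, (M.r0 f ≠ f → c (M.r0 f) ≠ c f) ∧ (M.r1 f ≠ f → c (M.r1 f) ≠ c f) ∧
      (M.r2 f ≠ f → c (M.r2 f) ≠ c f)) →
    ∀ f, ((M.joinCorners x t).r0 f ≠ f → c ((M.joinCorners x t).r0 f) ≠ c f) ∧
      ((M.joinCorners x t).r1 f ≠ f → c ((M.joinCorners x t).r1 f) ≠ c f) ∧
      ((M.joinCorners x t).r2 f ≠ f → c ((M.joinCorners x t).r2 f) ≠ c f) := by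
  intro hM f
  refine ⟨(hM f).1, ?_, (hM f).2.2⟩
  have tri : ∀ {p q r : Bool}, p ≠ q → r ≠ q → p = r := by decide
  have ht : c (M.r1 t) = c x := tri ((hM t).2.1 h.corner) hc
  by_cases g1 : f = x
  · rw [g1, h.r1_x]; exact fun _ => hc.symm
  by_cases g2 : f = M.r1 t
  · rw [g2]
    by_cases hx : M.r1 x = x
    · rw [h.r1_t'' hx]; exact fun h' => absurd rfl h'
    · rw [h.r1_t' hx, ht]; exact fun _ => (hM x).2.1 hx
  by_cases g3 : M.r1 f = x
  · have hx : M.r1 x ≠ x := fun hx => g1 (by rw [← M.r1_invol f, g3, hx])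
    have : f = M.r1 x := by rw [← g3, M.r1_invol]
    rw [this, h.r1_x' hx, ht]; exact fun _ => ((hM x).2.1 hx).symm
  by_cases g4 : f = t
  · rw [g4, h.r1_t]; exact fun _ => hc
  rw [r1_of_ne g1 g2 g3 g4]
  exact (hM f).2.1

theorem color_of_joinCorners (h : M.Joinable x t) {c : F → Bool} (ht : c (M.r1 t) ≠ c t)
    (hc : ∀ f, ((M.joinCorners x t).r0 f ≠ f → c ((M.joinCorners x t).r0 f) ≠ c f) ∧
      ((M.joinCorners x t).r1 f ≠ f → c ((M.joinCorners x t).r1 f) ≠ c f) ∧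
      ((M.joinCorners x t).r2 f ≠ f → c ((M.joinCorners x t).r2 f) ≠ c f)) :
    c x ≠ c t ∧ ∀ f, (M.r0 f ≠ f → c (M.r0 f) ≠ c f) ∧ (M.r1 f ≠ f → c (M.r1 f) ≠ c f) ∧
      (M.r2 f ≠ f → c (M.r2 f) ≠ c f) := by
  have tri : ∀ {p q r : Bool}, p ≠ q → r ≠ q → p = r := by decide
  have h1 := fun f => (hc f).2.1
  have hx : c x ≠ c t := by
    have := h1 t
    rw [h.r1_t] at this
    exact this h.ne
  have ht' : c (M.r1 t) = c x := tri ht hx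
  refine ⟨hx, fun f => ⟨(hc f).1, ?_, (hc f).2.2⟩⟩
  have hx' : M.r1 x ≠ x → c (M.r1 x) ≠ c x := by
    intro hxx
    have := h1 (M.r1 t)
    rw [h.r1_t' hxx, ht'] at this
    exact this fun h' => h.ne (M.r1_invol.injective h')
  by_cases g1 : f = x
  · rwa [g1]
  by_cases g2 : f = M.r1 t
  · rw [g2, M.r1_invol]; exact fun _ => ht.symm
  by_cases g3 : M.r1 f = x
  · have : f = M.r1 x := by rw [← g3, M.r1_invol]
    rw [this, M.r1_invol]
    exact fun h' => (hx' h'.symm).symm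
  by_cases g4 : f = t
  · rw [g4]; exact fun _ => ht
  rw [← r1_of_ne g1 g2 g3 g4]
  exact h1 f

end Joinable

/-! ### Disjoint unions of maps -/

variable {S T : Type*}

/-- The disjoint union of two maps. -/
def sum (M : FlagMap S) (N : FlagMap T) : FlagMap (S ⊕ T) where
  r0 := Sum.map M.r0 N.r0
  r1 := Sum.map M.r1 N.r1
  r2 := Sum.map M.r2 N.r2
  r0_invol := by rintro (f | f) <;> simp [M.r0_invol _, N.r0_invol _]
  r1_invol := by rintro (f | f) <;> simp [M.r1_invol _, N.r1_invol _]
  r2_invol := by rintro (f | f) <;> simp [M.r2_invol _, N.r2_invol _]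
  r0_r2_comm := by rintro (f | f) <;> simp [M.r0_r2_comm _, N.r0_r2_comm _]
  r0_ne_r2 := by rintro (f | f) <;> simp [M.r0_ne_r2, N.r0_ne_r2]

theorem numSides_eq_card_orb {F : Type*} (r : F → F) : numSides r = Nat.card (Quot (Orb r r)) :=
  card_quot_congr id id (by rintro f _ rfl; exact Quot.sound (Orb.left f))
    (fun f g h => h.lift (s := fun f g => Quot.mk (fun f g => g = r f) f = Quot.mk _ g)
      ⟨fun _ => rfl, Eq.symm, Eq.trans⟩ id (fun f => Quot.sound rfl) (fun f => Quot.sound rfl))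
    (fun _ => rfl) (fun _ => rfl)

theorem eulerChar_sum [Finite S] [Finite T] (M : FlagMap S) (N : FlagMap T) :
    (M.sum N).eulerChar = M.eulerChar + N.eulerChar := by
  have hV : Nat.card (Quot (M.sum N).SameVertex) = _ := Orb.card_quot_sum M.r1 M.r2 N.r1 N.r2
  have hE : Nat.card (Quot (M.sum N).SameEdge) = _ := Orb.card_quot_sum M.r0 M.r2 N.r0 N.r2
  have hF : Nat.card (Quot (M.sum N).SameFace) = _ := Orb.card_quot_sum M.r0 M.r1 N.r0 N.r1
  have h0 : numSides (M.sum N).r0 = numSides M.r0 + numSides N.r0 := by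
    simp only [numSides_eq_card_orb]; exact Orb.card_quot_sum _ _ _ _
  have h1 : numSides (M.sum N).r1 = numSides M.r1 + numSides N.r1 := by
    simp only [numSides_eq_card_orb]; exact Orb.card_quot_sum _ _ _ _
  have h2 : numSides (M.sum N).r2 = numSides M.r2 + numSides N.r2 := by
    simp only [numSides_eq_card_orb]; exact Orb.card_quot_sum _ _ _ _
  have hV' : Nat.card (Quot M.SameVertex) = Nat.card (Quot (Orb M.r1 M.r2)) := rfl
  have hV'' : Nat.card (Quot N.SameVertex) = Nat.card (Quot (Orb N.r1 N.r2)) := rfl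
  have hE' : Nat.card (Quot M.SameEdge) = Nat.card (Quot (Orb M.r0 M.r2)) := rfl
  have hE'' : Nat.card (Quot N.SameEdge) = Nat.card (Quot (Orb N.r0 N.r2)) := rfl
  have hF' : Nat.card (Quot M.SameFace) = Nat.card (Quot (Orb M.r0 M.r1)) := rfl
  have hF'' : Nat.card (Quot N.SameFace) = Nat.card (Quot (Orb N.r0 N.r1)) := rfl
  unfold eulerChar
  rw [hV, hE, hF, h0, h1, h2, Nat.card_sum, hV', hV'', hE', hE'', hF', hF'']
  push_cast
  ring

theorem sum_sameVertex_iff {M : FlagMap S} {N : FlagMap T} {p q : S ⊕ T} :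
    (M.sum N).SameVertex p q ↔ Sum.LiftRel M.SameVertex N.SameVertex p q := Orb.sum_iff

theorem sum_sameFace_iff {M : FlagMap S} {N : FlagMap T} {p q : S ⊕ T} :
    (M.sum N).SameFace p q ↔ Sum.LiftRel M.SameFace N.SameFace p q := Orb.sum_iff

/-- The restriction of a map to a set of flags that is closed under the adjacencies. -/
def restrict (M : FlagMap F) (S : Set F) (h0 : ∀ f ∈ S, M.r0 f ∈ S) (h1 : ∀ f ∈ S, M.r1 f ∈ S)
    (h2 : ∀ f ∈ S, M.r2 f ∈ S) : FlagMap S where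
  r0 f := ⟨M.r0 f, h0 f f.2⟩
  r1 f := ⟨M.r1 f, h1 f f.2⟩
  r2 f := ⟨M.r2 f, h2 f f.2⟩
  r0_invol f := Subtype.ext (M.r0_invol f)
  r1_invol f := Subtype.ext (M.r1_invol f)
  r2_invol f := Subtype.ext (M.r2_invol f)
  r0_r2_comm f := Subtype.ext (M.r0_r2_comm f)
  r0_ne_r2 f h := M.r0_ne_r2 f (congrArg Subtype.val h)

theorem mem_compl_of_closed {r : F → F} (hr : Function.Involutive r) {S : Set F}
    (h : ∀ f ∈ S, r f ∈ S) : ∀ f ∈ Sᶜ, r f ∈ Sᶜ := fun f hf hf' => hf (by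
  simpa [hr f] using h _ hf')

/-- A map is the disjoint union of its restrictions to a closed set and its complement. -/
theorem exists_iso_sum (M : FlagMap F) (S : Set F) (h0 : ∀ f ∈ S, M.r0 f ∈ S)
    (h1 : ∀ f ∈ S, M.r1 f ∈ S) (h2 : ∀ f ∈ S, M.r2 f ∈ S) :
    ∃ e : Iso ((M.restrict S h0 h1 h2).sum (M.restrict Sᶜ (mem_compl_of_closed M.r0_invol h0)
      (mem_compl_of_closed M.r1_invol h1) (mem_compl_of_closed M.r2_invol h2))) M,
      (∀ f, e.toEquiv (Sum.inl f) = f) ∧ ∀ f, e.toEquiv (Sum.inr f) = f := by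
  classical
  refine ⟨⟨Equiv.Set.sumCompl S, ?_, ?_, ?_⟩, fun f => rfl, fun f => rfl⟩ <;>
  · rintro (f | f) <;> rfl

/-- An isomorphism that takes one part of a map to one part of another. -/
theorem Iso.exists_of_embeddings {F' G G' : Type*} {M : FlagMap F} {M' : FlagMap F'}
    {N : FlagMap G} {N' : FlagMap G'} (e : Iso M M') (ι : G → F) (κ : G' → F')
    (hι : Function.Injective ι) (hκ : Function.Injective κ)
    (hN : ∀ g, ι (N.r0 g) = M.r0 (ι g) ∧ ι (N.r1 g) = M.r1 (ι g) ∧ ι (N.r2 g) = M.r2 (ι g))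
    (hN' : ∀ g, κ (N'.r0 g) = M'.r0 (κ g) ∧ κ (N'.r1 g) = M'.r1 (κ g) ∧ κ (N'.r2 g) = M'.r2 (κ g))
    (h : ∀ g, ∃ g', e.toEquiv (ι g) = κ g') (h' : ∀ g', ∃ g, e.toEquiv (ι g) = κ g') :
    ∃ e' : Iso N N', ∀ g, e.toEquiv (ι g) = κ (e'.toEquiv g) := by
  choose φ hφ using h
  have hbij : Function.Bijective φ := by
    constructor
    · intro g k hgk
      exact hι (e.toEquiv.injective (by rw [hφ, hφ, hgk]))
    · intro g'
      obtain ⟨g, hg⟩ := h' g'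
      exact ⟨g, hκ (by rw [← hφ, hg])⟩
  refine ⟨⟨Equiv.ofBijective φ hbij, fun g => hκ ?_, fun g => hκ ?_, fun g => hκ ?_⟩, hφ⟩
  · rw [Equiv.ofBijective_apply, Equiv.ofBijective_apply, ← hφ, (hN g).1, e.map_r0, hφ, (hN' _).1]
  · rw [Equiv.ofBijective_apply, Equiv.ofBijective_apply, ← hφ, (hN g).2.1, e.map_r1, hφ,
      (hN' _).2.1]
  · rw [Equiv.ofBijective_apply, Equiv.ofBijective_apply, ← hφ, (hN g).2.2, e.map_r2, hφ,
      (hN' _).2.2]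

/-- Two flags are joined by a sequence of steps between adjacent flags, that is, they lie in the
same component of the surface. -/
abbrev Linked (M : FlagMap F) : F → F → Prop :=
  Relation.EqvGen fun f g => g = M.r0 f ∨ g = M.r1 f ∨ g = M.r2 f

theorem Linked.r0 (M : FlagMap F) (f : F) : M.Linked f (M.r0 f) := .rel _ _ (Or.inl rfl)

theorem Linked.r1 (M : FlagMap F) (f : F) : M.Linked f (M.r1 f) := .rel _ _ (Or.inr (Or.inl rfl))

theorem Linked.r2 (M : FlagMap F) (f : F) : M.Linked f (M.r2 f) := .rel _ _ (Or.inr (Or.inr rfl))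

theorem Linked.lift {M : FlagMap F} {G : Type*} {s : G → G → Prop} (hs : Equivalence s) (α : F → G)
    (h0 : ∀ f, s (α f) (α (M.r0 f))) (h1 : ∀ f, s (α f) (α (M.r1 f)))
    (h2 : ∀ f, s (α f) (α (M.r2 f))) {f g : F} (h : M.Linked f g) : s (α f) (α g) :=
  eqvGen_lift hs α (by rintro f g (rfl | rfl | rfl); exacts [h0 f, h1 f, h2 f]) h

theorem Linked.mem_iff {M : FlagMap F} {S : Set F} (h0 : ∀ f ∈ S, M.r0 f ∈ S)
    (h1 : ∀ f ∈ S, M.r1 f ∈ S) (h2 : ∀ f ∈ S, M.r2 f ∈ S) {f g : F} (h : M.Linked f g) :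
    f ∈ S ↔ g ∈ S := by
  refine h.lift (s := fun p q => p ∈ S ↔ q ∈ S) ⟨fun _ => Iff.rfl, Iff.symm, Iff.trans⟩ id
    (fun f => ⟨h0 f, fun h => ?_⟩) (fun f => ⟨h1 f, fun h => ?_⟩) (fun f => ⟨h2 f, fun h => ?_⟩)
  · simpa [M.r0_invol f] using h0 _ h
  · simpa [M.r1_invol f] using h1 _ h
  · simpa [M.r2_invol f] using h2 _ h

end FlagMap

/-! ### Gluing two rooted maps at their roots -/

namespace FlagMap

variable {F G : Type*}

theorem Iso.joinCorners {M : FlagMap F} {N : FlagMap G} (e : Iso M N) {x t : F} {x' t' : G}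
    (hx : e.toEquiv x = x') (ht : e.toEquiv t = t') :
    ∃ e' : Iso (M.joinCorners x t) (N.joinCorners x' t'), e'.toEquiv = e.toEquiv :=
  e.conj M fun g => by rw [apply_flagSwap, e.map_r1, hx, ht]

/-- The disjoint union of two isomorphisms. -/
def Iso.sum {F' G' : Type*} {M : FlagMap F} {N : FlagMap G} {M' : FlagMap F'} {N' : FlagMap G'}
    (e : Iso M M') (e' : Iso N N') : Iso (M.sum N) (M'.sum N') where
  toEquiv := Equiv.sumCongr e.toEquiv e'.toEquiv
  map_r0 := by
    rintro (f | f)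
    exacts [congrArg Sum.inl (e.map_r0 f), congrArg Sum.inr (e'.map_r0 f)]
  map_r1 := by
    rintro (f | f)
    exacts [congrArg Sum.inl (e.map_r1 f), congrArg Sum.inr (e'.map_r1 f)]
  map_r2 := by
    rintro (f | f)
    exacts [congrArg Sum.inl (e.map_r2 f), congrArg Sum.inr (e'.map_r2 f)]

open Classical in
/-- The adjacency `r1` with the corner of `t` cut open. -/
noncomputable def cut (M : FlagMap F) (t g : F) : F := if g = t ∨ g = M.r1 t then g else M.r1 g

/-- The corner of `t` can be cut open without cutting its vertex or its face into two parts. -/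
structure Loose (M : FlagMap F) (t : F) : Prop where
  corner : M.r1 t ≠ t
  vertex : Orb (M.cut t) M.r2 t (M.r1 t)
  face : Orb M.r0 (M.cut t) t (M.r1 t)

theorem cut_invol (M : FlagMap F) (t : F) : Function.Involutive (M.cut t) := by
  intro g
  by_cases hg : g = t ∨ g = M.r1 t
  · simp [cut, hg]
  · have h : ¬ (M.r1 g = t ∨ M.r1 g = M.r1 t) := by
      rwa [M.r1_invol.injective.eq_iff, M.r1_invol.eq_iff, or_comm]
    simp only [cut, hg, h, if_false, M.r1_invol g]

theorem cut_of_mem {M : FlagMap F} {t g : F} (h : g = t ∨ g = M.r1 t) : M.cut t g = g := if_pos h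

theorem cut_of_not_mem {M : FlagMap F} {t g : F} (h : ¬ (g = t ∨ g = M.r1 t)) :
    M.cut t g = M.r1 g := if_neg h

theorem orb_cut_le {M : FlagMap F} {t g h : F} (hgh : Orb (M.cut t) M.r2 g h) :
    M.SameVertex g h := by
  refine hgh.map id (fun f => ?_) fun f => Orb.right f
  by_cases hf : f = t ∨ f = M.r1 t
  · rw [cut_of_mem hf]
  · rw [cut_of_not_mem hf]; exact Orb.left f

/-- A corner at a vertex in the interior can be cut open without cutting the vertex into two
parts: the vertex becomes a path whose ends are the two flags at the corner. -/
theorem orb_cut_of_interior [Finite F] {M : FlagMap F} {t : F} (ht : M.InteriorVertex t) :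
    Orb (M.cut t) M.r2 t (M.r1 t) := by
  rcases Orb.exists_other_end (M.cut_invol t) M.r2_invol (cut_of_mem (Or.inl rfl)) with
    ⟨l, hl, hlt, hfix, -⟩ | ⟨l, hl, hfix, -⟩
  · by_cases h : l = t ∨ l = M.r1 t
    · exact (h.resolve_left hlt) ▸ hl
    · rw [cut_of_not_mem h] at hfix
      exact absurd hfix (ht l (orb_cut_le hl)).1
  · exact absurd hfix (ht l (orb_cut_le hl)).2

end FlagMap

namespace RootedMap

open FlagMap

/-- The disjoint union of two rooted maps with the corners of the two roots joined. The root is that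
of the second map. -/
noncomputable abbrev glue (Y Z : RootedMap) : RootedMap :=
  ⟨Y.F ⊕ Z.F, inferInstance, (Y.M.sum Z.M).joinCorners (Sum.inl Y.root) (Sum.inr Z.root),
    Sum.inr Z.root⟩

theorem glue_congr {Y Y' Z Z' : RootedMap} (hY : Y.cls = Y'.cls) (hZ : Z.cls = Z'.cls) :
    (glue Y Z).cls = (glue Y' Z').cls := by
  obtain ⟨e, he⟩ := cls_eq_iff.1 hY
  obtain ⟨e', he'⟩ := cls_eq_iff.1 hZ
  obtain ⟨i, hi⟩ := (e.sum e').joinCorners (x := Sum.inl Y.root) (t := Sum.inr Z.root)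
    (congrArg Sum.inl he) (congrArg Sum.inr he')
  exact cls_eq_iff.2 ⟨i, (congrArg (fun j => j (Sum.inr Z.root)) hi).trans (congrArg Sum.inr he')⟩

section Glue

variable {Y Z : RootedMap}

theorem joinable (hZ : Z.M.Loose Z.root) :
    (Y.M.sum Z.M).Joinable (Sum.inl Y.root) (Sum.inr Z.root) where
  corner h := hZ.corner (Sum.inr_injective h)
  ne := Sum.inl_ne_inr
  ne' := Sum.inl_ne_inr

theorem glue_r0_inr (h : Z.F) : (glue Y Z).M.r0 (Sum.inr h) = Sum.inr (Z.M.r0 h) := rfl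

theorem glue_r2_inr (h : Z.F) : (glue Y Z).M.r2 (Sum.inr h) = Sum.inr (Z.M.r2 h) := rfl

theorem glue_r2_inl (h : Y.F) : (glue Y Z).M.r2 (Sum.inl h) = Sum.inl (Y.M.r2 h) := rfl

theorem glue_r1_root (hZ : Z.M.Loose Z.root) :
    (glue Y Z).M.r1 (glue Y Z).root = Sum.inl Y.root := (joinable hZ).r1_t

theorem glue_r1_inr {h : Z.F} (h1 : h ≠ Z.root) (h2 : h ≠ Z.M.r1 Z.root) :
    (glue Y Z).M.r1 (Sum.inr h) = Sum.inr (Z.M.r1 h) :=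
  Joinable.r1_of_ne (M := Y.M.sum Z.M) Sum.inr_ne_inl (fun h' => h2 (Sum.inr_injective h'))
    Sum.inr_ne_inl (fun h' => h1 (Sum.inr_injective h'))

theorem glue_r1_inl {h : Y.F} (h1 : h ≠ Y.root) (h2 : Y.M.r1 h ≠ Y.root) :
    (glue Y Z).M.r1 (Sum.inl h) = Sum.inl (Y.M.r1 h) :=
  Joinable.r1_of_ne (M := Y.M.sum Z.M) (fun h' => h1 (Sum.inl_injective h')) Sum.inl_ne_inr
    (fun h' => h2 (Sum.inl_injective h')) Sum.inl_ne_inr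

theorem glue_r1_other_of_ne (hZ : Z.M.Loose Z.root) (h : Y.M.r1 Y.root ≠ Y.root) :
    (glue Y Z).M.r1 (Sum.inr (Z.M.r1 Z.root)) = Sum.inl (Y.M.r1 Y.root) :=
  (joinable hZ).r1_t' fun h' => h (Sum.inl_injective h')

theorem glue_r1_other_of_eq (hZ : Z.M.Loose Z.root) (h : Y.M.r1 Y.root = Y.root) :
    (glue Y Z).M.r1 (Sum.inr (Z.M.r1 Z.root)) = Sum.inr (Z.M.r1 Z.root) :=
  (joinable hZ).r1_t'' (congrArg Sum.inl h)

/-- The corner of the root of `Z` may be cut open before gluing. -/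
theorem glue_orb_of_cut {a : Z.F → Z.F} {a' : Y.F → Y.F} {g h : Z.F}
    (hgh : Orb a (Z.M.cut Z.root) g h) :
    Orb (Sum.map a' a) (glue Y Z).M.r1 (Sum.inr g) (Sum.inr h) := by
  refine hgh.map Sum.inr (fun f => Orb.left (a := Sum.map a' a) (Sum.inr f)) fun f => ?_
  by_cases hf : f = Z.root ∨ f = Z.M.r1 Z.root
  · rw [cut_of_mem hf]
  · rw [cut_of_not_mem hf]
    rw [not_or] at hf
    rw [← glue_r1_inr hf.1 hf.2]
    exact Orb.right _

theorem glue_sameVertex_other (hZ : Z.M.Loose Z.root) :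
    (glue Y Z).M.SameVertex (Sum.inr Z.root) (Sum.inr (Z.M.r1 Z.root)) :=
  (glue_orb_of_cut (a' := Y.M.r2) hZ.vertex.comm).comm

theorem glue_sameFace_other (hZ : Z.M.Loose Z.root) :
    (glue Y Z).M.SameFace (Sum.inr Z.root) (Sum.inr (Z.M.r1 Z.root)) :=
  glue_orb_of_cut (a' := Y.M.r0) hZ.face

theorem glue_sameVertex_iff (hZ : Z.M.Loose Z.root) {p q : Y.F ⊕ Z.F} :
    (glue Y Z).M.SameVertex p q ↔
      JoinRel (Y.M.sum Z.M).SameVertex (Sum.inl Y.root) (Sum.inr Z.root) p q :=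
  (joinable hZ).sameVertex_joinCorners (glue_sameVertex_other hZ)

theorem glue_sameVertex_root_inl (hZ : Z.M.Loose Z.root) {g : Y.F} :
    (glue Y Z).M.SameVertex (glue Y Z).root (Sum.inl g) ↔ Y.M.SameVertex Y.root g := by
  refine (glue_sameVertex_iff hZ).trans ?_
  change JoinRel _ _ _ (Sum.inr Z.root) _ ↔ _
  simp only [JoinRel, sum_sameVertex_iff, Sum.liftRel_inl_inl, Sum.liftRel_inr_inr,
    Sum.not_liftRel_inr_inl, Sum.not_liftRel_inl_inr, false_or, or_false]
  exact ⟨fun h => h.2.symm, fun h => ⟨Orb.refl _, h.symm⟩⟩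

theorem glue_sameVertex_root_inr (hZ : Z.M.Loose Z.root) {g : Z.F} :
    (glue Y Z).M.SameVertex (glue Y Z).root (Sum.inr g) ↔ Z.M.SameVertex Z.root g := by
  refine (glue_sameVertex_iff hZ).trans ?_
  change JoinRel _ _ _ (Sum.inr Z.root) _ ↔ _
  simp only [JoinRel, sum_sameVertex_iff, Sum.liftRel_inr_inr, Sum.not_liftRel_inr_inl, false_or]
  exact ⟨fun h => h.elim id fun h => h.2.symm, Or.inl⟩

theorem glue_innerFlags (hZ : Z.M.Loose Z.root) :
    (glue Y Z).M.innerFlags (glue Y Z).root =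
      Y.M.innerFlags Y.root + Z.M.innerFlags Z.root := by
  unfold innerFlags
  rw [← Nat.card_sum]
  refine Nat.card_congr ((Equiv.subtypeSum (α := Y.F) (β := Z.F)).trans (Equiv.sumCongr
    (Equiv.subtypeEquivRight fun g => ?_) (Equiv.subtypeEquivRight fun g => ?_)))
  · rw [glue_sameVertex_root_inl hZ, glue_r2_inl, Ne, Sum.inl_injective.eq_iff]
  · rw [glue_sameVertex_root_inr hZ, glue_r2_inr, Ne, Sum.inr_injective.eq_iff]

theorem glue_degree (hZ : Z.M.Loose Z.root) : (glue Y Z).degree = Y.degree + Z.degree := by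
  have := glue_innerFlags (Y := Y) hZ
  have h1 := (glue Y Z).two_mul_degree
  have h2 := Y.two_mul_degree
  have h3 := Z.two_mul_degree
  omega

theorem glue_darts : (glue Y Z).darts = Y.darts + Z.darts := by
  have h0 : Nat.card (glue Y Z).F = Nat.card Y.F + Nat.card Z.F := Nat.card_sum
  have h1 := (glue Y Z).two_mul_darts
  have h2 := Y.two_mul_darts
  have h3 := Z.two_mul_darts
  omega

theorem glue_interiorVertex (hZ : Z.M.Loose Z.root) (hZi : Z.M.InteriorVertex Z.root) :
    (glue Y Z).M.InteriorVertex (glue Y Z).root ↔ Y.M.InteriorVertex Y.root := by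
  constructor
  · intro h g hg
    have h' := h (Sum.inl g) ((glue_sameVertex_root_inl hZ).2 hg)
    refine ⟨fun hr => ?_, fun hr => h'.2 (congrArg Sum.inl hr)⟩
    by_cases g1 : g = Y.root
    · have := h (Sum.inr (Z.M.r1 Z.root)) ((glue_sameVertex_root_inr hZ).2 (Orb.left _))
      exact this.1 (glue_r1_other_of_eq hZ (g1 ▸ hr))
    · refine h'.1 ?_
      rw [glue_r1_inl g1 (hr.symm ▸ g1), hr]
  · rintro h (g | g) hg
    · have hg' := (glue_sameVertex_root_inl hZ).1 hg
      refine ⟨fun hr => ?_, fun hr => (h g hg').2 (Sum.inl_injective hr)⟩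
      by_cases g1 : g = Y.root
      · rw [g1, show (glue Y Z).M.r1 (Sum.inl Y.root) = _ from (joinable hZ).r1_x] at hr
        exact Sum.inr_ne_inl hr
      by_cases g2 : Y.M.r1 g = Y.root
      · have hg2 : g = Y.M.r1 Y.root := by rw [← g2, Y.M.r1_invol]
        have hne : Y.M.r1 Y.root ≠ Y.root := fun h' => g1 (hg2.trans h')
        have := (glue Y Z).M.r1_invol.eq_iff.1 (glue_r1_other_of_ne (Y := Y) hZ hne)
        rw [hg2, ← this] at hr
        exact Sum.inr_ne_inl hr
      · rw [glue_r1_inl g1 g2] at hr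
        exact (h g hg').1 (Sum.inl_injective hr)
    · have hg' := (glue_sameVertex_root_inr hZ).1 hg
      refine ⟨fun hr => ?_, fun hr => (hZi g hg').2 (Sum.inr_injective hr)⟩
      by_cases g1 : g = Z.root
      · rw [g1, show (glue Y Z).M.r1 (Sum.inr Z.root) = _ from glue_r1_root hZ] at hr
        exact Sum.inl_ne_inr hr
      by_cases g2 : g = Z.M.r1 Z.root
      · rw [g2, glue_r1_other_of_ne hZ (h _ (Orb.refl _)).1] at hr
        exact Sum.inl_ne_inr hr
      · rw [glue_r1_inr g1 g2] at hr
        exact (hZi g hg').1 (Sum.inr_injective hr)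

/-- Gluing joins two vertices and two faces. -/
theorem glue_eulerChar (hZ : Z.M.Loose Z.root) :
    (glue Y Z).M.eulerChar + 2 = Y.M.eulerChar + Z.M.eulerChar := by
  rw [← eulerChar_sum]
  refine (joinable hZ).eulerChar_joinCorners (glue_sameVertex_other hZ) (glue_sameFace_other hZ)
    ?_ ?_
  · rw [sum_sameVertex_iff]; exact Sum.not_liftRel_inl_inr
  · rw [sum_sameFace_iff]; exact Sum.not_liftRel_inl_inr

theorem glue_connected (hZ : Z.M.Loose Z.root) (hY : Y.M.Connected) (hZc : Z.M.Connected) :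
    (glue Y Z).M.Connected := by
  have hE := eqvGen_equivalence fun f g =>
    g = (glue Y Z).M.r0 f ∨ g = (glue Y Z).M.r1 f ∨ g = (glue Y Z).M.r2 f
  have hle : ∀ p q, (Y.M.sum Z.M).Linked p q → (glue Y Z).M.Linked p q := by
    intro p q hpq
    refine Linked.lift (M := Y.M.sum Z.M) hE id (Linked.r0 (glue Y Z).M) ?_
      (Linked.r2 (glue Y Z).M) hpq
    have hxt : (glue Y Z).M.Linked (Sum.inl Y.root) (Sum.inr Z.root) := by
      have := Linked.r1 (glue Y Z).M (glue Y Z).root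
      rw [glue_r1_root hZ] at this
      exact hE.symm this
    have htt : (glue Y Z).M.Linked (Sum.inr Z.root) (Sum.inr (Z.M.r1 Z.root)) :=
      Orb.lift hE id (Linked.r1 (glue Y Z).M) (Linked.r2 (glue Y Z).M)
        (glue_sameVertex_other (Y := Y) hZ)
    refine (joinable hZ).forall_r1 hE ?_ htt ?_
    · intro _ hr
      exact hE.trans hxt (hE.trans htt (.rel _ _ (Or.inr (Or.inl hr.symm))))
    · intro g _ _ _ _ hr
      exact .rel _ _ (Or.inr (Or.inl hr.symm))
  have hroot : ∀ p, (glue Y Z).M.Linked (glue Y Z).root p := by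
    rintro (g | g)
    · have h1 : (Y.M.sum Z.M).Linked (Sum.inl Y.root) (Sum.inl g) :=
        Linked.lift (eqvGen_equivalence _) Sum.inl (fun f => Linked.r0 (Y.M.sum Z.M) (Sum.inl f))
          (fun f => Linked.r1 (Y.M.sum Z.M) (Sum.inl f))
          (fun f => Linked.r2 (Y.M.sum Z.M) (Sum.inl f)) (hY Y.root g)
      have h2 := Linked.r1 (glue Y Z).M (glue Y Z).root
      rw [glue_r1_root hZ] at h2
      exact hE.trans h2 (hle _ _ h1)
    · exact hle _ _ (Linked.lift (eqvGen_equivalence _) Sum.inr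
        (fun f => Linked.r0 (Y.M.sum Z.M) (Sum.inr f))
        (fun f => Linked.r1 (Y.M.sum Z.M) (Sum.inr f))
        (fun f => Linked.r2 (Y.M.sum Z.M) (Sum.inr f)) (hZc Z.root g))
  exact fun p q => hE.trans (hE.symm (hroot p)) (hroot q)

theorem glue_orientable (hZ : Z.M.Loose Z.root)
    (hZ' : Z.M.r1 Z.root = Z.M.r0 Z.root ∨ Z.M.r1 Z.root = Z.M.r2 Z.root) :
    (glue Y Z).M.Orientable ↔ Y.M.Orientable ∧ Z.M.Orientable := by
  constructor
  · rintro ⟨c, hc⟩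
    have ht : c (Sum.inr (Z.M.r1 Z.root)) ≠ c (Sum.inr Z.root) := by
      rcases hZ' with h | h
      · rw [h]
        exact (hc (Sum.inr Z.root)).1 fun h' => hZ.corner (h.trans (Sum.inr_injective h'))
      · rw [h]
        exact (hc (Sum.inr Z.root)).2.2 fun h' => hZ.corner (h.trans (Sum.inr_injective h'))
    have h := ((joinable hZ).color_of_joinCorners ht hc).2
    refine ⟨⟨c ∘ Sum.inl, fun f => ?_⟩, ⟨c ∘ Sum.inr, fun f => ?_⟩⟩
    · have := h (Sum.inl f)
      exact ⟨fun h' => this.1 fun h'' => h' (Sum.inl_injective h''),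
        fun h' => this.2.1 fun h'' => h' (Sum.inl_injective h''),
        fun h' => this.2.2 fun h'' => h' (Sum.inl_injective h'')⟩
    · have := h (Sum.inr f)
      exact ⟨fun h' => this.1 fun h'' => h' (Sum.inr_injective h''),
        fun h' => this.2.1 fun h'' => h' (Sum.inr_injective h''),
        fun h' => this.2.2 fun h'' => h' (Sum.inr_injective h'')⟩
  · rintro ⟨⟨c, hc⟩, ⟨d, hd⟩⟩
    -- the colours of `Z` are exchanged if the two roots have the same colour
    obtain ⟨d', hd', hne⟩ : ∃ d' : Z.F → Bool, (∀ f, (Z.M.r0 f ≠ f → d' (Z.M.r0 f) ≠ d' f) ∧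
        (Z.M.r1 f ≠ f → d' (Z.M.r1 f) ≠ d' f) ∧ (Z.M.r2 f ≠ f → d' (Z.M.r2 f) ≠ d' f)) ∧
        c Y.root ≠ d' Z.root := by
      by_cases h : c Y.root = d Z.root
      · refine ⟨fun f => !d f, fun f => ?_, by simp [h]⟩
        simpa using hd f
      · exact ⟨d, hd, h⟩
    refine ⟨Sum.elim c d', (joinable hZ).orientable_iff_of_color hne ?_⟩
    rintro (f | f)
    · exact ⟨fun h => (hc f).1 fun h' => h (congrArg Sum.inl h'),
        fun h => (hc f).2.1 fun h' => h (congrArg Sum.inl h'),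
        fun h => (hc f).2.2 fun h' => h (congrArg Sum.inl h')⟩
    · exact ⟨fun h => (hd' f).1 fun h' => h (congrArg Sum.inr h'),
        fun h => (hd' f).2.1 fun h' => h (congrArg Sum.inr h'),
        fun h => (hd' f).2.2 fun h' => h (congrArg Sum.inr h')⟩

/-- The two parts can be recovered from the result of gluing. -/
theorem glue_cls_iff {Y' Z' : RootedMap} (hZ : Z.M.Loose Z.root) (hZ' : Z'.M.Loose Z'.root)
    (hr : (Z.M.r1 Z.root = Z.M.r0 Z.root ∧ Z'.M.r1 Z'.root = Z'.M.r0 Z'.root) ∨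
      (Z.M.r1 Z.root = Z.M.r2 Z.root ∧ Z'.M.r1 Z'.root = Z'.M.r2 Z'.root))
    (hYc : Y.M.Connected) (hZc : Z.M.Connected) :
    (glue Y Z).cls = (glue Y' Z').cls ↔ Y.cls = Y'.cls ∧ Z.cls = Z'.cls := by
  refine ⟨fun h => ?_, fun h => glue_congr h.1 h.2⟩
  obtain ⟨e, he⟩ := cls_eq_iff.1 h
  have het : e.toEquiv (Sum.inr Z.root) = Sum.inr Z'.root := he
  have hex : e.toEquiv (Sum.inl Y.root) = Sum.inl Y'.root := by
    rw [← glue_r1_root hZ, e.map_r1, he, glue_r1_root hZ']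
  have het' : e.toEquiv (Sum.inr (Z.M.r1 Z.root)) = Sum.inr (Z'.M.r1 Z'.root) := by
    rcases hr with hr | hr
    · rw [hr.1, hr.2, ← glue_r0_inr, e.map_r0, het, glue_r0_inr]
    · rw [hr.1, hr.2, ← glue_r2_inr, e.map_r2, het, glue_r2_inr]
  obtain ⟨i, hi⟩ := e.conj _ (π := flagSwap (Sum.inl Y.root) (Sum.inr (Z.M.r1 Z.root)))
    (ρ := flagSwap (Sum.inl Y'.root) (Sum.inr (Z'.M.r1 Z'.root))) fun g => by
      rw [apply_flagSwap, hex, het']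
  have h1 : (glue Y Z).M.conj (flagSwap (Sum.inl Y.root) (Sum.inr (Z.M.r1 Z.root))) =
    Y.M.sum Z.M := Joinable.joinCorners_conj rfl
  have h2 : (glue Y' Z').M.conj (flagSwap (Sum.inl Y'.root) (Sum.inr (Z'.M.r1 Z'.root))) =
    Y'.M.sum Z'.M := Joinable.joinCorners_conj rfl
  obtain ⟨i, hi⟩ : ∃ i : Iso (Y.M.sum Z.M) (Y'.M.sum Z'.M), i.toEquiv = e.toEquiv := by
    rw [← h1, ← h2]; exact ⟨i, hi⟩
  -- the isomorphism maps the component of each root to the component of the other root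
  have hside : ∀ p q, (Y.M.sum Z.M).Linked p q →
      ((i.toEquiv p).isLeft = (i.toEquiv q).isLeft) := by
    intro p q hpq
    refine hpq.lift (s := fun p q : Y'.F ⊕ Z'.F => p.isLeft = q.isLeft)
      ⟨fun _ => rfl, Eq.symm, Eq.trans⟩ i.toEquiv (fun f => ?_) (fun f => ?_) (fun f => ?_)
    · rw [i.map_r0]; cases i.toEquiv f <;> rfl
    · rw [i.map_r1]; cases i.toEquiv f <;> rfl
    · rw [i.map_r2]; cases i.toEquiv f <;> rfl
  have hlin : ∀ g, (Y.M.sum Z.M).Linked (Sum.inl Y.root) (Sum.inl g) := fun g =>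
    Linked.lift (eqvGen_equivalence _) Sum.inl (fun f => Linked.r0 (Y.M.sum Z.M) (Sum.inl f))
      (fun f => Linked.r1 (Y.M.sum Z.M) (Sum.inl f))
      (fun f => Linked.r2 (Y.M.sum Z.M) (Sum.inl f)) (hYc Y.root g)
  have hrin : ∀ g, (Y.M.sum Z.M).Linked (Sum.inr Z.root) (Sum.inr g) := fun g =>
    Linked.lift (eqvGen_equivalence _) Sum.inr (fun f => Linked.r0 (Y.M.sum Z.M) (Sum.inr f))
      (fun f => Linked.r1 (Y.M.sum Z.M) (Sum.inr f))
      (fun f => Linked.r2 (Y.M.sum Z.M) (Sum.inr f)) (hZc Z.root g)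
  have hl : ∀ g, ∃ g', i.toEquiv (Sum.inl g) = Sum.inl g' := fun g => by
    have := hside _ _ (hlin g)
    rw [hi, hex, ← hi] at this
    exact Sum.isLeft_iff.1 this.symm
  have hr : ∀ g, ∃ g', i.toEquiv (Sum.inr g) = Sum.inr g' := fun g => by
    have := hside _ _ (hrin g)
    rw [hi, het, ← hi] at this
    exact Sum.isRight_iff.1 (by rw [← Sum.not_isLeft, ← this]; exact Bool.false_ne_true)
  have hl' : ∀ g', ∃ g, i.toEquiv (Sum.inl g) = Sum.inl g' := fun g' => by
    obtain ⟨p | p, hp⟩ := i.toEquiv.surjective (Sum.inl g')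
    · exact ⟨p, hp⟩
    · obtain ⟨q, hq⟩ := hr p
      exact absurd (hq.symm.trans hp) Sum.inr_ne_inl
  have hr' : ∀ g', ∃ g, i.toEquiv (Sum.inr g) = Sum.inr g' := fun g' => by
    obtain ⟨p | p, hp⟩ := i.toEquiv.surjective (Sum.inr g')
    · obtain ⟨q, hq⟩ := hl p
      exact absurd (hq.symm.trans hp) Sum.inl_ne_inr
    · exact ⟨p, hp⟩
  obtain ⟨j, hj⟩ := i.exists_of_embeddings (N := Y.M) (N' := Y'.M) Sum.inl Sum.inl
    Sum.inl_injective Sum.inl_injective (fun _ => ⟨rfl, rfl, rfl⟩) (fun _ => ⟨rfl, rfl, rfl⟩) hl hl'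
  obtain ⟨k, hk⟩ := i.exists_of_embeddings (N := Z.M) (N' := Z'.M) Sum.inr Sum.inr
    Sum.inr_injective Sum.inr_injective (fun _ => ⟨rfl, rfl, rfl⟩) (fun _ => ⟨rfl, rfl, rfl⟩) hr hr'
  refine ⟨cls_eq_iff.2 ⟨j, Sum.inl_injective (β := Z'.F) ?_⟩,
    cls_eq_iff.2 ⟨k, Sum.inr_injective (α := Y'.F) ?_⟩⟩
  · rw [← hj, hi, hex]
  · rw [← hk, hi, het]

end Glue

/-- A connected map that falls apart when the corner of the root is joined with `t'` is the result
of gluing the two parts. -/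
theorem exists_glue (X : RootedMap) {t' : X.F} (hX : X.M.Connected) (ht' : t' ≠ X.root)
    (hx : X.M.r1 X.root ≠ X.root) (hx' : X.M.r1 X.root ≠ t') {S : Set X.F}
    (h0 : ∀ f ∈ S, X.M.r0 f ∈ S)
    (h1 : ∀ f ∈ S, (X.M.conj (flagSwap (X.M.r1 X.root) t')).r1 f ∈ S)
    (h2 : ∀ f ∈ S, X.M.r2 f ∈ S) (hS : X.M.r1 X.root ∈ S) (hS' : X.root ∉ S) :
    ∃ Y Z : RootedMap, Y.M.Connected ∧ Z.M.Connected ∧ Z.M.r1 Z.root ≠ Z.root ∧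
      (t' = X.M.r0 X.root → Z.M.r1 Z.root = Z.M.r0 Z.root) ∧
      (t' = X.M.r2 X.root → Z.M.r1 Z.root = Z.M.r2 Z.root) ∧ X.cls = (glue Y Z).cls := by
  set t := X.root with ht
  set x := X.M.r1 t with hxdef
  set N := X.M.conj (flagSwap x t') with hN
  have hNt : N.r1 t = t' := by
    rw [hN, conj_r1, flagSwap_symm, flagSwap_of_ne hx.symm ht'.symm, ← hxdef, flagSwap_left]
  have hJ : N.Joinable x t := ⟨by rwa [hNt], hx, by rwa [hNt]⟩
  have hMN : N.joinCorners x t = X.M := by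
    rw [joinCorners, hNt]; exact X.M.conj_conj (flagSwap_mul_self _ _)
  have hS1 : ∀ f ∈ Sᶜ, N.r0 f ∈ Sᶜ := mem_compl_of_closed N.r0_invol h0
  have hS2 : ∀ f ∈ Sᶜ, N.r1 f ∈ Sᶜ := mem_compl_of_closed N.r1_invol h1
  have hS3 : ∀ f ∈ Sᶜ, N.r2 f ∈ Sᶜ := mem_compl_of_closed N.r2_invol h2
  obtain ⟨e, hel, her⟩ := N.exists_iso_sum S h0 h1 h2
  have hE := eqvGen_equivalence fun f g => g = N.r0 f ∨ g = N.r1 f ∨ g = N.r2 f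
  -- every flag is linked to one of the two roots
  have hall : ∀ g h, JoinRel N.Linked x t g h := by
    intro g h
    have hJE := JoinRel.equivalence hE x t
    refine Linked.lift (M := X.M) hJE id ?_ ?_ ?_ (hX g h)
    · exact fun f => Or.inl (Linked.r0 N f)
    · have key : ∀ f, JoinRel N.Linked x t f ((N.joinCorners x t).r1 f) :=
        hJ.forall_r1_joinCorners hJE (Or.inr ⟨Or.inl (hE.refl x), Or.inr (hE.refl t)⟩)
          (fun _ => Or.inr ⟨Or.inr (hE.symm (Linked.r1 N t)), Or.inl (hE.symm (Linked.r1 N x))⟩)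
          fun f => Or.inl (Or.inl (Linked.r1 N f))
      rwa [hMN] at key
    · exact fun f => Or.inl (Linked.r2 N f)
  have hmem : ∀ {g h}, N.Linked g h → (g ∈ S ↔ h ∈ S) := fun h => Linked.mem_iff (M := N) h0 h1 h2 h
  have hconn : ∀ (T : Set X.F) (k0 : ∀ f ∈ T, N.r0 f ∈ T) (k1 : ∀ f ∈ T, N.r1 f ∈ T)
      (k2 : ∀ f ∈ T, N.r2 f ∈ T) (u : X.F), (∀ f ∈ T, N.Linked f u) →
      (N.restrict T k0 k1 k2).Connected := by
    intro T k0 k1 k2 u hu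
    have key : ∀ g h, N.Linked g h → (g ∈ T ↔ h ∈ T) ∧
        ∀ (hg : g ∈ T) (hh : h ∈ T), (N.restrict T k0 k1 k2).Linked ⟨g, hg⟩ ⟨h, hh⟩ := by
      intro g h hgh
      have hm : ∀ {g h}, N.Linked g h → (g ∈ T ↔ h ∈ T) := fun h =>
        Linked.mem_iff (M := N) k0 k1 k2 h
      refine hgh.lift (s := fun g h => (g ∈ T ↔ h ∈ T) ∧
        ∀ (hg : g ∈ T) (hh : h ∈ T), (N.restrict T k0 k1 k2).Linked ⟨g, hg⟩ ⟨h, hh⟩)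
        ⟨fun g => ⟨Iff.rfl, fun _ _ => .refl _⟩,
          fun h => ⟨h.1.symm, fun hg hh => (h.2 hh hg).symm⟩,
          fun h h' => ⟨h.1.trans h'.1, fun hg hh =>
            (h.2 hg (h.1.1 hg)).trans _ _ _ (h'.2 (h.1.1 hg) hh)⟩⟩ id
        (fun f => ⟨hm (Linked.r0 N f), fun hg hh => ?_⟩)
        (fun f => ⟨hm (Linked.r1 N f), fun hg hh => ?_⟩)
        (fun f => ⟨hm (Linked.r2 N f), fun hg hh => ?_⟩)
      exacts [Linked.r0 (N.restrict T k0 k1 k2) ⟨f, hg⟩, Linked.r1 (N.restrict T k0 k1 k2) ⟨f, hg⟩,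
        Linked.r2 (N.restrict T k0 k1 k2) ⟨f, hg⟩]
    intro g h
    exact (key _ _ (hE.trans (hu g g.2) (hE.symm (hu h h.2)))).2 g.2 h.2
  refine ⟨⟨S, inferInstance, N.restrict S h0 h1 h2, ⟨x, hS⟩⟩,
    ⟨↥Sᶜ, inferInstance, N.restrict Sᶜ hS1 hS2 hS3, ⟨t, hS'⟩⟩, ?_, ?_, ?_, ?_, ?_, ?_⟩
  · refine hconn S h0 h1 h2 x fun f hf => ?_
    rcases hall f x with h | ⟨h | h, -⟩
    exacts [h, h, absurd ((hmem h).1 hf) hS']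
  · refine hconn Sᶜ hS1 hS2 hS3 t fun f hf => ?_
    rcases hall f t with h | ⟨h | h, -⟩
    exacts [h, absurd ((hmem h).2 hS) hf, h]
  · exact fun h => ht' (hNt.symm.trans (congrArg Subtype.val h))
  · exact fun h => Subtype.ext (hNt.trans h)
  · exact fun h => Subtype.ext (hNt.trans h)
  · obtain ⟨i, hi⟩ := e.joinCorners (x := Sum.inl ⟨x, hS⟩) (t := Sum.inr ⟨t, hS'⟩) (hel _) (her _)
    refine (cls_eq_iff.2 ?_).symm
    have : ∃ j : Iso (((N.restrict S h0 h1 h2).sum (N.restrict Sᶜ hS1 hS2 hS3)).joinCorners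
        (Sum.inl ⟨x, hS⟩) (Sum.inr ⟨t, hS'⟩)) X.M, j.toEquiv = e.toEquiv := by
      rw [← hMN]; exact ⟨i, hi⟩
    obtain ⟨j, hj⟩ := this
    exact ⟨j, (congrArg (fun k => k (Sum.inr ⟨t, hS'⟩)) hj).trans (her _)⟩

/-- Counting the results of gluing is counting pairs. -/
theorem count_glue {P : RootedMap → Prop} {Q : RootedMap → RootedMap → Prop}
    (h₁ : ∀ X, P X → ∃ Y Z, Q Y Z ∧ X.cls = (glue Y Z).cls) (h₂ : ∀ Y Z, Q Y Z → P (glue Y Z))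
    (hQ : ∀ Y Z, Q Y Z → Y.M.Connected ∧ Z.M.Connected ∧ Z.M.Loose Z.root)
    (hr : (∀ Y Z, Q Y Z → Z.M.r1 Z.root = Z.M.r0 Z.root) ∨
      ∀ Y Z, Q Y Z → Z.M.r1 Z.root = Z.M.r2 Z.root) :
    count P = ((fun p : RootedMap × RootedMap => (p.1.cls, p.2.cls)) ''
      {p | Q p.1 p.2}).ncard := by
  refine ncard_image_eq_of_rel cls _ (fun X p => X.cls = (glue p.1 p.2).cls) ?_ ?_ ?_
  · intro X hX
    obtain ⟨Y, Z, h⟩ := h₁ X hX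
    exact ⟨(Y, Z), h⟩
  · rintro ⟨Y, Z⟩ h
    exact ⟨_, h₂ Y Z h, rfl⟩
  · rintro X X' ⟨Y, Z⟩ ⟨Y', Z'⟩ - - h h' hX hX'
    rw [hX, hX']
    obtain ⟨h1, h2, h3⟩ := hQ Y Z h
    have h3' := (hQ Y' Z' h').2.2
    refine (glue_cls_iff h3 h3' ?_ h1 h2).trans Prod.mk_inj.symm
    exact hr.imp (fun hr => ⟨hr Y Z h, hr Y' Z' h'⟩) (fun hr => ⟨hr Y Z h, hr Y' Z' h'⟩)

theorem ncard_pairs (A B : RootedMap → Prop) :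
    ((fun p : RootedMap × RootedMap => (p.1.cls, p.2.cls)) '' {p | A p.1 ∧ B p.2}).ncard =
      count A * count B := by
  have h : (fun p : RootedMap × RootedMap => (p.1.cls, p.2.cls)) '' {p | A p.1 ∧ B p.2} =
      (cls '' {X | A X}) ×ˢ (cls '' {X | B X}) := Set.prodMap_image_prod cls cls _ _
  rw [h, Set.ncard_prod]
  rfl

end RootedMap

/-! ### The maps with at most one edge -/

namespace FlagMap

/-- A map on the four flags of a complete edge: `(i, j)` is at the end `i` and on the side `j`. -/
def ofEdge (r : Bool × Bool → Bool × Bool) (hr : Function.Involutive r) :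
    FlagMap (Bool × Bool) where
  r0 p := (!p.1, p.2)
  r1 := r
  r2 p := (p.1, !p.2)
  r0_invol := by unfold Function.Involutive; decide
  r1_invol := hr
  r2_invol := by unfold Function.Involutive; decide
  r0_r2_comm := by decide
  r0_ne_r2 := by decide

/-- The complete edge on the sphere whose two ends are at the same vertex. -/
def loopEdge : FlagMap (Bool × Bool) :=
  ofEdge (fun p => (!p.1, p.2)) (by unfold Function.Involutive; decide)

/-- The complete edge on the sphere whose two ends are at different vertices. -/
def segment : FlagMap (Bool × Bool) :=
  ofEdge (fun p => (p.1, !p.2)) (by unfold Function.Involutive; decide)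

/-- The complete edge on the disk with one end in the interior and the other one on the boundary. -/
def spoke : FlagMap (Bool × Bool) :=
  ofEdge (fun p => (p.1, xor (!p.1) p.2)) (by unfold Function.Involutive; decide)

/-- The halfedge on the disk. -/
def halfedge : FlagMap Bool where
  r0 := id
  r1 := not
  r2 := not
  r0_invol := by unfold Function.Involutive; decide
  r1_invol := by unfold Function.Involutive; decide
  r2_invol := by unfold Function.Involutive; decide
  r0_r2_comm := by decide
  r0_ne_r2 := by decide

theorem card_quot_orb_eq {F G : Type*} {a b : F → F} (φ : F → G) (hφ : Function.Surjective φ)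
    (ha : ∀ f, φ (a f) = φ f) (hb : ∀ f, φ (b f) = φ f)
    (h : ∀ f g, φ f = φ g → g = f ∨ g = a f ∨ g = b f ∨ g = a (b f)) :
    Nat.card (Quot (Orb a b)) = Nat.card G := by
  have key : ∀ f g, Orb a b f g → φ f = φ g := fun f g hfg =>
    hfg.lift (s := Eq) ⟨fun _ => rfl, Eq.symm, Eq.trans⟩ φ (fun f => (ha f).symm)
      fun f => (hb f).symm
  refine Nat.card_congr (Equiv.ofBijective (Quot.lift φ key) ⟨?_, fun g => ?_⟩)
  · rintro ⟨f⟩ ⟨g⟩ hfg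
    refine Quot.sound ?_
    rcases h f g hfg with rfl | rfl | rfl | rfl
    exacts [Orb.refl _, Orb.left _, Orb.right _, (Orb.right _).trans (Orb.left _)]
  · obtain ⟨f, rfl⟩ := hφ g
    exact ⟨Quot.mk _ f, rfl⟩

theorem card_quot_side_eq {F G : Type*} {r : F → F} (φ : F → G) (hφ : Function.Surjective φ)
    (hr : ∀ f, φ (r f) = φ f) (h : ∀ f g, φ f = φ g → g = f ∨ g = r f) :
    numSides r = Nat.card G := by
  rw [numSides_eq_card_orb]
  exact card_quot_orb_eq φ hφ hr hr fun f g hfg => (h f g hfg).imp id Or.inl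

theorem connected_ofEdge {r : Bool × Bool → Bool × Bool} {hr : Function.Involutive r} :
    (ofEdge r hr).Connected := by
  have hE := eqvGen_equivalence fun f g => g = (ofEdge r hr).r0 f ∨ g = (ofEdge r hr).r1 f ∨
    g = (ofEdge r hr).r2 f
  have key : ∀ p, (ofEdge r hr).Linked (false, false) p := by
    have h0 := Linked.r0 (ofEdge r hr)
    have h2 := Linked.r2 (ofEdge r hr)
    rintro ⟨_ | _, _ | _⟩
    exacts [hE.refl _, h2 (false, false), h0 (false, false),
      hE.trans (h0 (false, false)) (h2 (true, false))]
  exact fun p q => hE.trans (hE.symm (key p)) (key q)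

theorem numSides_r0_ofEdge {r : Bool × Bool → Bool × Bool} {hr : Function.Involutive r} :
    numSides (ofEdge r hr).r0 = 2 :=
  (card_quot_side_eq (r := (ofEdge r hr).r0) (G := Bool) Prod.snd (by decide) (fun _ => rfl)
    (show ∀ f g : Bool × Bool, f.2 = g.2 → g = f ∨ g = (!f.1, f.2) by decide)).trans (by simp)

theorem numSides_r2_ofEdge {r : Bool × Bool → Bool × Bool} {hr : Function.Involutive r} :
    numSides (ofEdge r hr).r2 = 2 :=
  (card_quot_side_eq (r := (ofEdge r hr).r2) (G := Bool) Prod.fst (by decide) (fun _ => rfl)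
    (show ∀ f g : Bool × Bool, f.1 = g.1 → g = f ∨ g = (f.1, !f.2) by decide)).trans (by simp)

theorem card_sameEdge_ofEdge {r : Bool × Bool → Bool × Bool} {hr : Function.Involutive r} :
    Nat.card (Quot (ofEdge r hr).SameEdge) = 1 :=
  (card_quot_orb_eq (G := Unit) (fun _ => ()) (by decide) (fun _ => rfl) (fun _ => rfl)
    (show ∀ f g : Bool × Bool, () = () → g = f ∨ g = (!f.1, f.2) ∨ g = (f.1, !f.2) ∨
      g = (!f.1, !f.2) by decide)).trans (by simp)

theorem isSphere_loopEdge : loopEdge.IsSphere := by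
  refine ⟨connected_ofEdge, ⟨fun p => xor p.1 p.2, by decide⟩, ?_⟩
  have h1 : Nat.card (Quot loopEdge.SameVertex) = 1 :=
    (card_quot_orb_eq (G := Unit) (fun _ => ()) (by decide) (by decide) (by decide)
      (by decide)).trans (by simp)
  have h2 : Nat.card (Quot loopEdge.SameFace) = 2 :=
    (card_quot_orb_eq (G := Bool) Prod.snd (by decide) (by decide) (by decide)
      (by decide)).trans (by simp)
  have h3 : numSides loopEdge.r1 = 2 := numSides_r0_ofEdge (r := fun p => (!p.1, p.2))
    (hr := loopEdge.r1_invol)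
  rw [eulerChar, h1, h2, h3]
  unfold loopEdge
  rw [numSides_r0_ofEdge, numSides_r2_ofEdge, card_sameEdge_ofEdge]
  simp

theorem isSphere_segment : segment.IsSphere := by
  refine ⟨connected_ofEdge, ⟨fun p => xor p.1 p.2, by decide⟩, ?_⟩
  have h1 : Nat.card (Quot segment.SameFace) = 1 :=
    (card_quot_orb_eq (G := Unit) (fun _ => ()) (by decide) (by decide) (by decide)
      (by decide)).trans (by simp)
  have h2 : Nat.card (Quot segment.SameVertex) = 2 :=
    (card_quot_orb_eq (G := Bool) Prod.fst (by decide) (by decide) (by decide)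
      (by decide)).trans (by simp)
  have h3 : numSides segment.r1 = 2 := numSides_r2_ofEdge (r := fun p => (p.1, !p.2))
    (hr := segment.r1_invol)
  rw [eulerChar, h1, h2, h3]
  unfold segment
  rw [numSides_r0_ofEdge, numSides_r2_ofEdge, card_sameEdge_ofEdge]
  simp

theorem isDisk_spoke : spoke.IsDisk := by
  refine ⟨connected_ofEdge, ⟨fun p => xor p.1 p.2, by decide⟩, ?_⟩
  have h1 : Nat.card (Quot spoke.SameFace) = 1 := by
    rw [show spoke.SameFace = fun _ _ => True from ?_]
    · exact Nat.card_eq_one_iff_unique.2 ⟨⟨by rintro ⟨f⟩ ⟨g⟩; exact Quot.sound trivial⟩,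
        ⟨Quot.mk _ (true, true)⟩⟩
    · funext p q
      have h : ∀ p, spoke.SameFace (false, false) p := by
        have h0 : ∀ p, spoke.SameFace p (!p.1, p.2) := fun p => Orb.left p
        have h1 : ∀ p, spoke.SameFace p (p.1, xor (!p.1) p.2) := fun p => Orb.right p
        rintro ⟨_ | _, _ | _⟩
        exacts [Orb.refl _, h1 (false, false), h0 (false, false),
          (h1 (false, false)).trans (h0 (false, true))]
      exact propext ⟨fun _ => trivial, fun _ => (h p).symm.trans (h q)⟩
  have h2 : Nat.card (Quot spoke.SameVertex) = 2 :=
    (card_quot_orb_eq (G := Bool) Prod.fst (by decide) (by decide) (by decide)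
      (by decide)).trans (by simp)
  have h3 : numSides spoke.r1 = 3 :=
    (card_quot_side_eq (G := Option Bool) (fun p => if p.1 then some p.2 else none) (by decide)
      (by decide) (by decide)).trans (by simp)
  rw [eulerChar, h1, h2, h3]
  unfold spoke
  rw [numSides_r0_ofEdge, numSides_r2_ofEdge, card_sameEdge_ofEdge]
  simp

theorem isDisk_halfedge : halfedge.IsDisk := by
  have h : ∀ {a b : Bool → Bool}, (a = not ∨ b = not) → Nat.card (Quot (Orb a b)) = 1 := by
    intro a b hab
    have : ∀ p q, Orb a b p q := by
      have key : Orb a b false true := by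
        rcases hab with rfl | rfl
        exacts [Orb.left false, Orb.right false]
      rintro (_ | _) (_ | _)
      exacts [Orb.refl _, key, key.symm, Orb.refl _]
    exact Nat.card_eq_one_iff_unique.2 ⟨⟨by rintro ⟨f⟩ ⟨g⟩; exact Quot.sound (this f g)⟩,
        ⟨Quot.mk _ true⟩⟩
  refine ⟨?_, ⟨id, by decide⟩, ?_⟩
  · have h := Linked.r1 halfedge
    rintro (_ | _) (_ | _)
    exacts [.refl _, h false, h true, .refl _]
  · have h1 : Nat.card (Quot halfedge.SameVertex) = 1 := h (Or.inl rfl)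
    have h2 : Nat.card (Quot halfedge.SameEdge) = 1 := h (Or.inr rfl)
    have h3 : Nat.card (Quot halfedge.SameFace) = 1 := h (Or.inr rfl)
    have h4 : numSides halfedge.r0 = 2 :=
      (card_quot_side_eq (G := Bool) id (by decide) (by decide) (by decide)).trans (by simp)
    have h5 : numSides halfedge.r1 = 1 :=
      (card_quot_side_eq (G := Unit) (fun _ => ()) (by decide) (by decide) (by decide)).trans
        (by simp)
    have h6 : numSides halfedge.r2 = 1 := h5
    rw [eulerChar, h1, h2, h3, h4, h5, h6]
    simp

/-- A copy of a map inside a connected map is the whole of it. -/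
theorem exists_iso_of_equivariant {F G : Type*} [Nonempty G] {N : FlagMap G} {M : FlagMap F}
    (hM : M.Connected) (φ : G → F) (hφ : Function.Injective φ) (h0 : ∀ g, φ (N.r0 g) = M.r0 (φ g))
    (h1 : ∀ g, φ (N.r1 g) = M.r1 (φ g)) (h2 : ∀ g, φ (N.r2 g) = M.r2 (φ g)) :
    ∃ e : Iso N M, ∀ g, e.toEquiv g = φ g := by
  have hs : Function.Surjective φ := by
    intro f
    obtain ⟨g₀⟩ := ‹Nonempty G›
    have := (Linked.mem_iff (M := M) (S := Set.range φ) ?_ ?_ ?_ (hM (φ g₀) f)).1 ⟨g₀, rfl⟩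
    · exact this
    all_goals rintro _ ⟨g, rfl⟩
    exacts [⟨_, h0 g⟩, ⟨_, h1 g⟩, ⟨_, h2 g⟩]
  exact ⟨⟨Equiv.ofBijective φ ⟨hφ, hs⟩, h0, h1, h2⟩, fun _ => rfl⟩

theorem exists_iso_ofEdge {F : Type*} {M : FlagMap F} (hM : M.Connected) {t : F}
    (h0 : M.r0 t ≠ t) (h2 : M.r2 t ≠ t) {r : Bool × Bool → Bool × Bool}
    {hr : Function.Involutive r} (φ : Bool × Bool → F)
    (hφ : φ = fun p => cond p.1 (M.r0 (cond p.2 (M.r2 t) t)) (cond p.2 (M.r2 t) t))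
    (h : ∀ p, φ (r p) = M.r1 (φ p)) : ∃ e : Iso (ofEdge r hr) M, e.toEquiv (false, false) = t := by
  have h0' : M.r0 (M.r2 t) ≠ M.r2 t := by
    rw [M.r0_r2_comm]; exact fun h => h0 (M.r2_invol.injective h)
  have h3 : M.r0 (M.r2 t) ≠ t := fun h => M.r0_ne_r2 t (by
    rw [← M.r0_invol (M.r2 t), h])
  suffices ∃ e : Iso (ofEdge r hr) M, ∀ g, e.toEquiv g = φ g by
    obtain ⟨e, he⟩ := this
    exact ⟨e, by rw [he, hφ]; rfl⟩
  refine exists_iso_of_equivariant (N := ofEdge r hr) hM φ ?_ ?_ h ?_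
  · subst hφ
    rintro ⟨_ | _, _ | _⟩ ⟨_ | _, _ | _⟩ <;>
      simp [h0, h2, h0', h3, h0.symm, h2.symm, h0'.symm, h3.symm, M.r0_ne_r2 t,
        (M.r0_ne_r2 t).symm, M.r0_invol.injective.eq_iff]
  · subst hφ
    rintro ⟨_ | _, _ | _⟩ <;> simp [ofEdge, M.r0_invol t, M.r0_invol (M.r2 t)]
  · subst hφ
    rintro ⟨_ | _, _ | _⟩ <;> simp [ofEdge, M.r2_invol t, M.r0_r2_comm, M.r2_invol (M.r0 t)]

end FlagMap

namespace RootedMap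

open FlagMap

/-- The loop on the sphere. -/
def loop : RootedMap := ⟨Bool × Bool, inferInstance, loopEdge, (false, false)⟩

/-- The segment on the sphere. -/
def seg : RootedMap := ⟨Bool × Bool, inferInstance, segment, (false, false)⟩

/-- The complete edge on the disk that joins the interior, where the root is, to the boundary. -/
def spoke : RootedMap := ⟨Bool × Bool, inferInstance, FlagMap.spoke, (false, false)⟩

/-- The halfedge on the disk. -/
def half : RootedMap := ⟨Bool, inferInstance, FlagMap.halfedge, false⟩

variable {X : RootedMap}

theorem cls_eq_loop (hX : X.M.Connected) (h0 : X.M.r0 X.root ≠ X.root)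
    (h2 : X.M.r2 X.root ≠ X.root) (h : X.M.r1 X.root = X.M.r0 X.root)
    (h' : X.M.r1 (X.M.r2 X.root) = X.M.r0 (X.M.r2 X.root)) : X.cls = loop.cls := by
  have h3 := X.M.r1_invol.eq_iff.1 h
  have h4 := X.M.r1_invol.eq_iff.1 h'
  refine (cls_eq_iff.2 (exists_iso_ofEdge hX h0 h2 _ rfl ?_)).symm
  rintro ⟨_ | _, _ | _⟩
  exacts [h.symm, h'.symm, h3, h4]

theorem cls_eq_seg (hX : X.M.Connected) (h0 : X.M.r0 X.root ≠ X.root)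
    (h2 : X.M.r2 X.root ≠ X.root) (h : X.M.r1 X.root = X.M.r2 X.root)
    (h' : X.M.r1 (X.M.r0 X.root) = X.M.r2 (X.M.r0 X.root)) : X.cls = seg.cls := by
  have h3 := X.M.r1_invol.eq_iff.1 h
  have h4 := X.M.r1_invol.eq_iff.1 h'
  rw [← X.M.r0_r2_comm] at h' h4
  refine (cls_eq_iff.2 (exists_iso_ofEdge hX h0 h2 _ rfl ?_)).symm
  rintro ⟨_ | _, _ | _⟩
  exacts [h.symm, h3, h'.symm, h4]

theorem cls_eq_spoke (hX : X.M.Connected) (h0 : X.M.r0 X.root ≠ X.root)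
    (h2 : X.M.r2 X.root ≠ X.root) (h : X.M.r1 X.root = X.M.r2 X.root)
    (h' : X.M.r1 (X.M.r0 X.root) = X.M.r0 X.root)
    (h'' : X.M.r1 (X.M.r0 (X.M.r2 X.root)) = X.M.r0 (X.M.r2 X.root)) : X.cls = spoke.cls := by
  have h3 := X.M.r1_invol.eq_iff.1 h
  refine (cls_eq_iff.2 (exists_iso_ofEdge hX h0 h2 _ rfl ?_)).symm
  rintro ⟨_ | _, _ | _⟩
  exacts [h.symm, h3, h'.symm, h''.symm]

theorem cls_eq_half (hX : X.M.Connected) (h0 : X.M.r0 X.root = X.root)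
    (h2 : X.M.r2 X.root ≠ X.root) (h : X.M.r1 X.root = X.M.r2 X.root) : X.cls = half.cls := by
  suffices ∃ e : Iso FlagMap.halfedge X.M, ∀ g, e.toEquiv g = cond g (X.M.r2 X.root) X.root by
    obtain ⟨e, he⟩ := this
    exact (cls_eq_iff.2 ⟨e, he _⟩).symm
  refine exists_iso_of_equivariant (N := FlagMap.halfedge) hX
    (fun p => cond p (X.M.r2 X.root) X.root) ?_ ?_ ?_ ?_
  · rintro (_ | _) (_ | _) <;> simp [h2, h2.symm]
  · rintro (_ | _)
    exacts [h0.symm, ((X.M.r0_r2_comm _).trans (congrArg _ h0)).symm]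
  · rintro (_ | _)
    exacts [h.symm, X.M.r1_invol.eq_iff.1 h]
  · rintro (_ | _)
    exacts [rfl, (X.M.r2_invol _).symm]

theorem innerFlags_eq_of_iff {F : Type*} {M : FlagMap F} {f : F} (S : Finset F)
    (h : ∀ g, (M.SameVertex f g ∧ M.r2 g ≠ g) ↔ g ∈ S) : M.innerFlags f = S.card := by
  rw [innerFlags, Nat.card_congr (Equiv.subtypeEquivRight h), Nat.card_eq_fintype_card,
    Fintype.card_coe]

theorem loop_interior : loop.M.InteriorVertex loop.root :=
  fun g _ => (show ∀ g, loopEdge.r1 g ≠ g ∧ loopEdge.r2 g ≠ g by decide) g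

theorem seg_interior : seg.M.InteriorVertex seg.root :=
  fun g _ => (show ∀ g, segment.r1 g ≠ g ∧ segment.r2 g ≠ g by decide) g

theorem loop_darts : loop.darts = 2 := by
  have := loop.two_mul_darts
  have h : Nat.card loop.F = 4 := by
    change Nat.card (Bool × Bool) = 4
    simp
  omega

theorem seg_darts : seg.darts = 2 := loop_darts

theorem spoke_darts : spoke.darts = 2 := loop_darts

theorem half_darts : half.darts = 1 := by
  have := half.two_mul_darts
  have h : Nat.card half.F = 2 := by
    change Nat.card Bool = 2
    simp
  omega

theorem loop_degree : loop.degree = 2 := by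
  have := loop.two_mul_degree
  have h : loop.M.innerFlags loop.root = 4 := by
    refine innerFlags_eq_of_iff (M := loopEdge) Finset.univ fun g =>
      ⟨fun _ => Finset.mem_univ _, fun _ => ⟨?_, ?_⟩⟩
    · have h1 : ∀ p, loopEdge.SameVertex p (!p.1, p.2) := fun p => Orb.left p
      have h2 : ∀ p, loopEdge.SameVertex p (p.1, !p.2) := fun p => Orb.right p
      rcases g with ⟨_ | _, _ | _⟩
      exacts [Orb.refl _, h2 (false, false), h1 (false, false),
        (h1 (false, false)).trans (h2 (true, false))]
    · exact (show ∀ g, loopEdge.r2 g ≠ g by decide) g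
  omega

theorem innerFlags_eq_two {F : Type*} {M : FlagMap F} {t : F} (h2 : M.r2 t ≠ t)
    (h : M.r1 t = M.r2 t) : M.innerFlags t = 2 := by
  classical
  refine (innerFlags_eq_of_iff {t, M.r2 t} fun g => ?_).trans (Finset.card_pair h2.symm)
  simp only [Finset.mem_insert, Finset.mem_singleton]
  have h3 := M.r1_invol.eq_iff.1 h
  constructor
  · rintro ⟨hg, -⟩
    refine (Orb.mem_iff M.r1_invol M.r2_invol (S := {t, M.r2 t}) ?_ ?_ hg).1 (Or.inl rfl)
    · rintro _ (rfl | rfl)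
      exacts [Or.inr h, Or.inl h3.symm]
    · rintro _ (rfl | rfl)
      exacts [Or.inr rfl, Or.inl (M.r2_invol _)]
  · rintro (rfl | rfl)
    exacts [⟨Orb.refl _, h2⟩, ⟨Orb.right _, by rw [M.r2_invol]; exact h2.symm⟩]

theorem degree_eq_one {X : RootedMap} (h2 : X.M.r2 X.root ≠ X.root)
    (h : X.M.r1 X.root = X.M.r2 X.root) : X.degree = 1 := by
  have := X.two_mul_degree
  have := innerFlags_eq_two h2 h
  omega

theorem seg_degree : seg.degree = 1 :=
  degree_eq_one (X := seg) (show segment.r2 (false, false) ≠ (false, false) by decide) rfl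

/-- At the vertex of a leaf, the corner can be cut open. -/
theorem loose_seg : seg.M.Loose seg.root where
  corner := (show segment.r1 (false, false) ≠ (false, false) by decide)
  vertex := Orb.right (b := segment.r2) (false, false)
  face := by
    have h1 : segment.cut (false, false) (true, false) = (true, true) :=
      cut_of_not_mem (M := segment) (by decide)
    have h := Orb.right (a := segment.r0) (b := segment.cut (false, false)) (true, false)
    rw [h1] at h
    exact (Orb.left (false, false)).trans (h.trans (Orb.left _))

theorem loose_of_loop {Z : RootedMap} (hc : Z.M.r1 Z.root ≠ Z.root)
    (h : Z.M.r1 Z.root = Z.M.r0 Z.root) (hi : Z.M.InteriorVertex Z.root) :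
    Z.M.Loose Z.root where
  corner := hc
  vertex := orb_cut_of_interior hi
  face := by rw [h]; exact Orb.left _

theorem loose_loop : loop.M.Loose loop.root := loose_of_loop
  (show loopEdge.r1 (false, false) ≠ (false, false) by decide) rfl loop_interior

end RootedMap

/-! ### Inserting a loop or a pendant edge -/

namespace RootedMap

open FlagMap

/-- A property of rooted maps that depends only on the isomorphism class. -/
def Invariant (P : RootedMap → Prop) : Prop := ∀ X Y : RootedMap, X.cls = Y.cls → P X → P Y

theorem invariant_of_iso {P : RootedMap → Prop}
    (h : ∀ X Y : RootedMap, ∀ e : X.M.Iso Y.M, e.toEquiv X.root = Y.root → (P X → P Y)) :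
    Invariant P := fun X Y hXY => by
  obtain ⟨e, he⟩ := cls_eq_iff.1 hXY
  exact h X Y e he

theorem Invariant.and {P Q : RootedMap → Prop} (hP : Invariant P) (hQ : Invariant Q) :
    Invariant fun X => P X ∧ Q X :=
  fun X Y h hX => ⟨hP X Y h hX.1, hQ X Y h hX.2⟩

theorem Invariant.not {P : RootedMap → Prop} (hP : Invariant P) : Invariant fun X => ¬ P X :=
  fun X Y h hX hY => hX (hP Y X h.symm hY)

theorem Invariant.or {P Q : RootedMap → Prop} (hP : Invariant P) (hQ : Invariant Q) :
    Invariant fun X => P X ∨ Q X :=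
  fun X Y h => Or.imp (hP X Y h) (hQ X Y h)

theorem invariant_darts (n : ℕ) : Invariant fun X => X.darts = n :=
  fun _ _ h hX => (darts_congr h).symm.trans hX

theorem invariant_isDisk : Invariant fun X => X.M.IsDisk :=
  invariant_of_iso fun _ _ e _ => e.isDisk

theorem invariant_isSphere : Invariant fun X => X.M.IsSphere :=
  invariant_of_iso fun _ _ e _ => e.isSphere

/-- A flag of each rooted map that isomorphisms respect. -/
def Natural (p : ∀ X : RootedMap, X.F) : Prop :=
  ∀ X Y : RootedMap, ∀ e : X.M.Iso Y.M, e.toEquiv X.root = Y.root → e.toEquiv (p X) = p Y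

theorem natural_root : Natural fun X => X.root := fun _ _ _ he => he

variable {p q : ∀ X : RootedMap, X.F}

theorem Natural.r0 (hp : Natural p) : Natural fun X => X.M.r0 (p X) :=
  fun X Y e he => by rw [e.map_r0, hp X Y e he]

theorem Natural.r1 (hp : Natural p) : Natural fun X => X.M.r1 (p X) :=
  fun X Y e he => by rw [e.map_r1, hp X Y e he]

theorem Natural.r2 (hp : Natural p) : Natural fun X => X.M.r2 (p X) :=
  fun X Y e he => by rw [e.map_r2, hp X Y e he]

theorem Natural.eq (hp : Natural p) (hq : Natural q) : Invariant fun X => p X = q X :=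
  invariant_of_iso fun X Y e he h => by rw [← hp X Y e he, ← hq X Y e he, h]

theorem Natural.sameVertex (hp : Natural p) (hq : Natural q) :
    Invariant fun X => X.M.SameVertex (p X) (q X) :=
  invariant_of_iso fun X Y e he h => by
    rw [← hp X Y e he, ← hq X Y e he]; exact e.sameVertex h

theorem Natural.interiorVertex (hp : Natural p) : Invariant fun X => X.M.InteriorVertex (p X) :=
  invariant_of_iso fun X Y e he h => by rw [← hp X Y e he]; exact e.interiorVertex h

theorem Natural.innerFlags (hp : Natural p) (n : ℕ) :
    Invariant fun X => X.M.innerFlags (p X) = n :=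
  invariant_of_iso fun X Y e he h => by rw [← hp X Y e he, e.innerFlags_eq, h]

theorem Natural.boundaryDarts (hp : Natural p) (n : ℕ) :
    Invariant fun X => X.M.boundaryDarts (p X) = n :=
  invariant_of_iso fun X Y e he h => by rw [← hp X Y e he, e.boundaryDarts_eq, h]

/-- The same map with the root at the other end of its edge. -/
def reroot0 (X : RootedMap) : RootedMap := ⟨X.F, X.fin, X.M, X.M.r0 X.root⟩

/-- The same map with the root on the other side of its edge. -/
def reroot2 (X : RootedMap) : RootedMap := ⟨X.F, X.fin, X.M, X.M.r2 X.root⟩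

theorem reroot0_reroot0 (X : RootedMap) : X.reroot0.reroot0 = X := by
  obtain ⟨F, _, M, f⟩ := X
  simp only [reroot0, M.r0_invol f]

theorem reroot2_reroot2 (X : RootedMap) : X.reroot2.reroot2 = X := by
  obtain ⟨F, _, M, f⟩ := X
  simp only [reroot2, M.r2_invol f]

theorem count_reroot0 (P : RootedMap → Prop) : count (fun X => P X.reroot0) = count P := by
  refine count_eq_of_maps reroot0 reroot0 (fun _ h => h)
    (fun X h => by rwa [reroot0_reroot0]) ?_ ?_ (fun X _ => reroot0_reroot0 X)
    fun X _ => reroot0_reroot0 X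
  all_goals
    intro X Y h
    obtain ⟨e, he⟩ := cls_eq_iff.1 h
    exact cls_eq_iff.2 ⟨e, natural_root.r0 X Y e he⟩

theorem count_reroot2 (P : RootedMap → Prop) : count (fun X => P X.reroot2) = count P := by
  refine count_eq_of_maps reroot2 reroot2 (fun _ h => h)
    (fun X h => by rwa [reroot2_reroot2]) ?_ ?_ (fun X _ => reroot2_reroot2 X)
    fun X _ => reroot2_reroot2 X
  all_goals
    intro X Y h
    obtain ⟨e, he⟩ := cls_eq_iff.1 h
    exact cls_eq_iff.2 ⟨e, natural_root.r2 X Y e he⟩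

/-- Cutting off an edge all of whose corners but one are inside the edge. -/
theorem exists_glue_edge (X : RootedMap) {t' u u' : X.F} (hX : X.M.Connected) (ht' : t' ≠ X.root)
    (hx : X.M.r1 X.root ≠ X.root) (hx' : X.M.r1 X.root ≠ t') (hu : X.M.r1 u = u')
    (hut : u ≠ X.root) (hut' : u ≠ t') (hut1 : u' ≠ X.root) (hut1' : u' ≠ t')
    (h0 : ∀ f ∈ ({X.root, t', u, u'} : Set X.F), X.M.r0 f ∈ ({X.root, t', u, u'} : Set X.F))
    (h2 : ∀ f ∈ ({X.root, t', u, u'} : Set X.F), X.M.r2 f ∈ ({X.root, t', u, u'} : Set X.F)) :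
    ∃ Y Z : RootedMap, Y.M.Connected ∧ Z.M.Connected ∧ Z.M.r1 Z.root ≠ Z.root ∧
      (t' = X.M.r0 X.root → Z.M.r1 Z.root = Z.M.r0 Z.root) ∧
      (t' = X.M.r2 X.root → Z.M.r1 Z.root = Z.M.r2 Z.root) ∧ X.cls = (glue Y Z).cls := by
  have hu' := X.M.r1_invol.eq_iff.1 hu
  have hxu : u ≠ X.M.r1 X.root := fun h => hut1 (by rw [← hu, h, X.M.r1_invol])
  have hxu' : u' ≠ X.M.r1 X.root := fun h => hut (by rw [hu', h, X.M.r1_invol])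
  set N := X.M.conj (flagSwap (X.M.r1 X.root) t') with hN
  have h1 : N.r1 X.root = t' := by
    rw [conj_r1, flagSwap_symm, flagSwap_of_ne hx.symm ht'.symm, flagSwap_left]
  have h1' : N.r1 t' = X.root := (N.r1_invol.eq_iff.1 h1).symm
  have h3 : N.r1 u = u' := by
    rw [conj_r1, flagSwap_symm, flagSwap_of_ne hxu hut', hu, flagSwap_of_ne hxu' hut1']
  have h3' : N.r1 u' = u := (N.r1_invol.eq_iff.1 h3).symm
  refine X.exists_glue hX ht' hx hx' (S := {X.root, t', u, u'}ᶜ)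
    (mem_compl_of_closed X.M.r0_invol h0) (mem_compl_of_closed N.r1_invol ?_)
    (mem_compl_of_closed X.M.r2_invol h2) ?_ ?_
  · rintro _ (rfl | rfl | rfl | rfl)
    · rw [h1]; exact Or.inr (Or.inl rfl)
    · rw [h1']; exact Or.inl rfl
    · rw [h3]; exact Or.inr (Or.inr (Or.inr rfl))
    · rw [h3']; exact Or.inr (Or.inr (Or.inl rfl))
  · rintro (h | h | h | h)
    exacts [hx h, hx' h, hxu h.symm, hxu' h.symm]
  · exact fun h => h (Or.inl rfl)

variable {X : RootedMap}

theorem exists_glue_loop (hX : X.M.Connected) (h0 : X.M.r0 X.root ≠ X.root)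
    (h2 : X.M.r2 X.root ≠ X.root) (hx : X.M.r1 X.root ≠ X.root)
    (hx' : X.M.r1 X.root ≠ X.M.r0 X.root)
    (hu : X.M.r1 (X.M.r2 X.root) = X.M.r0 (X.M.r2 X.root)) :
    ∃ Y : RootedMap, Y.M.Connected ∧ X.cls = (glue Y loop).cls := by
  obtain ⟨Y, Z, hY, hZ, hc, hr, -, h⟩ := X.exists_glue_edge hX h0 hx hx' hu h2
    (X.M.r0_ne_r2 _).symm (fun h => X.M.r0_ne_r2 X.root (by
      rw [← X.M.r0_invol (X.M.r2 X.root), h]))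
    (fun h => h2 (X.M.r0_invol.injective h)) (by
      rintro _ (rfl | rfl | rfl | rfl)
      exacts [Or.inr (Or.inl rfl), Or.inl (X.M.r0_invol _), Or.inr (Or.inr (Or.inr rfl)),
        Or.inr (Or.inr (Or.inl (X.M.r0_invol _)))]) (by
      rintro _ (rfl | rfl | rfl | rfl)
      exacts [Or.inr (Or.inr (Or.inl rfl)), Or.inr (Or.inr (Or.inr (X.M.r0_r2_comm _).symm)),
        Or.inl (X.M.r2_invol _), Or.inr (Or.inl (by
          rw [← X.M.r0_r2_comm, X.M.r2_invol]))])
  refine ⟨Y, hY, h.trans (glue_congr rfl ?_)⟩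
  obtain ⟨e, he⟩ := cls_eq_iff.1 h
  have hr := hr rfl
  have h2' : Z.M.r2 Z.root ≠ Z.root := fun h' => h2 (e.toEquiv.injective (by
    rw [e.map_r2, he]; exact congrArg Sum.inr h'))
  refine cls_eq_loop hZ (hr ▸ hc) h2' hr (Sum.inr_injective (α := Y.F) ?_)
  rw [← glue_r1_inr h2' (hr ▸ (Z.M.r0_ne_r2 _).symm)]
  have := congrArg e.toEquiv hu
  rw [e.map_r1, e.map_r2, e.map_r0, e.map_r2, he] at this
  exact this

theorem exists_glue_seg (hX : X.M.Connected) (h0 : X.M.r0 X.root ≠ X.root)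
    (h2 : X.M.r2 X.root ≠ X.root) (hx : X.M.r1 X.root ≠ X.root)
    (hx' : X.M.r1 X.root ≠ X.M.r2 X.root)
    (hu : X.M.r1 (X.M.r0 X.root) = X.M.r2 (X.M.r0 X.root)) :
    ∃ Y : RootedMap, Y.M.Connected ∧ X.cls = (glue Y seg).cls := by
  obtain ⟨Y, Z, hY, hZ, hc, -, hr, h⟩ := X.exists_glue_edge hX h2 hx hx' hu h0
    (X.M.r0_ne_r2 _) (fun h => X.M.r0_ne_r2 X.root (by
      rw [← X.M.r2_invol (X.M.r0 X.root), h]))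
    (fun h => h0 (X.M.r2_invol.injective h)) (by
      rintro _ (rfl | rfl | rfl | rfl)
      exacts [Or.inr (Or.inr (Or.inl rfl)), Or.inr (Or.inr (Or.inr (X.M.r0_r2_comm _))),
        Or.inl (X.M.r0_invol _), Or.inr (Or.inl (by
          rw [X.M.r0_r2_comm, X.M.r0_invol]))]) (by
      rintro _ (rfl | rfl | rfl | rfl)
      exacts [Or.inr (Or.inl rfl), Or.inl (X.M.r2_invol _), Or.inr (Or.inr (Or.inr rfl)),
        Or.inr (Or.inr (Or.inl (X.M.r2_invol _)))])
  refine ⟨Y, hY, h.trans (glue_congr rfl ?_)⟩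
  obtain ⟨e, he⟩ := cls_eq_iff.1 h
  have hr := hr rfl
  have h0' : Z.M.r0 Z.root ≠ Z.root := fun h' => h0 (e.toEquiv.injective (by
    rw [e.map_r0, he]; exact congrArg Sum.inr h'))
  refine cls_eq_seg hZ h0' (hr ▸ hc) hr (Sum.inr_injective (α := Y.F) ?_)
  rw [← glue_r1_inr h0' (hr ▸ Z.M.r0_ne_r2 _)]
  have := congrArg e.toEquiv hu
  rw [e.map_r1, e.map_r0, e.map_r2, e.map_r0, he] at this
  exact this

/-- Gluing on a fixed sphere does not change the numbers. -/
theorem count_glue_const {P Q : RootedMap → Prop} (Z : RootedMap) (hZ : Z.M.Loose Z.root)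
    (hZc : Z.M.Connected)
    (hr : Z.M.r1 Z.root = Z.M.r0 Z.root ∨ Z.M.r1 Z.root = Z.M.r2 Z.root) (hP : Invariant P)
    (h₁ : ∀ X, P X → ∃ Y : RootedMap, Y.M.Connected ∧ X.cls = (glue Y Z).cls)
    (h₂ : ∀ Y : RootedMap, Y.M.Connected → (P (glue Y Z) ↔ Q Y))
    (hQ : ∀ Y, Q Y → Y.M.Connected) : count P = count Q := by
  refine ncard_image_eq_of_rel cls cls (fun X Y => X.cls = (glue Y Z).cls) ?_ ?_ ?_
  · intro X hX
    obtain ⟨Y, hY, h⟩ := h₁ X hX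
    exact ⟨Y, (h₂ Y hY).1 (hP _ _ h hX), h⟩
  · intro Y hY
    exact ⟨_, (h₂ Y (hQ Y hY)).2 hY, rfl⟩
  · intro X X' Y Y' _ _ hY hY' h h'
    rw [h, h', glue_cls_iff hZ hZ (hr.imp (fun h => ⟨h, h⟩) fun h => ⟨h, h⟩) (hQ Y hY) hZc]
    exact and_iff_left rfl

variable {Y Z : RootedMap}

theorem glue_eulerChar_of_sphere (hZ : Z.M.Loose Z.root) (hs : Z.M.IsSphere) :
    (glue Y Z).M.eulerChar = Y.M.eulerChar := by
  have := glue_eulerChar (Y := Y) hZ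
  have := hs.2.2
  omega

theorem glue_isDisk_iff (hZ : Z.M.Loose Z.root) (hs : Z.M.IsSphere)
    (hr : Z.M.r1 Z.root = Z.M.r0 Z.root ∨ Z.M.r1 Z.root = Z.M.r2 Z.root) (hY : Y.M.Connected) :
    (glue Y Z).M.IsDisk ↔ Y.M.IsDisk := by
  rw [IsDisk, IsDisk, glue_eulerChar_of_sphere hZ hs, glue_orientable hZ hr]
  exact ⟨fun h => ⟨hY, h.2.1.1, h.2.2⟩,
    fun h => ⟨glue_connected hZ hY hs.1, ⟨h.2.1, hs.2.1⟩, h.2.2⟩⟩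

theorem glue_isSphere_iff (hZ : Z.M.Loose Z.root) (hs : Z.M.IsSphere)
    (hr : Z.M.r1 Z.root = Z.M.r0 Z.root ∨ Z.M.r1 Z.root = Z.M.r2 Z.root) (hY : Y.M.Connected) :
    (glue Y Z).M.IsSphere ↔ Y.M.IsSphere := by
  rw [IsSphere, IsSphere, glue_eulerChar_of_sphere hZ hs, glue_orientable hZ hr]
  exact ⟨fun h => ⟨hY, h.2.1.1, h.2.2⟩,
    fun h => ⟨glue_connected hZ hY hs.1, ⟨h.2.1, hs.2.1⟩, h.2.2⟩⟩

theorem glue_loop_darts : (glue Y loop).darts = Y.darts + 2 := by rw [glue_darts, loop_darts]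

theorem glue_loop_degree : (glue Y loop).degree = Y.degree + 2 := by
  rw [glue_degree loose_loop, loop_degree]

theorem glue_seg_darts : (glue Y seg).darts = Y.darts + 2 := by rw [glue_darts, seg_darts]

theorem glue_seg_degree : (glue Y seg).degree = Y.degree + 1 := by
  rw [glue_degree loose_seg, seg_degree]

theorem glue_loop_isDisk (hY : Y.M.Connected) : (glue Y loop).M.IsDisk ↔ Y.M.IsDisk :=
  glue_isDisk_iff loose_loop isSphere_loopEdge (Or.inl rfl) hY

theorem glue_loop_isSphere (hY : Y.M.Connected) : (glue Y loop).M.IsSphere ↔ Y.M.IsSphere :=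
  glue_isSphere_iff loose_loop isSphere_loopEdge (Or.inl rfl) hY

theorem glue_seg_isDisk (hY : Y.M.Connected) : (glue Y seg).M.IsDisk ↔ Y.M.IsDisk :=
  glue_isDisk_iff loose_seg isSphere_segment (Or.inr rfl) hY

theorem glue_loop_interior :
    (glue Y loop).M.InteriorVertex (glue Y loop).root ↔ Y.M.InteriorVertex Y.root :=
  glue_interiorVertex loose_loop loop_interior

theorem glue_seg_interior :
    (glue Y seg).M.InteriorVertex (glue Y seg).root ↔ Y.M.InteriorVertex Y.root :=
  glue_interiorVertex loose_seg seg_interior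

/-- The loop that has been glued on. -/
theorem glue_loop_spec : (glue Y loop).M.r1 ((glue Y loop).M.r2 (glue Y loop).root) =
    (glue Y loop).M.r0 ((glue Y loop).M.r2 (glue Y loop).root) :=
  glue_r1_inr (Z := loop) (h := (false, true)) (show (false, true) ≠ (false, false) by decide)
    (show (false, true) ≠ (true, false) by decide)

/-- The pendant edge that has been glued on. -/
theorem glue_seg_spec : (glue Y seg).M.r1 ((glue Y seg).M.r0 (glue Y seg).root) =
    (glue Y seg).M.r2 ((glue Y seg).M.r0 (glue Y seg).root) :=
  glue_r1_inr (Z := seg) (h := (true, false)) (show (true, false) ≠ (false, false) by decide)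
    (show (true, false) ≠ (false, true) by decide)

theorem glue_seg_r0_ne : (glue Y seg).M.r0 (glue Y seg).root ≠ (glue Y seg).root :=
  fun h => (show (true, false) ≠ (false, false) by decide) (Sum.inr_injective h)

theorem glue_seg_r2_ne : (glue Y seg).M.r2 (glue Y seg).root ≠ (glue Y seg).root :=
  fun h => (show (false, true) ≠ (false, false) by decide) (Sum.inr_injective h)

theorem glue_seg_r1 : (glue Y seg).M.r1 (glue Y seg).root = Sum.inl Y.root :=
  glue_r1_root loose_seg

theorem glue_loop_r1 : (glue Y loop).M.r1 (glue Y loop).root = Sum.inl Y.root :=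
  glue_r1_root loose_loop

end RootedMap

/-! ### Cutting a vertex in two along a loop -/

namespace FlagMap

variable {F : Type*} {M : FlagMap F} {f g t : F}

theorem SameVertex.innerFlags_eq (h : M.SameVertex f g) : M.innerFlags f = M.innerFlags g :=
  Nat.card_congr (Equiv.subtypeEquivRight fun _ =>
    and_congr_left fun _ => ⟨fun h' => h.symm.trans h', fun h' => h.trans h'⟩)

theorem SameVertex.boundaryDarts_eq (h : M.SameVertex f g) :
    M.boundaryDarts f = M.boundaryDarts g :=
  Nat.card_congr (Equiv.subtypeEquivRight fun _ =>
    and_congr_left fun _ => ⟨fun h' => h.symm.trans h', fun h' => h.trans h'⟩)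

theorem InteriorVertex.of_sameVertex (hf : M.InteriorVertex f) (h : M.SameVertex f g) :
    M.InteriorVertex g := fun k hk => hf k (h.trans hk)

theorem sameVertex_r1 (f : F) : M.SameVertex f (M.r1 f) := Orb.left f

theorem sameVertex_r2 (f : F) : M.SameVertex f (M.r2 f) := Orb.right f

theorem InteriorVertex.r1_ne (h : M.InteriorVertex f) : M.r1 f ≠ f := (h f (Orb.refl f)).1

theorem InteriorVertex.r2_ne (h : M.InteriorVertex f) : M.r2 f ≠ f := (h f (Orb.refl f)).2

/-- A sphere has no boundary. -/
theorem IsSphere.interiorVertex [Finite F] (h : M.IsSphere) (f : F) : M.InteriorVertex f := by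
  intro g _
  have h1 := (M.eulerChar_le h.1 g).2
  have h2 := h.2.2
  exact ⟨fun h' => by have := h1 (Or.inr (Or.inl h')); omega,
    fun h' => by have := h1 (Or.inr (Or.inr h')); omega⟩

theorem IsDisk.not_isSphere (h : M.IsDisk) : ¬ M.IsSphere := fun h' => by
  have := h.2.2
  have := h'.2.2
  omega

/-- If both ends of the edge of `t` are at the same vertex in the interior, then joining the corners
`{t, r1 t}` and `{r0 t, r1 (r0 t)}` differently cuts this vertex in two: on a path around
the vertex, the colours of the flags alternate. -/
theorem not_sameVertex_of_loop [Finite F] (hor : M.Orientable) (hi : M.InteriorVertex t)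
    (h0 : M.r0 t ≠ t) (hl : M.SameVertex t (M.r0 t)) (hx : M.r1 t ≠ M.r0 t) :
    ¬ (M.conj (flagSwap (M.r1 t) (M.r0 t))).SameVertex (M.r1 t) t := by
  classical
  obtain ⟨c, hc⟩ := hor
  set x := M.r1 t with hxdef
  set t' := M.r0 t with htdef
  set y := M.r1 t' with hydef
  have hxt : x ≠ t := hi.r1_ne
  have hyt' : y ≠ t' := (hi.of_sameVertex hl).r1_ne
  have hyx : y ≠ x := fun h => h0 (M.r1_invol.injective h)
  have hyt : y ≠ t := fun h => hx (by rw [hxdef, ← h, M.r1_invol])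
  have hrx : M.r1 x = t := M.r1_invol t
  have hry : M.r1 y = t' := M.r1_invol t'
  let C : Finset F := {t, x, t', y}
  have hC : ∀ g, g ∈ C ↔ g = t ∨ g = x ∨ g = t' ∨ g = y := by intro g; simp [C]
  have hC1 : ∀ g, M.r1 g ∈ C ↔ g ∈ C := by
    have key : ∀ g, g ∈ C → M.r1 g ∈ C := by
      intro g hg
      rw [hC] at hg ⊢
      rcases hg with rfl | rfl | rfl | rfl
      · exact Or.inr (Or.inl rfl)
      · exact Or.inl hrx
      · exact Or.inr (Or.inr (Or.inr rfl))
      · exact Or.inr (Or.inr (Or.inl hry))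
    exact fun g => ⟨fun h => by simpa [M.r1_invol g] using key _ h, key g⟩
  -- both corners are cut open: the vertex falls apart into paths whose ends are the flags in `C`
  let a : F → F := fun g => if g ∈ C then g else M.r1 g
  have ha1 : ∀ {g}, g ∈ C → a g = g := fun h => if_pos h
  have ha2 : ∀ {g}, g ∉ C → a g = M.r1 g := fun h => if_neg h
  have ha : Function.Involutive a := by
    intro g
    by_cases hg : g ∈ C
    · rw [ha1 hg, ha1 hg]
    · rw [ha2 hg, ha2 (fun h => hg ((hC1 g).1 h)), M.r1_invol]
  have hle : ∀ {g}, Orb a M.r2 t g → M.SameVertex t g := by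
    intro g hg
    refine hg.map id (fun f => ?_) fun f => Orb.right f
    by_cases hf : f ∈ C
    · rw [ha1 hf]
    · rw [ha2 hf]; exact Orb.left f
  have hfix : ∀ {g}, Orb a M.r2 t g → a g = g → g ∈ C := fun {g} hg hag => by
    by_contra h
    rw [ha2 h] at hag
    exact (hi g (hle hg)).1 hag
  have htC : t ∈ C := (hC t).2 (Or.inl rfl)
  rcases Orb.exists_other_end ha M.r2_invol (ha1 htC) with
    ⟨l, hl1, hlt, hal, -, hends⟩ | ⟨l, hl1, hbl, -⟩
  swap
  · exact absurd hbl (hi l (hle hl1)).2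
  have hcol := Orb.color_ne_of_ends ha M.r2_invol (c := c) hlt (ha1 htC) hal hl1
    (fun g _ hag => by
      by_cases hg : g ∈ C
      · exact absurd (ha1 hg) hag
      · rw [ha2 hg] at hag ⊢; exact (hc g).2.1 hag)
    (fun g hg => (hc g).2.2 (hi g (hle hg)).2) hends
  have hc2 : c t' ≠ c t := (hc t).1 h0
  have hc3 : c y ≠ c t' := (hc t').2.1 hyt'
  rcases (hC l).1 (hfix hl1 hal) with rfl | rfl | rfl | rfl
  · exact absurd rfl hlt
  · -- the path from `t` ends at `x`: it is the whole vertex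
    exfalso
    have hmem : ∀ g ∈ {g | Orb a M.r2 t g}, M.r1 g ∈ {g | Orb a M.r2 t g} := by
      intro g hg
      by_cases hgC : g ∈ C
      · rcases hends g hg (ha1 hgC) with rfl | rfl
        · exact hl1
        · change Orb a M.r2 t (M.r1 x); rw [hrx]
      · change Orb a M.r2 t (M.r1 g); rw [← ha2 hgC]; exact Orb.left_iff.2 hg
    have := (Orb.mem_iff M.r1_invol M.r2_invol hmem (fun g hg => Orb.right_iff.2 hg) hl).1
      (Orb.refl t)
    rcases hends t' this (ha1 ((hC _).2 (Or.inr (Or.inr (Or.inl rfl))))) with h | h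
    exacts [h0 h, hx h.symm]
  · -- the path from `t` ends at `t'`: it is a whole vertex after the two corners are exchanged
    have hmem : ∀ g ∈ {g | Orb a M.r2 t g},
        (M.conj (flagSwap x t')).r1 g ∈ {g | Orb a M.r2 t g} := by
      intro g hg
      change Orb a M.r2 t _
      rw [conj_r1, flagSwap_symm]
      by_cases hgC : g ∈ C
      · rcases hends g hg (ha1 hgC) with rfl | rfl
        · rw [flagSwap_of_ne hxt.symm h0.symm, ← hxdef, flagSwap_left]; exact hl1
        · rw [flagSwap_right, hrx, flagSwap_of_ne hxt.symm h0.symm]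
      · have hgC' := (hC1 g).not.2 hgC
        rw [hC, not_or, not_or, not_or] at hgC hgC'
        rw [flagSwap_of_ne hgC.2.1 hgC.2.2.1, flagSwap_of_ne hgC'.2.1 hgC'.2.2.1,
          ← ha2 (mt (hC g).1 (by tauto))]
        exact Orb.left_iff.2 hg
    intro hxt'
    have := (Orb.mem_iff (FlagMap.r1_invol _) M.r2_invol hmem
      (fun g hg => Orb.right_iff.2 hg) hxt').2 (Orb.refl t)
    rcases hends x this (ha1 ((hC _).2 (Or.inr (Or.inl rfl)))) with h | h
    exacts [hxt h, hx h]
  · -- the path from `t` does not end at `y`: these flags have the same colour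
    have tri : ∀ p q r : Bool, p ≠ q → r ≠ q → p ≠ r → False := by decide
    exact (tri _ _ _ hcol hc2 hc3).elim

end FlagMap

namespace RootedMap

open FlagMap

variable {X Y Z : RootedMap}

/-- The rooted maps on the disk with `n` darts whose root vertex is in the interior and has
degree `k`. -/
def IsInner (n k : ℕ) (X : RootedMap) : Prop :=
  X.darts = n ∧ X.M.IsDisk ∧ X.M.InteriorVertex X.root ∧ X.degree = k

/-- The rooted maps on the sphere with `n` darts, `n ≥ 1`, whose root vertex has degree `k`. -/
def IsBall (n k : ℕ) (X : RootedMap) : Prop := X.darts = n ∧ X.M.IsSphere ∧ X.degree = k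

theorem invariant_degree (k : ℕ) : Invariant fun X => X.degree = k :=
  fun _ _ h hX => (degree_congr h).symm.trans hX

theorem invariant_isInner (n k : ℕ) : Invariant (IsInner n k) :=
  (invariant_darts n).and (invariant_isDisk.and (natural_root.interiorVertex.and
    (invariant_degree k)))

theorem invariant_isBall (n k : ℕ) : Invariant (IsBall n k) :=
  (invariant_darts n).and (invariant_isSphere.and (invariant_degree k))

theorem degree_reroot2 (X : RootedMap) : X.reroot2.degree = X.degree :=
  congrArg (· / 2) (sameVertex_r2 (M := X.M) X.root).innerFlags_eq.symm

theorem darts_reroot2 (X : RootedMap) : X.reroot2.darts = X.darts := rfl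

theorem interior_reroot2 (X : RootedMap) :
    X.reroot2.M.InteriorVertex X.reroot2.root ↔ X.M.InteriorVertex X.root :=
  ⟨fun h => h.of_sameVertex (sameVertex_r2 (M := X.M) X.root).symm,
    fun h => h.of_sameVertex (sameVertex_r2 (M := X.M) X.root)⟩

theorem isInner_reroot2 {n k : ℕ} : IsInner n k X.reroot2 ↔ IsInner n k X := by
  rw [IsInner, IsInner, darts_reroot2, interior_reroot2, degree_reroot2]; rfl

theorem isBall_reroot2 {n k : ℕ} : IsBall n k X.reroot2 ↔ IsBall n k X := by
  rw [IsBall, IsBall, darts_reroot2, degree_reroot2]; rfl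

/-- A corner inside a loop at a vertex in the interior: the loop is the whole map, or it is inserted
in another one. -/
theorem eq_loop_or_exists_glue (hX : X.M.Connected) (hi : X.M.InteriorVertex X.root)
    (h : X.M.r1 (X.M.r2 X.root) = X.M.r0 (X.M.r2 X.root)) :
    X.cls = loop.cls ∨ X.M.r1 X.root ≠ X.M.r0 X.root ∧
      ∃ Y : RootedMap, Y.M.Connected ∧ X.cls = (glue Y loop).cls := by
  have h2 := hi.of_sameVertex (sameVertex_r2 (M := X.M) X.root)
  have h0 : X.M.r0 X.root ≠ X.root := fun h' => h2.r1_ne (by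
    rw [h, X.M.r0_r2_comm, h'])
  by_cases hr : X.M.r1 X.root = X.M.r0 X.root
  · exact Or.inl (cls_eq_loop hX h0 hi.r2_ne hr h)
  · exact Or.inr ⟨hr, exists_glue_loop hX h0 hi.r2_ne hi.r1_ne hr h⟩

theorem invariant_corner :
    Invariant fun X => X.M.r1 (X.M.r2 X.root) = X.M.r0 (X.M.r2 X.root) :=
  natural_root.r2.r1.eq natural_root.r2.r0

theorem loop_not_disk (h : X.cls = loop.cls) : ¬ X.M.IsDisk := fun hX =>
  (invariant_isDisk _ _ h hX).not_isSphere isSphere_loopEdge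

theorem count_eq_one {P : RootedMap → Prop} (L : RootedMap) (hL : P L)
    (h : ∀ X, P X → X.cls = L.cls) : count P = 1 := by
  rw [count, Set.ncard_eq_one]
  refine ⟨L.cls, Set.eq_singleton_iff_unique_mem.2 ⟨⟨L, hL, rfl⟩, ?_⟩⟩
  rintro _ ⟨X, hX, rfl⟩
  exact h X hX

theorem not_loop_glue (Y : RootedMap) :
    (glue Y loop).M.r1 (glue Y loop).root ≠ (glue Y loop).M.r0 (glue Y loop).root := by
  rw [glue_loop_r1]; exact Sum.inl_ne_inr

/-- Removing a loop around the root corner from a map on the disk. -/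
theorem count_isInner_loop (n k : ℕ) :
    count (fun X => IsInner (n + 2) (k + 2) X ∧ X.M.r1 X.root = X.M.r0 X.root) =
      count (IsInner n k) := by
  rw [← count_reroot2]
  refine Eq.trans (count_congr fun X => and_congr_left' isInner_reroot2)
    (count_glue_const loop loose_loop isSphere_loopEdge.1 (Or.inl rfl)
    ((invariant_isInner _ _).and invariant_corner) ?_ ?_ fun Y hY => hY.2.1.1)
  · rintro X ⟨⟨-, hd, hi, -⟩, h⟩
    rcases eq_loop_or_exists_glue hd.1 hi h with h' | ⟨-, h'⟩
    exacts [absurd hd (loop_not_disk h'), h']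
  · intro Y hY
    rw [IsInner, IsInner, glue_loop_darts, glue_loop_degree, glue_loop_interior,
      glue_loop_isDisk hY, Nat.add_right_cancel_iff, Nat.add_right_cancel_iff]
    exact and_iff_left glue_loop_spec

/-- Removing a loop around the root corner from a map on the sphere. If the map is this loop, then a
single vertex remains. -/
theorem count_isBall_loop (n k : ℕ) :
    count (fun X => IsBall (n + 2) (k + 2) X ∧ X.M.r1 X.root = X.M.r0 X.root) =
      count (IsBall n k) + if n = 0 ∧ k = 0 then 1 else 0 := by
  rw [← count_reroot2]
  refine Eq.trans (count_congr fun X => and_congr_left' isBall_reroot2) ?_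
  rw [count_add (n := n + 2) (fun X => X.M.r1 X.root = X.M.r0 X.root) (fun X hX => hX.1.1)
    (natural_root.r1.eq natural_root.r0), add_comm]
  congr 1
  · refine count_glue_const loop loose_loop isSphere_loopEdge.1 (Or.inl rfl)
      (((invariant_isBall _ _).and invariant_corner).and
        (natural_root.r1.eq natural_root.r0).not) ?_ ?_ fun Y hY => hY.2.1.1
    · rintro X ⟨⟨⟨-, hs, -⟩, h⟩, hr⟩
      rcases eq_loop_or_exists_glue hs.1 (hs.interiorVertex _) h with h' | ⟨-, h'⟩
      exacts [absurd (natural_root.r1.eq natural_root.r0 _ _ h'.symm rfl) hr, h']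
    · intro Y hY
      rw [IsBall, IsBall, glue_loop_darts, glue_loop_degree, glue_loop_isSphere hY,
        Nat.add_right_cancel_iff, Nat.add_right_cancel_iff]
      exact ⟨fun h => h.1.1, fun h => ⟨⟨h, glue_loop_spec⟩, not_loop_glue Y⟩⟩
  · have key : ∀ X : RootedMap, ((IsBall (n + 2) (k + 2) X ∧
        X.M.r1 (X.M.r2 X.root) = X.M.r0 (X.M.r2 X.root)) ∧ X.M.r1 X.root = X.M.r0 X.root) →
        X.cls = loop.cls := by
      rintro X ⟨⟨⟨-, hs, -⟩, h⟩, hr⟩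
      rcases eq_loop_or_exists_glue hs.1 (hs.interiorVertex _) h with h' | ⟨h', -⟩
      exacts [h', absurd hr h']
    split_ifs with h
    · refine count_eq_one loop ?_ key
      obtain ⟨rfl, rfl⟩ := h
      exact ⟨⟨⟨loop_darts, isSphere_loopEdge, loop_degree⟩, rfl⟩, rfl⟩
    · refine count_eq_zero fun X hX => h ?_
      have h1 := (darts_congr (key X hX)).symm.trans hX.1.1.1
      have h2 := (degree_congr (key X hX)).symm.trans hX.1.1.2.2
      rw [loop_darts] at h1
      rw [loop_degree] at h2
      omega

/-- A loop around a single corner has two darts at its vertex. -/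
theorem two_le_of_corner (hX : X.M.Connected) (hi : X.M.InteriorVertex X.root)
    (h : X.M.r1 X.root = X.M.r0 X.root) : 2 ≤ X.darts ∧ 2 ≤ X.degree := by
  rw [← degree_reroot2, ← darts_reroot2]
  have h' : X.reroot2.M.r1 (X.reroot2.M.r2 X.reroot2.root) =
      X.reroot2.M.r0 (X.reroot2.M.r2 X.reroot2.root) := by
    change X.M.r1 (X.M.r2 (X.M.r2 X.root)) = X.M.r0 (X.M.r2 (X.M.r2 X.root))
    rwa [X.M.r2_invol]
  rcases eq_loop_or_exists_glue (X := X.reroot2) hX ((interior_reroot2 X).2 hi) h' with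
    h' | ⟨-, Y, -, h'⟩
  · rw [darts_congr h', degree_congr h', loop_darts, loop_degree]; simp
  · rw [darts_congr h', degree_congr h', glue_loop_darts, glue_loop_degree]; simp

theorem interiorVertex_of_glue (hc : Z.M.r1 Z.root ≠ Z.root)
    (hi : (glue Y Z).M.InteriorVertex (glue Y Z).root)
    (hl : (glue Y Z).M.SameVertex (Sum.inr Z.root) (Sum.inr (Z.M.r1 Z.root))) :
    Z.M.InteriorVertex Z.root := by
  have hle : ∀ {g h}, Z.M.SameVertex g h →
      (glue Y Z).M.SameVertex (Sum.inr g) (Sum.inr h) := by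
    intro g h hgh
    refine Orb.map (a' := (glue Y Z).M.r1) (b' := (glue Y Z).M.r2) Sum.inr (fun f => ?_)
      (fun f => Orb.right _) hgh
    by_cases h1 : f = Z.root
    · rw [h1]; exact hl
    by_cases h2 : f = Z.M.r1 Z.root
    · rw [h2, Z.M.r1_invol]; exact hl.symm
    rw [← glue_r1_inr h1 h2]
    exact Orb.left _
  intro g hg
  refine ⟨fun hr => ?_, fun hr => (hi _ (hle hg)).2 (congrArg Sum.inr hr)⟩
  have h1 : g ≠ Z.root := fun h => hc (h ▸ hr)
  have h2 : g ≠ Z.M.r1 Z.root := fun h => hc (by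
    rw [h, Z.M.r1_invol] at hr; exact hr.symm)
  exact (hi _ (hle hg)).1 (by rw [glue_r1_inr h1 h2, hr])

/-- A loop on the disk with both ends at a vertex in the interior cuts the disk into a disk and a
sphere. -/
theorem exists_glue_of_loop (hd : X.M.IsDisk) (hi : X.M.InteriorVertex X.root)
    (h0 : X.M.r0 X.root ≠ X.root) (hl : X.M.SameVertex X.root (X.M.r0 X.root))
    (hx : X.M.r1 X.root ≠ X.M.r0 X.root) :
    ∃ Y Z : RootedMap, Y.M.InteriorVertex Y.root ∧ Z.M.InteriorVertex Z.root ∧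
      Z.M.r1 Z.root = Z.M.r0 Z.root ∧ X.cls = (glue Y Z).cls ∧
      (Y.M.IsDisk ∧ Z.M.IsSphere ∨ Y.M.IsSphere ∧ Z.M.IsDisk) := by
  set N := X.M.conj (flagSwap (X.M.r1 X.root) (X.M.r0 X.root)) with hN
  have hNV : ¬ N.SameVertex (X.M.r1 X.root) X.root :=
    not_sameVertex_of_loop hd.2.1 hi h0 hl hx
  have hNt : N.r1 X.root = X.M.r0 X.root := by
    rw [hN, conj_r1, flagSwap_symm, flagSwap_of_ne hi.r1_ne.symm h0.symm, flagSwap_left]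
  have hNt' : N.r1 (X.M.r0 X.root) = X.root := (N.r1_invol.eq_iff.1 hNt).symm
  have hNF : ¬ N.SameFace (X.M.r1 X.root) X.root := by
    intro h
    have := (Orb.mem_iff N.r0_invol N.r1_invol (S := {X.root, X.M.r0 X.root}) ?_ ?_ h).2
      (Or.inl rfl)
    · exact this.elim hi.r1_ne hx
    · rintro _ (rfl | rfl)
      exacts [Or.inr rfl, Or.inl (X.M.r0_invol _)]
    · rintro _ (rfl | rfl)
      exacts [Or.inr hNt, Or.inl hNt']
  have hJ : N.Joinable (X.M.r1 X.root) X.root :=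
    ⟨by rwa [hNt], hi.r1_ne, by rwa [hNt]⟩
  have hMN : N.joinCorners (X.M.r1 X.root) X.root = X.M := by
    rw [joinCorners, hNt]; exact X.M.conj_conj (flagSwap_mul_self _ _)
  have hχ := hJ.eulerChar_joinCorners (by rwa [hMN, hNt]) (by rw [hNt]; exact Orb.left _) hNV hNF
  rw [hMN, hd.2.2] at hχ
  -- `N` has one vertex and one face more than `X`, which is impossible for a connected surface
  have hnl : ¬ N.Linked (X.M.r1 X.root) X.root := by
    intro hlink
    have hE := eqvGen_equivalence fun f g => g = N.r0 f ∨ g = N.r1 f ∨ g = N.r2 f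
    have hJE := JoinRel.equivalence hE (X.M.r1 X.root) X.root
    have hNc : N.Connected := by
      intro g h
      have : JoinRel N.Linked (X.M.r1 X.root) X.root g h := by
        refine Linked.lift (M := X.M) hJE id (fun f => Or.inl (Linked.r0 N f)) ?_
          (fun f => Or.inl (Linked.r2 N f)) (hd.1 g h)
        have key := hJ.forall_r1_joinCorners hJE (Or.inr ⟨Or.inl (hE.refl _), Or.inr (hE.refl _)⟩)
          (fun _ => Or.inr ⟨Or.inr (hE.symm (Linked.r1 N _)), Or.inl (hE.symm (Linked.r1 N _))⟩)
          fun f => Or.inl (Or.inl (Linked.r1 N f))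
        rwa [hMN] at key
      rcases this with h' | ⟨h1, h2⟩
      · exact h'
      · have : ∀ {p}, N.Linked p (X.M.r1 X.root) ∨ N.Linked p X.root → N.Linked p X.root :=
          fun h => h.elim (fun h => hE.trans h hlink) id
        exact hE.trans (this h1) (hE.symm (this h2))
    have := (N.eulerChar_le hNc X.root).1
    omega
  have hE := eqvGen_equivalence fun f g => g = N.r0 f ∨ g = N.r1 f ∨ g = N.r2 f
  obtain ⟨Y, Z, hY, hZ, hc, hr, -, h⟩ := X.exists_glue (t' := X.M.r0 X.root) hd.1 h0 hi.r1_ne hx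
    (S := {g | N.Linked (X.M.r1 X.root) g})
    (fun f hf => hE.trans hf (Linked.r0 N f)) (fun f hf => hE.trans hf (Linked.r1 N f))
    (fun f hf => hE.trans hf (Linked.r2 N f)) (hE.refl _) hnl
  have hr := hr rfl
  have hGi := natural_root.interiorVertex _ _ h hi
  have hGl : (glue Y Z).M.SameVertex (Sum.inr Z.root) (Sum.inr (Z.M.r1 Z.root)) := by
    have := natural_root.sameVertex natural_root.r0 _ _ h hl
    rw [hr]
    exact this
  have hZi := interiorVertex_of_glue hc hGi hGl
  have hL := loose_of_loop hc hr hZi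
  have hGd := invariant_isDisk _ _ h hd
  have hor := (glue_orientable hL (Or.inl hr)).1 hGd.2.1
  have hsum := glue_eulerChar (Y := Y) hL
  have hYle := (Y.M.eulerChar_le hY Y.root).1
  have hZle := (Z.M.eulerChar_le hZ Z.root).1
  have hG1 := hGd.2.2
  refine ⟨Y, Z, (glue_interiorVertex hL hZi).1 hGi, hZi, hr, h, ?_⟩
  rcases (by omega : Y.M.eulerChar = 1 ∧ Z.M.eulerChar = 2 ∨
    Y.M.eulerChar = 2 ∧ Z.M.eulerChar = 1) with h' | h'
  · exact Or.inl ⟨⟨hY, hor.1, h'.1⟩, ⟨hZ, hor.2, h'.2⟩⟩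
  · exact Or.inr ⟨⟨hY, hor.1, h'.1⟩, ⟨hZ, hor.2, h'.2⟩⟩

end RootedMap

/-! ### Counting the maps whose root edge is a loop -/

namespace RootedMap

open FlagMap

/-- The number of pairs of rooted maps is a sum over the numbers of darts and the degrees of the
first one. -/
theorem ncard_pairs_eq_sum {Q : RootedMap → RootedMap → Prop} (n m k : ℕ)
    (A B : Bool → ℕ → ℕ → RootedMap → Prop)
    (hn : ∀ Y Z, Q Y Z → Y.darts + Z.darts = n)
    (hm : ∀ Y Z, Q Y Z → Y.darts < m ∧ Y.degree < k) (c : RootedMap → Bool)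
    (hc : ∀ X Y : RootedMap, X.cls = Y.cls → c X = c Y)
    (hQ : ∀ b i j, i < m → j < k → ∀ Y Z,
      (Q Y Z ∧ c Y = b ∧ Y.darts = i ∧ Y.degree = j) ↔ (A b i j Y ∧ B b i j Z)) :
    ((fun p : RootedMap × RootedMap => (p.1.cls, p.2.cls)) '' {p | Q p.1 p.2}).ncard =
      ∑ i ∈ Finset.range m, ∑ j ∈ Finset.range k, count (A true i j) * count (B true i j) +
      ∑ i ∈ Finset.range m, ∑ j ∈ Finset.range k, count (A false i j) * count (B false i j) := by
  rw [ncard_image_eq_sum (fun p : RootedMap × RootedMap => (p.1.cls, p.2.cls))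
    ((Finset.univ : Finset Bool) ×ˢ Finset.range m ×ˢ Finset.range k)
    (fun p => (c p.1, p.1.darts, p.1.degree)) ?_ ?_ ?_]
  · rw [Finset.sum_product, Fintype.sum_bool, Finset.sum_product, Finset.sum_product]
    have key : ∀ b : Bool, ∑ x ∈ Finset.range m, ∑ y ∈ Finset.range k,
        ((fun p : RootedMap × RootedMap => (p.1.cls, p.2.cls)) ''
          {a | Q a.1 a.2 ∧ (c a.1, a.1.darts, a.1.degree) = (b, x, y)}).ncard =
        ∑ i ∈ Finset.range m, ∑ j ∈ Finset.range k, count (A b i j) * count (B b i j) := by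
      intro b
      refine Finset.sum_congr rfl fun i hi => Finset.sum_congr rfl fun j hj => ?_
      rw [← ncard_pairs]
      congr 2
      ext p
      rw [Set.mem_ofPred_eq, Set.mem_ofPred_eq, Prod.mk.injEq, Prod.mk.injEq]
      exact hQ b i j (Finset.mem_range.1 hi) (Finset.mem_range.1 hj) p.1 p.2
    rw [key, key]
  · have hf : ∀ N, (cls '' {X | X.darts ≤ N}).Finite := by
      intro N
      refine ((Finset.range (N + 1)).finite_toSet.biUnion fun i _ => finite_classes i).subset ?_
      rintro _ ⟨X, hX, rfl⟩
      exact Set.mem_biUnion (Finset.mem_range.2 (Nat.lt_succ_of_le hX)) ⟨X, rfl, rfl⟩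
    refine ((hf n).prod (hf n)).subset ?_
    rintro _ ⟨p, hp, rfl⟩
    have := hn _ _ hp
    exact ⟨⟨p.1, (by omega : p.1.darts ≤ n), rfl⟩, ⟨p.2, (by omega : p.2.darts ≤ n), rfl⟩⟩
  · intro p hp
    have := hm _ _ hp
    simp [this]
  · intro p p' _ _ h
    have h := (Prod.mk.inj h).1
    simp only [hc _ _ h, darts_congr h, degree_congr h]

/-- The numbers of maps on the sphere, including the map that is a single vertex. -/
noncomputable def balls (n k : ℕ) : ℕ := count (IsBall n k) + if n = 0 ∧ k = 0 then 1 else 0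

theorem invariant_loop_ne : Invariant fun X => X.M.r1 X.root = X.M.r0 X.root :=
  natural_root.r1.eq natural_root.r0

/-- Maps on the disk whose root edge is a loop and whose root corner is not the inside of this loop.
The part `Z` that contains the loop is a disk or a sphere; without the loop it is an arbitrary map
rooted at this vertex, or, in the case of a sphere, possibly a single vertex. -/
theorem count_isInner_loop_ne (n k : ℕ) :
    count (fun X => (IsInner n k X ∧ X.M.r0 X.root ≠ X.root ∧
        X.M.SameVertex X.root (X.M.r0 X.root)) ∧ X.M.r1 X.root ≠ X.M.r0 X.root) =
      ∑ n' ∈ Finset.range (n - 1), ∑ k' ∈ Finset.range (k - 1),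
        count (IsInner n' k') * balls (n - n' - 2) (k - k' - 2) +
      ∑ n' ∈ Finset.range (n - 1), ∑ k' ∈ Finset.range (k - 1),
        count (IsBall n' k') * count (IsInner (n - n' - 2) (k - k' - 2)) := by
  classical
  -- the loop of the second map surrounds a single corner
  let Q : RootedMap → RootedMap → Prop := fun Y Z => (Y.darts + Z.darts = n ∧
    Y.degree + Z.degree = k ∧ Z.M.r1 Z.root = Z.M.r0 Z.root) ∧ Y.M.InteriorVertex Y.root ∧
    Z.M.InteriorVertex Z.root ∧ (Y.M.IsDisk ∧ Z.M.IsSphere ∨ Y.M.IsSphere ∧ Z.M.IsDisk)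
  have hQc : ∀ Y Z, Q Y Z → Y.M.Connected ∧ Z.M.Connected ∧ Z.M.Loose Z.root := by
    rintro Y Z ⟨⟨-, -, hr⟩, -, hZi, h⟩
    exact ⟨h.elim (fun h => h.1.1) fun h => h.1.1, h.elim (fun h => h.2.1) fun h => h.2.1,
      loose_of_loop hZi.r1_ne hr hZi⟩
  rw [count_glue (Q := Q) ?_ ?_ hQc (Or.inl fun Y Z h => h.1.2.2),
    ncard_pairs_eq_sum n (n - 1) (k - 1)
      (fun b i j => if b then IsInner i j else IsBall i j)
      (fun b i j X => (if b then IsBall (n - i) (k - j) X else IsInner (n - i) (k - j) X) ∧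
        X.M.r1 X.root = X.M.r0 X.root) (fun Y Z h => h.1.1) ?_ (fun X => decide X.M.IsDisk)
      (fun X Y h => decide_eq_decide.2 ⟨invariant_isDisk _ _ h, invariant_isDisk _ _ h.symm⟩) ?_]
  · congr 1 <;>
    refine Finset.sum_congr rfl fun i hi => Finset.sum_congr rfl fun j hj => ?_
    all_goals
      rw [Finset.mem_range] at hi hj
      have h1 : n - i = n - i - 2 + 2 := by omega
      have h2 : k - j = k - j - 2 + 2 := by omega
    · have := count_isBall_loop (n - i - 2) (k - j - 2)
      rw [← h1, ← h2] at this
      simp only [if_true]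
      rw [this, balls]
    · have := count_isInner_loop (n - i - 2) (k - j - 2)
      rw [← h1, ← h2] at this
      simp only [Bool.false_eq_true, if_false]
      rw [this]
  · intro Y Z h
    have := two_le_of_corner (hQc Y Z h).2.1 h.2.2.1 h.1.2.2
    have h1 := h.1.1
    have h2 := h.1.2.1
    omega
  · rintro b i j hi hj Y Z
    rcases b
    · simp only [Bool.false_eq_true, if_false, decide_eq_false_iff_not, IsInner, IsBall, Q]
      constructor
      · rintro ⟨⟨⟨h1, h2, h3⟩, h4, h5, h6⟩, hb, rfl, rfl⟩
        have h6 := h6.resolve_left fun h => hb h.1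
        exact ⟨⟨rfl, h6.1, rfl⟩, ⟨by omega, h6.2, h5, by omega⟩, h3⟩
      · rintro ⟨⟨rfl, h1, rfl⟩, ⟨h2, h3, h4, h5⟩, h6⟩
        exact ⟨⟨⟨by omega, by omega, h6⟩, h1.interiorVertex _, h4, Or.inr ⟨h1, h3⟩⟩,
          fun h => h.not_isSphere h1, rfl, rfl⟩
    · simp only [if_true, decide_eq_true_eq, IsInner, IsBall, Q]
      constructor
      · rintro ⟨⟨⟨h1, h2, h3⟩, h4, h5, h6⟩, hb, rfl, rfl⟩
        have h6 := h6.resolve_right fun h => hb.not_isSphere h.1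
        exact ⟨⟨rfl, hb, h4, rfl⟩, ⟨by omega, h6.2, by omega⟩, h3⟩
      · rintro ⟨⟨rfl, h1, h1', rfl⟩, ⟨h2, h3, h5⟩, h6⟩
        exact ⟨⟨⟨by omega, by omega, h6⟩, h1', h3.interiorVertex _, Or.inl ⟨h1, h3⟩⟩, h1, rfl, rfl⟩
  · rintro X ⟨⟨⟨hn, hd, hi, hk⟩, h0, hl⟩, hx⟩
    obtain ⟨Y, Z, hYi, hZi, hr, h, hYZ⟩ := exists_glue_of_loop hd hi h0 hl hx
    have hL := loose_of_loop hZi.r1_ne hr hZi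
    refine ⟨Y, Z, ⟨⟨?_, ?_, hr⟩, hYi, hZi, hYZ⟩, h⟩
    · rw [← glue_darts, ← darts_congr h, hn]
    · rw [← glue_degree hL, ← degree_congr h, hk]
  · intro Y Z hQ
    obtain ⟨hY, hZ, hL⟩ := hQc Y Z hQ
    obtain ⟨⟨hn, hk, hr⟩, hYi, hZi, hYZ⟩ := hQ
    have hχ := glue_eulerChar (Y := Y) hL
    refine ⟨⟨⟨glue_darts.trans hn, ⟨glue_connected hL hY hZ, (glue_orientable hL (Or.inl hr)).2 ?_,
      ?_⟩, (glue_interiorVertex hL hZi).2 hYi, (glue_degree hL).trans hk⟩, ?_, ?_⟩, ?_⟩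
    · exact hYZ.elim (fun h => ⟨h.1.2.1, h.2.2.1⟩) fun h => ⟨h.1.2.1, h.2.2.1⟩
    · rcases hYZ with h | h
      all_goals
        have h1 := h.1.2.2
        have h2 := h.2.2.2
        omega
    · exact fun h => hZi.r1_ne (hr.trans (Sum.inr_injective h))
    · have := glue_sameVertex_other (Y := Y) hL
      rw [hr] at this
      exact this
    · rw [glue_r1_root hL]
      exact Sum.inl_ne_inr

/-- Maps on the disk whose root corner is the inside of a loop. They supply the single vertex that
is missing among the spheres when the two factors are exchanged. -/
theorem count_isInner_loop_eq (n k : ℕ) :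
    count (fun X => (IsInner n k X ∧ X.M.r0 X.root ≠ X.root ∧
        X.M.SameVertex X.root (X.M.r0 X.root)) ∧ X.M.r1 X.root = X.M.r0 X.root) =
      if 2 ≤ n ∧ 2 ≤ k then count (IsInner (n - 2) (k - 2)) else 0 := by
  have h : count (fun X => (IsInner n k X ∧ X.M.r0 X.root ≠ X.root ∧
        X.M.SameVertex X.root (X.M.r0 X.root)) ∧ X.M.r1 X.root = X.M.r0 X.root) =
      count fun X => IsInner n k X ∧ X.M.r1 X.root = X.M.r0 X.root := by
    refine count_congr fun X => ⟨fun h => ⟨h.1.1, h.2⟩, fun h => ⟨⟨h.1, ?_, ?_⟩, h.2⟩⟩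
    · rw [← h.2]; exact h.1.2.2.1.r1_ne
    · rw [← h.2]; exact sameVertex_r1 (M := X.M) _
  rw [h]
  split_ifs with hnk
  · rw [← count_isInner_loop, Nat.sub_add_cancel hnk.1, Nat.sub_add_cancel hnk.2]
  · refine count_eq_zero fun X hX => hnk ?_
    have := two_le_of_corner hX.1.2.1.1 hX.1.2.2.1 hX.2
    rwa [hX.1.1, hX.1.2.2.2] at this

/-- Maps on the disk whose root edge is a loop. The factor `2` is due to the two sides of the root
edge, either of which may be the side of the sphere. -/
theorem count_isInner_sameVertex (n k : ℕ) :
    count (fun X => IsInner n k X ∧ X.M.r0 X.root ≠ X.root ∧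
        X.M.SameVertex X.root (X.M.r0 X.root)) =
      2 * ∑ n' ∈ Finset.range (n - 1), ∑ k' ∈ Finset.range (k - 1),
        count (IsInner n' k') * balls (n - n' - 2) (k - k' - 2) := by
  rw [count_add (n := n) (fun X => X.M.r1 X.root = X.M.r0 X.root) (fun X hX => hX.1.1)
    invariant_loop_ne, count_isInner_loop_ne, count_isInner_loop_eq, two_mul, add_left_comm]
  congr 1
  -- exchange the two factors
  have hrefl : ∑ n' ∈ Finset.range (n - 1), ∑ k' ∈ Finset.range (k - 1),
      count (IsBall n' k') * count (IsInner (n - n' - 2) (k - k' - 2)) =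
      ∑ n' ∈ Finset.range (n - 1), ∑ k' ∈ Finset.range (k - 1),
        count (IsInner n' k') * count (IsBall (n - n' - 2) (k - k' - 2)) := by
    rw [← Finset.sum_range_reflect]
    refine Finset.sum_congr rfl fun i hi => ?_
    rw [← Finset.sum_range_reflect]
    refine Finset.sum_congr rfl fun j hj => ?_
    rw [Finset.mem_range] at hi hj
    rw [mul_comm, show n - 1 - 1 - i = n - i - 2 by omega, show k - 1 - 1 - j = k - j - 2 by omega,
      show n - (n - i - 2) - 2 = i by omega, show k - (k - j - 2) - 2 = j by omega]
  rw [hrefl]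
  -- the maps whose root corner is inside the loop are the terms where the sphere is a single vertex
  have hz : (if 2 ≤ n ∧ 2 ≤ k then count (IsInner (n - 2) (k - 2)) else 0) =
      ∑ n' ∈ Finset.range (n - 1), ∑ k' ∈ Finset.range (k - 1),
        count (IsInner n' k') * if n - n' - 2 = 0 ∧ k - k' - 2 = 0 then 1 else 0 := by
    split_ifs with h
    · rw [Finset.sum_eq_single (n - 2), Finset.sum_eq_single (k - 2)]
      · rw [if_pos (by omega), mul_one]
      · intro j hj hne
        rw [Finset.mem_range] at hj
        rw [if_neg (by omega), mul_zero]
      · intro hj; exact absurd (Finset.mem_range.2 (by omega)) hj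
      · intro i hi hne
        rw [Finset.mem_range] at hi
        refine Finset.sum_eq_zero fun j _ => ?_
        rw [if_neg (by omega), mul_zero]
      · intro hj; exact absurd (Finset.mem_range.2 (by omega)) hj
    · refine (Finset.sum_eq_zero fun i hi => Finset.sum_eq_zero fun j hj => ?_).symm
      rw [Finset.mem_range] at hi hj
      omega
  rw [hz, ← Finset.sum_add_distrib]
  refine Finset.sum_congr rfl fun i _ => ?_
  rw [← Finset.sum_add_distrib]
  refine Finset.sum_congr rfl fun j _ => ?_
  rw [balls, mul_add, add_comm]

end RootedMap

/-! ### Adding a halfedge -/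

namespace FlagMap

variable {G : Type*} {M : FlagMap G} {x z : G}

/-- Two sides of flags on the boundary that run from a vertex to the centre of a face. -/
structure Ends (M : FlagMap G) (x z : G) : Prop where
  left : M.r1 x = x
  right : M.r1 z = z
  ne : x ≠ z

open Classical in
/-- A halfedge is attached: its two flags `inr false` and `inr true` become adjacent to `x`
and `z`. -/
noncomputable def addHalf (M : FlagMap G) (h : M.Ends x z) : FlagMap (G ⊕ Bool) where
  r0 := Sum.map M.r0 id
  r1 := Sum.elim (fun g => if g = x then Sum.inr false else if g = z then Sum.inr true
    else Sum.inl (M.r1 g)) fun b => Sum.inl (cond b z x)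
  r2 := Sum.map M.r2 not
  r0_invol := (M.sum halfedge).r0_invol
  r1_invol := by
    rintro (f | _ | _)
    · by_cases h1 : f = x
      · simp [h1]
      by_cases h2 : f = z
      · simp [h2, h.ne.symm]
      have h3 : M.r1 f ≠ x := fun h' => h1 (by rw [← M.r1_invol f, h', h.left])
      have h4 : M.r1 f ≠ z := fun h' => h2 (by rw [← M.r1_invol f, h', h.right])
      simp [h1, h2, h3, h4, M.r1_invol f]
    · simp
    · simp [h.ne.symm]
  r2_invol := (M.sum halfedge).r2_invol
  r0_r2_comm := (M.sum halfedge).r0_r2_comm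
  r0_ne_r2 := (M.sum halfedge).r0_ne_r2

namespace Ends

theorem r1_left (h : M.Ends x z) : (M.addHalf h).r1 (Sum.inl x) = Sum.inr false := if_pos rfl

theorem r1_right (h : M.Ends x z) : (M.addHalf h).r1 (Sum.inl z) = Sum.inr true :=
  (if_neg h.ne.symm).trans (if_pos rfl)

theorem r1_inl (h : M.Ends x z) {g : G} (h1 : g ≠ x) (h2 : g ≠ z) :
    (M.addHalf h).r1 (Sum.inl g) = Sum.inl (M.r1 g) := (if_neg h1).trans (if_neg h2)

theorem r1_inr (h : M.Ends x z) (b : Bool) :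
    (M.addHalf h).r1 (Sum.inr b) = Sum.inl (cond b z x) := rfl

/-- Every pair of flags that are adjacent at a corner is so before the halfedge is attached, or one
of the flags belongs to the halfedge. -/
theorem forall_r1 (h : M.Ends x z) {s : G ⊕ Bool → G ⊕ Bool → Prop} (hs : Equivalence s)
    (h1 : s (Sum.inl x) (Sum.inr false)) (h2 : s (Sum.inl z) (Sum.inr true))
    (h3 : ∀ g, g ≠ x → g ≠ z → s (Sum.inl g) (Sum.inl (M.r1 g))) (p : G ⊕ Bool) :
    s p ((M.addHalf h).r1 p) := by
  rcases p with g | _ | _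
  · by_cases g1 : g = x
    · rw [g1, h.r1_left]; exact h1
    by_cases g2 : g = z
    · rw [g2, h.r1_right]; exact h2
    rw [h.r1_inl g1 g2]; exact h3 g g1 g2
  · exact hs.symm h1
  · exact hs.symm h2

theorem orb_inl (h : M.Ends x z) {a : G → G} {a' : G ⊕ Bool → G ⊕ Bool}
    (ha : ∀ g, a' (Sum.inl g) = Sum.inl (a g)) {g k : G} (hgk : Orb M.r1 a g k) :
    Orb (M.addHalf h).r1 a' (Sum.inl g) (Sum.inl k) := by
  refine hgk.map Sum.inl (fun f => ?_) fun f => ha f ▸ Orb.right _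
  by_cases g1 : f = x
  · rw [g1, h.left]
  by_cases g2 : f = z
  · rw [g2, h.right]
  rw [← h.r1_inl g1 g2]; exact Orb.left _

/-- The retraction that takes the flags of the halfedge to the adjacent flags. -/
def retract (x z : G) : G ⊕ Bool → G := Sum.elim id fun b => cond b z x

theorem retract_r1 (h : M.Ends x z) {s : G → G → Prop} (hs : Equivalence s)
    (h3 : ∀ g, s g (M.r1 g)) (p : G ⊕ Bool) :
    s (retract x z p) (retract x z ((M.addHalf h).r1 p)) :=
  h.forall_r1 (s := fun p q => s (retract x z p) (retract x z q))
    ⟨fun _ => hs.refl _, hs.symm, hs.trans⟩ (hs.refl x) (hs.refl z) (fun g _ _ => h3 g) p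

variable (h : M.Ends x z)

include h in
theorem retract_r2 (hxz : M.SameVertex x z) (p : G ⊕ Bool) :
    M.SameVertex (retract x z p) (retract x z ((M.addHalf h).r2 p)) := by
  rcases p with g | _ | _
  exacts [Orb.right g, hxz, hxz.symm]

theorem sameVertex_retract (hxz : M.SameVertex x z) {p q : G ⊕ Bool}
    (hpq : (M.addHalf h).SameVertex p q) : M.SameVertex (retract x z p) (retract x z q) :=
  Orb.map (a := (M.addHalf h).r1) (b := (M.addHalf h).r2) _
    (h.retract_r1 (Orb.equivalence M.r1 M.r2) Orb.left) (h.retract_r2 hxz) hpq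

theorem sameVertex_inl_iff (hxz : M.SameVertex x z) {g k : G} :
    (M.addHalf h).SameVertex (Sum.inl g) (Sum.inl k) ↔ M.SameVertex g k :=
  ⟨h.sameVertex_retract hxz, fun hgk => h.orb_inl (a := M.r2) (fun _ => rfl) hgk⟩

theorem sameVertex_inr (b : Bool) : (M.addHalf h).SameVertex (Sum.inr false) (Sum.inr b) := by
  rcases b
  exacts [Orb.refl _, Orb.right (a := (M.addHalf h).r1) (b := (M.addHalf h).r2) (Sum.inr false)]

theorem sameVertex_root_inl (hxz : M.SameVertex x z) {g : G} :
    (M.addHalf h).SameVertex (Sum.inr false) (Sum.inl g) ↔ M.SameVertex x g := by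
  rw [← h.sameVertex_inl_iff hxz]
  have h1 : (M.addHalf h).SameVertex (Sum.inr false) (Sum.inl x) :=
    sameVertex_r1 (M := M.addHalf h) _
  exact ⟨fun h' => h1.symm.trans h', fun h' => h1.trans h'⟩

theorem innerFlags_addHalf [Finite G] (hxz : M.SameVertex x z) :
    (M.addHalf h).innerFlags (Sum.inr false) = M.innerFlags x + 2 := by
  have h2 : Nat.card {b : Bool // (M.addHalf h).SameVertex (Sum.inr false) (Sum.inr b) ∧
      (M.addHalf h).r2 (Sum.inr b) ≠ Sum.inr b} = 2 := by
    rw [Nat.card_congr (Equiv.subtypeUnivEquiv fun b => ⟨h.sameVertex_inr b, fun h' =>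
      Bool.not_ne_self b (Sum.inr_injective h')⟩)]
    simp
  unfold innerFlags
  rw [← h2, ← Nat.card_sum]
  refine Nat.card_congr ((Equiv.subtypeSum (α := G) (β := Bool)).trans (Equiv.sumCongr
    (Equiv.subtypeEquivRight fun g => ?_) (Equiv.refl _)))
  rw [h.sameVertex_root_inl hxz]
  exact and_congr_right fun _ => not_congr Sum.inl_injective.eq_iff

theorem interiorVertex_addHalf (hxz : M.SameVertex x z) :
    (M.addHalf h).InteriorVertex (Sum.inr false) ↔
      ∀ g, M.SameVertex x g → (M.r1 g = g → g = x ∨ g = z) ∧ M.r2 g ≠ g := by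
  constructor
  · intro hi g hg
    have := hi (Sum.inl g) ((h.sameVertex_root_inl hxz).2 hg)
    refine ⟨fun hr => ?_, fun hr => this.2 (congrArg Sum.inl hr)⟩
    by_contra! hne
    exact this.1 (by rw [h.r1_inl hne.1 hne.2, hr])
  · rintro hi (g | b) hg
    · have := hi g ((h.sameVertex_root_inl hxz).1 hg)
      refine ⟨fun hr => ?_, fun hr => this.2 (Sum.inl_injective hr)⟩
      by_cases g1 : g = x
      · rw [g1, h.r1_left] at hr; exact Sum.inr_ne_inl hr
      by_cases g2 : g = z
      · rw [g2, h.r1_right] at hr; exact Sum.inr_ne_inl hr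
      rw [h.r1_inl g1 g2] at hr
      exact (this.1 (Sum.inl_injective hr)).elim g1 g2
    · exact ⟨Sum.inl_ne_inr, fun hr => Bool.not_ne_self b (Sum.inr_injective hr)⟩

theorem eulerChar_addHalf [Finite G] (hxz : M.SameVertex x z) :
    (M.addHalf h).eulerChar = M.eulerChar := by
  have hs := eulerChar_sum M halfedge
  have hV1 : Nat.card (Quot (M.sum halfedge).SameVertex) =
      Nat.card (Quot M.SameVertex) + Nat.card (Quot (Orb not not)) :=
    Orb.card_quot_sum M.r1 M.r2 not not
  have hF1 : Nat.card (Quot (M.sum halfedge).SameFace) =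
      Nat.card (Quot M.SameFace) + Nat.card (Quot (Orb id not)) :=
    Orb.card_quot_sum M.r0 M.r1 id not
  have hS1 : numSides (M.sum halfedge).r1 = numSides M.r1 + numSides not := by
    simp only [numSides_eq_card_orb]; exact Orb.card_quot_sum _ _ _ _
  have h1 : Nat.card (Quot (Orb not not)) = 1 :=
    (card_quot_orb_eq (G := Unit) (fun _ => ()) (by decide) (by decide) (by decide)
      (by decide)).trans (by simp)
  have h2 : Nat.card (Quot (Orb id not)) = 1 :=
    (card_quot_orb_eq (G := Unit) (fun _ => ()) (by decide) (by decide) (by decide)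
      (by decide)).trans (by simp)
  have h3 : numSides not = 1 := by rw [numSides_eq_card_orb, h1]
  have hret : ∀ p, Orb (M.addHalf h).r1 (M.addHalf h).r1 (Sum.inl (retract x z p)) p := by
    rintro (g | _ | _)
    exacts [Orb.refl _, (Orb.left (Sum.inr false)).symm, (Orb.left (Sum.inr true)).symm]
  have hret' : ∀ {a} (p), Orb a (M.addHalf h).r1 (Sum.inl (retract x z p)) p := fun p =>
    (hret p).map id Orb.right Orb.right
  have hV2 : Nat.card (Quot (M.addHalf h).SameVertex) = Nat.card (Quot M.SameVertex) :=
    Orb.card_quot_congr (retract x z) Sum.inl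
      (h.retract_r1 (Orb.equivalence M.r1 M.r2) Orb.left) (h.retract_r2 hxz)
      (fun f => h.orb_inl (a := M.r2) (fun _ => rfl) (Orb.left f))
      (fun f => h.orb_inl (a := M.r2) (fun _ => rfl) (Orb.right f))
      (fun p => (hret' p).comm) (fun g => Orb.refl _)
  have hF2 : Nat.card (Quot (M.addHalf h).SameFace) = Nat.card (Quot M.SameFace) :=
    Orb.card_quot_congr (retract x z) Sum.inl
      (by
        rintro (g | _ | _)
        exacts [Orb.left g, Orb.refl _, Orb.refl _])
      (h.retract_r1 (Orb.equivalence M.r0 M.r1) Orb.right)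
      (fun f => (h.orb_inl (a := M.r0) (fun _ => rfl) (Orb.right f)).comm)
      (fun f => (h.orb_inl (a := M.r0) (fun _ => rfl) (Orb.left f)).comm)
      hret' (fun g => Orb.refl _)
  have hS2 : numSides (M.addHalf h).r1 = numSides M.r1 := by
    rw [numSides_eq_card_orb, numSides_eq_card_orb]
    refine Orb.card_quot_congr (retract x z) Sum.inl
      (h.retract_r1 (Orb.equivalence M.r1 M.r1) Orb.left)
      (h.retract_r1 (Orb.equivalence M.r1 M.r1) Orb.left) ?_ ?_ hret (fun g => Orb.refl _)
    all_goals
      intro f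
      by_cases g1 : f = x
      · rw [g1, h.left]
      by_cases g2 : f = z
      · rw [g2, h.right]
      rw [← h.r1_inl g1 g2]; exact Orb.left _
  have hE : Nat.card (Quot (M.addHalf h).SameEdge) = Nat.card (Quot (M.sum halfedge).SameEdge) :=
    rfl
  have hS0 : numSides (M.addHalf h).r0 = numSides (M.sum halfedge).r0 := rfl
  have hS2' : numSides (M.addHalf h).r2 = numSides (M.sum halfedge).r2 := rfl
  have hd := isDisk_halfedge.2.2
  rw [eulerChar, hV1, hF1, hS1, h1, h2, h3, hd] at hs
  rw [eulerChar, hE, hS0, hS2', hV2, hF2, hS2]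
  push_cast at hs ⊢
  linarith

theorem linked_inl {g k : G} (hgk : M.Linked g k) :
    (M.addHalf h).Linked (Sum.inl g) (Sum.inl k) := by
  refine Linked.lift (M := M) (eqvGen_equivalence _) Sum.inl
    (fun f => Linked.r0 (M.addHalf h) (Sum.inl f)) (fun f => ?_)
    (fun f => Linked.r2 (M.addHalf h) (Sum.inl f)) hgk
  by_cases g1 : f = x
  · rw [g1, h.left]; exact .refl _
  by_cases g2 : f = z
  · rw [g2, h.right]; exact .refl _
  rw [← h.r1_inl g1 g2]; exact Linked.r1 (M.addHalf h) _

theorem connected_addHalf (hxz : M.SameVertex x z) :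
    (M.addHalf h).Connected ↔ M.Connected := by
  constructor
  · intro hM g k
    refine Linked.lift (M := M.addHalf h) (f := Sum.inl g) (g := Sum.inl k) (eqvGen_equivalence _)
      (retract x z) ?_ (h.retract_r1 (eqvGen_equivalence _) (Linked.r1 M)) ?_ (hM _ _)
    · rintro (f | _ | _)
      exacts [Linked.r0 M f, .refl _, .refl _]
    · intro p
      exact Orb.lift (eqvGen_equivalence _) id (Linked.r1 M) (Linked.r2 M) (h.retract_r2 hxz p)
  · intro hM p q
    have hE := eqvGen_equivalence fun f g => g = (M.addHalf h).r0 f ∨ g = (M.addHalf h).r1 f ∨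
      g = (M.addHalf h).r2 f
    have key : ∀ p, (M.addHalf h).Linked p (Sum.inl (retract x z p)) := by
      rintro (g | _ | _)
      exacts [hE.refl _, Linked.r1 (M.addHalf h) _, Linked.r1 (M.addHalf h) _]
    exact hE.trans (key p) (hE.trans (h.linked_inl (hM _ _)) (hE.symm (key q)))

/-- Colourings extend over the halfedge because the two ends `x` and `z` have different colours. -/
theorem orientable_addHalf [Finite G] (hxz : M.SameVertex x z)
    (hi : ∀ g, M.SameVertex x g → (M.r1 g = g → g = x ∨ g = z) ∧ M.r2 g ≠ g) :
    (M.addHalf h).Orientable ↔ M.Orientable := by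
  constructor
  · rintro ⟨c, hc⟩
    refine ⟨c ∘ Sum.inl, fun f => ⟨fun h' => (hc (Sum.inl f)).1 fun h'' =>
      h' (Sum.inl_injective h''), fun h' => ?_, fun h' => (hc (Sum.inl f)).2.2 fun h'' =>
      h' (Sum.inl_injective h'')⟩⟩
    have h1 : f ≠ x := fun hf => h' (hf ▸ h.left)
    have h2 : f ≠ z := fun hf => h' (hf ▸ h.right)
    have := (hc (Sum.inl f)).2.1
    rw [h.r1_inl h1 h2] at this
    exact this fun h'' => h' (Sum.inl_injective h'')
  · rintro ⟨c, hc⟩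
    have hcz : c z ≠ c x := Orb.color_ne_of_ends M.r1_invol M.r2_invol h.ne.symm h.left h.right hxz
      (fun g _ => (hc g).2.1) (fun g hg => (hc g).2.2 (hi g hg).2) fun g hg => (hi g hg).1
    refine ⟨Sum.elim c fun b => !c (cond b z x), ?_⟩
    rintro (f | b)
    · refine ⟨fun h' => (hc f).1 fun h'' => h' (congrArg Sum.inl h''), fun h' => ?_,
        fun h' => (hc f).2.2 fun h'' => h' (congrArg Sum.inl h'')⟩
      by_cases g1 : f = x
      · rw [g1, h.r1_left]; simp
      by_cases g2 : f = z
      · rw [g2, h.r1_right]; simp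
      rw [h.r1_inl g1 g2] at h' ⊢
      exact (hc f).2.1 fun h'' => h' (congrArg Sum.inl h'')
    · refine ⟨fun h' => absurd rfl h', fun _ => ?_, fun _ => ?_⟩
      · rw [h.r1_inr]; simp
      · rcases b <;> simp [addHalf, hcz, hcz.symm]

end Ends

end FlagMap

namespace RootedMap

open FlagMap

variable {X Y : RootedMap}

/-- The rooted map with a halfedge attached between the root and `z`; the root is on the
halfedge. -/
noncomputable abbrev addHalf (Y : RootedMap) {z : Y.F} (h : Y.M.Ends Y.root z) : RootedMap :=
  ⟨Y.F ⊕ Bool, inferInstance, Y.M.addHalf h, Sum.inr false⟩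

theorem boundaryDarts_eq_zero_iff {F : Type*} [Finite F] {M : FlagMap F} {f : F} :
    M.boundaryDarts f = 0 ↔ ∀ g, M.SameVertex f g → M.r2 g ≠ g := by
  rw [boundaryDarts, Finite.card_eq_zero_iff]
  exact ⟨fun h g hg hr => h.elim' ⟨g, hg, hr⟩, fun h => ⟨fun g => h g g.2.1 g.2.2⟩⟩

/-- The rooted maps on the disk whose root vertex is on the boundary, whose root is leftmost, and
that have no boundary dart at the root vertex. -/
def IsOuter0 (n k : ℕ) (Y : RootedMap) : Prop :=
  Y.darts = n ∧ Y.M.IsDisk ∧ Y.M.r1 Y.root = Y.root ∧ Y.M.boundaryDarts Y.root = 0 ∧ Y.degree = k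

/-- The vertex of the root of such a map is a path of flags from the root to another end `z`. -/
theorem exists_ends {n k : ℕ} (hY : IsOuter0 n k Y) :
    ∃ z, Y.M.Ends Y.root z ∧ Y.M.SameVertex Y.root z ∧
      ∀ g, Y.M.SameVertex Y.root g → (Y.M.r1 g = g → g = Y.root ∨ g = z) ∧ Y.M.r2 g ≠ g := by
  obtain ⟨-, -, hr, hb, -⟩ := hY
  rw [boundaryDarts_eq_zero_iff] at hb
  rcases Orb.exists_other_end Y.M.r1_invol Y.M.r2_invol hr with
    ⟨z, h1, h2, h3, -, h4⟩ | ⟨z, h1, h2, -⟩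
  · exact ⟨z, ⟨hr, h3, h2.symm⟩, h1, fun g hg => ⟨h4 g hg, hb g hg⟩⟩
  · exact absurd h2 (hb z h1)

theorem addHalf_darts {z : Y.F} (h : Y.M.Ends Y.root z) : (Y.addHalf h).darts = Y.darts + 1 := by
  have hb : Nat.card Bool = 2 := by simp
  have h0 : Nat.card (Y.addHalf h).F = Nat.card Y.F + 2 := hb ▸ Nat.card_sum
  have h1 := (Y.addHalf h).two_mul_darts
  have h2 := Y.two_mul_darts
  omega

theorem addHalf_degree {z : Y.F} (h : Y.M.Ends Y.root z) (hz : Y.M.SameVertex Y.root z) :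
    (Y.addHalf h).degree = Y.degree + 1 := by
  have h0 : (Y.addHalf h).M.innerFlags (Y.addHalf h).root = Y.M.innerFlags Y.root + 2 :=
    h.innerFlags_addHalf hz
  have h1 := (Y.addHalf h).two_mul_degree
  have h2 := Y.two_mul_degree
  omega

theorem addHalf_isInner_iff {z : Y.F} (h : Y.M.Ends Y.root z) (hz : Y.M.SameVertex Y.root z)
    (hi : ∀ g, Y.M.SameVertex Y.root g → (Y.M.r1 g = g → g = Y.root ∨ g = z) ∧ Y.M.r2 g ≠ g)
    {n k : ℕ} : IsInner (n + 1) (k + 1) (Y.addHalf h) ↔ IsOuter0 n k Y := by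
  rw [IsInner, IsOuter0, IsDisk, IsDisk, addHalf_darts, addHalf_degree h hz,
    h.interiorVertex_addHalf hz, h.eulerChar_addHalf hz, h.connected_addHalf hz,
    h.orientable_addHalf hz hi, Nat.add_right_cancel_iff, Nat.add_right_cancel_iff,
    boundaryDarts_eq_zero_iff]
  exact ⟨fun h' => ⟨h'.1, h'.2.1, h.left, fun g hg => (hi g hg).2, h'.2.2.2⟩,
    fun h' => ⟨h'.1, h'.2.1, hi, h'.2.2.2.2⟩⟩

/-- A halfedge at a vertex in the interior with other darts has been attached to a map whose root
vertex is on the boundary. -/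
theorem exists_addHalf (hX : X.M.Connected) (hi : X.M.InteriorVertex X.root)
    (h0 : X.M.r0 X.root = X.root) (hx : X.M.r1 X.root ≠ X.M.r2 X.root) :
    ∃ (Y : RootedMap) (z : Y.F) (h : Y.M.Ends Y.root z), Y.M.SameVertex Y.root z ∧
      (∀ g, Y.M.SameVertex Y.root g → (Y.M.r1 g = g → g = Y.root ∨ g = z) ∧ Y.M.r2 g ≠ g) ∧
      X.cls = (Y.addHalf h).cls := by
  classical
  set f := X.root with hf
  set g := X.M.r2 f with hg
  set x := X.M.r1 f with hxdef
  set z := X.M.r1 g with hzdef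
  have hgf : g ≠ f := hi.r2_ne
  have hxf : x ≠ f := hi.r1_ne
  have hzg : z ≠ g := (hi.of_sameVertex (sameVertex_r2 (M := X.M) f)).r1_ne
  have hxz : x ≠ z := fun h => hgf (X.M.r1_invol.injective h).symm
  have hrx : X.M.r1 x = f := X.M.r1_invol f
  have hrz : X.M.r1 z = g := X.M.r1_invol g
  have hzf : z ≠ f := fun h => hx (by rw [hxdef, ← h, hrz])
  have h0g : X.M.r0 g = g := by rw [hg, X.M.r0_r2_comm, h0]
  have h2g : X.M.r2 g = f := X.M.r2_invol f
  -- the map with the corners of the halfedge removed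
  let q : X.F → X.F := fun k => if k = f then g else if k = g then f else
    if k = x ∨ k = z then k else X.M.r1 k
  have qf : q f = g := if_pos rfl
  have qg : q g = f := (if_neg hgf).trans (if_pos rfl)
  have q1 : ∀ {k}, k ≠ f → k ≠ g → (k = x ∨ k = z) → q k = k := fun h1 h2 h3 => by
    simp only [q, if_neg h1, if_neg h2, if_pos h3]
  have q2 : ∀ {k}, k ≠ f → k ≠ g → ¬ (k = x ∨ k = z) → q k = X.M.r1 k := fun h1 h2 h3 => by
    simp only [q, if_neg h1, if_neg h2, if_neg h3]
  have hne : ∀ {k}, k ≠ f → k ≠ g → ¬ (k = x ∨ k = z) → X.M.r1 k ≠ f ∧ X.M.r1 k ≠ g ∧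
      ¬ (X.M.r1 k = x ∨ X.M.r1 k = z) := by
    intro k h1 h2 h3
    rw [not_or] at h3
    refine ⟨fun h => h3.1 ?_, fun h => h3.2 ?_, fun h => h.elim (fun h => h1 ?_) fun h => h2 ?_⟩
    · rw [hxdef, ← h, X.M.r1_invol]
    · rw [hzdef, ← h, X.M.r1_invol]
    · exact X.M.r1_invol.injective h
    · exact X.M.r1_invol.injective h
  have hq : Function.Involutive q := by
    intro k
    by_cases h1 : k = f
    · rw [h1, qf, qg]
    by_cases h2 : k = g
    · rw [h2, qg, qf]
    by_cases h3 : k = x ∨ k = z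
    · rw [q1 h1 h2 h3, q1 h1 h2 h3]
    · have := hne h1 h2 h3
      rw [q2 h1 h2 h3, q2 this.1 this.2.1 this.2.2, X.M.r1_invol]
  let N : FlagMap X.F := { X.M with r1 := q, r1_invol := hq }
  let S : Set X.F := {f, g}
  have k0 : ∀ k ∈ Sᶜ, N.r0 k ∈ Sᶜ := mem_compl_of_closed X.M.r0_invol (by
    rintro _ (rfl | rfl)
    exacts [Or.inl h0, Or.inr h0g])
  have k1 : ∀ k ∈ Sᶜ, N.r1 k ∈ Sᶜ := mem_compl_of_closed hq (by
    rintro _ (rfl | rfl)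
    exacts [Or.inr qf, Or.inl qg])
  have k2 : ∀ k ∈ Sᶜ, N.r2 k ∈ Sᶜ := mem_compl_of_closed X.M.r2_invol (by
    rintro _ (rfl | rfl)
    exacts [Or.inr rfl, Or.inl h2g])
  have hS : ∀ {k}, k ∈ Sᶜ ↔ k ≠ f ∧ k ≠ g := fun {k} => not_or
  have hxS : x ∈ Sᶜ := hS.2 ⟨hxf, hx⟩
  have hzS : z ∈ Sᶜ := hS.2 ⟨hzf, hzg⟩
  let Y : RootedMap := ⟨↥Sᶜ, inferInstance, N.restrict Sᶜ k0 k1 k2, ⟨x, hxS⟩⟩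
  have hE : Y.M.Ends Y.root ⟨z, hzS⟩ := ⟨Subtype.ext (q1 hxf hx (Or.inl rfl)),
    Subtype.ext (q1 hzf hzg (Or.inr rfl)), fun h => hxz (congrArg Subtype.val h)⟩
  have hcls : X.cls = (Y.addHalf hE).cls := by
    have : ∃ e : Iso (Y.addHalf hE).M X.M, ∀ p, e.toEquiv p =
        Sum.elim (fun k : Y.F => (k : ↥Sᶜ).1) (fun b => cond b g f) p := by
      have : Nonempty (Y.addHalf hE).F := ⟨(Y.addHalf hE).root⟩
      refine exists_iso_of_equivariant hX _ ?_ ?_ ?_ ?_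
      · rintro (k | _ | _) (k' | _ | _) hkk
        · exact congrArg Sum.inl (Subtype.ext hkk)
        · exact absurd hkk (hS.1 k.2).1
        · exact absurd hkk (hS.1 k.2).2
        · exact absurd hkk.symm (hS.1 k'.2).1
        · rfl
        · exact absurd hkk.symm hgf
        · exact absurd hkk.symm (hS.1 k'.2).2
        · exact absurd hkk hgf
        · rfl
      · rintro (k | _ | _)
        exacts [rfl, h0.symm, h0g.symm]
      · rintro (k | _ | _)
        · by_cases h1 : k = Y.root
          · rw [h1, hE.r1_left]; exact hrx.symm
          by_cases h2 : k = ⟨z, hzS⟩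
          · rw [h2, hE.r1_right]; exact hrz.symm
          rw [hE.r1_inl h1 h2]
          exact q2 (hS.1 k.2).1 (hS.1 k.2).2 fun h => h.elim (fun h => h1 (Subtype.ext h))
            fun h => h2 (Subtype.ext h)
        · rfl
        · rfl
      · rintro (k | _ | _)
        exacts [rfl, rfl, h2g.symm]
    obtain ⟨e, he⟩ := this
    exact (cls_eq_iff.2 ⟨e, he _⟩).symm
  have hi' : (Y.M.addHalf hE).InteriorVertex (Sum.inr false) :=
    natural_root.interiorVertex _ _ hcls hi
  have hroot : ∀ {k}, Y.M.SameVertex Y.root k →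
      (Y.M.addHalf hE).SameVertex (Sum.inr false) (Sum.inl k) := fun {k} hk =>
    (sameVertex_r1 (M := Y.M.addHalf hE) (Sum.inr false)).trans
      (hE.orb_inl (a := Y.M.r2) (fun _ => rfl) hk)
  have hsame : Y.M.SameVertex Y.root ⟨z, hzS⟩ := by
    rcases Orb.exists_other_end Y.M.r1_invol Y.M.r2_invol hE.left with
      ⟨l, h1, h2, h3, -⟩ | ⟨l, h1, h2, -⟩
    · by_cases hl : l = ⟨z, hzS⟩
      · rw [← hl]; exact h1
      · exact absurd ((hE.r1_inl h2 hl).trans (congrArg Sum.inl h3)) (hi' _ (hroot h1)).1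
    · exact absurd (congrArg Sum.inl h2) (hi' _ (hroot h1)).2
  exact ⟨Y, ⟨z, hzS⟩, hE, hsame, (hE.interiorVertex_addHalf hsame).1 hi', hcls⟩

/-- The map without the halfedge can be recovered: the second end `z` is determined by the first. -/
theorem addHalf_cls_iff {Y' : RootedMap} {z : Y.F} {z' : Y'.F} (h : Y.M.Ends Y.root z)
    (h' : Y'.M.Ends Y'.root z') (hz : Y.M.SameVertex Y.root z)
    (hi : ∀ g, Y'.M.SameVertex Y'.root g → Y'.M.r1 g = g → g = Y'.root ∨ g = z') :
    (Y.addHalf h).cls = (Y'.addHalf h').cls ↔ Y.cls = Y'.cls := by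
  constructor
  · intro he
    obtain ⟨e, he⟩ := cls_eq_iff.1 he
    have he0 : e.toEquiv (Sum.inr false) = Sum.inr false := he
    have he1 : e.toEquiv (Sum.inr true) = Sum.inr true := by
      have := e.map_r2 (Sum.inr false)
      rw [he0] at this
      exact this
    have hex : e.toEquiv (Sum.inl Y.root) = Sum.inl Y'.root := by
      have := e.map_r1 (Sum.inr false)
      rw [he0] at this
      exact this
    have hez : e.toEquiv (Sum.inl z) = Sum.inl z' := by
      have := e.map_r1 (Sum.inr true)
      rw [he1] at this
      exact this
    have hl : ∀ g, ∃ g', e.toEquiv (Sum.inl g) = Sum.inl g' := by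
      intro g
      rcases hg : e.toEquiv (Sum.inl g) with g' | _ | _
      · exact ⟨g', rfl⟩
      · exact absurd (e.toEquiv.injective (hg.trans he0.symm)) Sum.inl_ne_inr
      · exact absurd (e.toEquiv.injective (hg.trans he1.symm)) Sum.inl_ne_inr
    choose φ hφ using hl
    have hinj : Function.Injective φ := fun g k hgk =>
      Sum.inl_injective (e.toEquiv.injective (by rw [hφ, hφ, hgk]))
    have hφx : φ Y.root = Y'.root := Sum.inl_injective ((hφ _).symm.trans hex)
    have hφz : φ z = z' := Sum.inl_injective ((hφ _).symm.trans hez)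
    have hsurj : Function.Surjective φ := by
      intro g'
      obtain ⟨g | _ | _, hg⟩ := e.toEquiv.surjective (Sum.inl g')
      · exact ⟨g, Sum.inl_injective ((hφ g).symm.trans hg)⟩
      · exact absurd (he0.symm.trans hg) Sum.inr_ne_inl
      · exact absurd (he1.symm.trans hg) Sum.inr_ne_inl
    refine cls_eq_iff.2 ⟨⟨Equiv.ofBijective φ ⟨hinj, hsurj⟩, fun g => ?_, fun g => ?_,
      fun g => ?_⟩, hφx⟩
    · have := e.map_r0 (Sum.inl g)
      rw [hφ] at this
      exact Sum.inl_injective ((hφ _).symm.trans this)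
    · change φ (Y.M.r1 g) = Y'.M.r1 (φ g)
      by_cases g1 : g = Y.root
      · rw [g1, h.left, hφx, h'.left]
      by_cases g2 : g = z
      · rw [g2, h.right, hφz, h'.right]
      have := e.map_r1 (Sum.inl g)
      rw [hφ, h.r1_inl g1 g2, h'.r1_inl (fun hg => g1 (hinj (hg.trans hφx.symm)))
        (fun hg => g2 (hinj (hg.trans hφz.symm)))] at this
      exact Sum.inl_injective ((hφ _).symm.trans this)
    · have := e.map_r2 (Sum.inl g)
      rw [hφ] at this
      exact Sum.inl_injective ((hφ _).symm.trans this)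
  · intro he
    obtain ⟨e, he⟩ := cls_eq_iff.1 he
    have hez : e.toEquiv z = z' := by
      have h1 := e.sameVertex hz
      rw [he] at h1
      have h2 : Y'.M.r1 (e.toEquiv z) = e.toEquiv z := by rw [← e.map_r1, h.right]
      refine (hi _ h1 h2).resolve_left fun h3 => h.ne ?_
      exact (e.toEquiv.injective (h3.trans he.symm)).symm
    refine cls_eq_iff.2 ⟨⟨Equiv.sumCongr e.toEquiv (Equiv.refl Bool), ?_, ?_, ?_⟩, rfl⟩
    · rintro (g | _ | _)
      exacts [congrArg Sum.inl (e.map_r0 g), rfl, rfl]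
    · rintro (g | _ | _)
      · by_cases g1 : g = Y.root
        · rw [g1, h.r1_left]
          change _ = (Y'.M.addHalf h').r1 (Sum.inl (e.toEquiv Y.root))
          rw [he, h'.r1_left]
          rfl
        by_cases g2 : g = z
        · rw [g2, h.r1_right]
          change _ = (Y'.M.addHalf h').r1 (Sum.inl (e.toEquiv z))
          rw [hez, h'.r1_right]
          rfl
        rw [h.r1_inl g1 g2]
        change _ = (Y'.M.addHalf h').r1 (Sum.inl (e.toEquiv g))
        rw [h'.r1_inl (fun hg => g1 (e.toEquiv.injective (hg.trans he.symm)))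
          (fun hg => g2 (e.toEquiv.injective (hg.trans hez.symm)))]
        exact congrArg Sum.inl (e.map_r1 g)
      · exact congrArg Sum.inl he
      · exact congrArg Sum.inl hez
    · rintro (g | _ | _)
      exacts [congrArg Sum.inl (e.map_r2 g), rfl, rfl]

/-- Removing a halfedge at a vertex in the interior moves this vertex to the boundary. -/
theorem count_isInner_halfedge_ne (n k : ℕ) :
    count (fun X => (IsInner (n + 1) (k + 1) X ∧ X.M.r0 X.root = X.root) ∧
      X.M.r1 X.root ≠ X.M.r2 X.root) = count (IsOuter0 n k) := by
  refine ncard_image_eq_of_rel cls cls (fun X Y => ∃ z, ∃ h : Y.M.Ends Y.root z,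
    Y.M.SameVertex Y.root z ∧ (∀ g, Y.M.SameVertex Y.root g → Y.M.r1 g = g → g = Y.root ∨ g = z) ∧
      X.cls = (Y.addHalf h).cls) ?_ ?_ ?_
  · rintro X ⟨⟨hX, h0⟩, hx⟩
    obtain ⟨Y, z, h, hz, hi, he⟩ := exists_addHalf hX.2.1.1 hX.2.2.1 h0 hx
    exact ⟨Y, (addHalf_isInner_iff h hz hi).1 (invariant_isInner _ _ _ _ he hX), z, h, hz,
      fun g hg => (hi g hg).1, he⟩
  · intro Y hY
    obtain ⟨z, h, hz, hi⟩ := exists_ends hY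
    exact ⟨Y.addHalf h, ⟨⟨(addHalf_isInner_iff h hz hi).2 hY, rfl⟩, Sum.inl_ne_inr⟩, z, h, hz,
      fun g hg => (hi g hg).1, rfl⟩
  · rintro X X' Y Y' - - - - ⟨z, h, hz, -, he⟩ ⟨z', h', -, hi', he'⟩
    rw [he, he', addHalf_cls_iff h h' hz hi']

/-- The numbers of maps on the disk with no boundary dart at the root vertex, which is on the
boundary, including the map that is a single vertex. -/
noncomputable def outer0 (n k : ℕ) : ℕ := count (IsOuter0 n k) + if n = 0 ∧ k = 0 then 1 else 0

theorem degree_pos {X : RootedMap} (h : X.M.r2 X.root ≠ X.root) : 0 < X.degree := by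
  have h1 := X.two_mul_degree
  have : 0 < X.M.innerFlags X.root := by
    have : Nonempty {g // X.M.SameVertex X.root g ∧ X.M.r2 g ≠ g} := ⟨⟨X.root, Orb.refl _, h⟩⟩
    exact Finite.card_pos
  omega

/-- A vertex in the interior with a single dart. -/
theorem r1_eq_r2_of_degree (hi : X.M.InteriorVertex X.root) (h : X.degree = 1) :
    X.M.r1 X.root = X.M.r2 X.root := by
  classical
  have h1 := X.two_mul_degree
  rw [h] at h1
  by_contra hne
  have hlt : ({X.root, X.M.r1 X.root, X.M.r2 X.root} : Finset X.F).card ≤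
      X.M.innerFlags X.root := by
    rw [innerFlags, ← Fintype.card_coe, ← Nat.card_eq_fintype_card]
    have hmem : ∀ g ∈ ({X.root, X.M.r1 X.root, X.M.r2 X.root} : Finset X.F),
        X.M.SameVertex X.root g ∧ X.M.r2 g ≠ g := by
      intro g hg
      have : X.M.SameVertex X.root g := by
        simp only [Finset.mem_insert, Finset.mem_singleton] at hg
        rcases hg with rfl | rfl | rfl
        exacts [Orb.refl _, Orb.left _, Orb.right _]
      exact ⟨this, (hi g this).2⟩
    exact Nat.card_le_card_of_injective (fun g => ⟨g.1, hmem g.1 g.2⟩) fun g k h =>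
      Subtype.ext (congrArg (fun p => p.1) h)
  rw [← h1, Finset.card_eq_three.2 ⟨_, _, _, hi.r1_ne.symm, hi.r2_ne.symm, hne, rfl⟩] at hlt
  omega

/-- Maps on the disk whose root edge is a halfedge. If it is the only dart at the root vertex, then
it is the whole map, and a single vertex on the boundary corresponds to it. -/
theorem count_isInner_halfedge (n k : ℕ) (hn : 1 ≤ n) (hk : 1 ≤ k) :
    count (fun X => IsInner n k X ∧ X.M.r0 X.root = X.root) = outer0 (n - 1) (k - 1) := by
  obtain ⟨n, rfl⟩ := Nat.exists_eq_add_of_le' hn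
  obtain ⟨k, rfl⟩ := Nat.exists_eq_add_of_le' hk
  rw [count_add (n := n + 1) (fun X => X.M.r1 X.root = X.M.r2 X.root) (fun X hX => hX.1.1)
    (natural_root.r1.eq natural_root.r2), count_isInner_halfedge_ne, outer0, add_comm]
  congr 1
  have key : ∀ X, ((IsInner (n + 1) (k + 1) X ∧ X.M.r0 X.root = X.root) ∧
      X.M.r1 X.root = X.M.r2 X.root) → X.cls = half.cls := fun X hX =>
    cls_eq_half hX.1.1.2.1.1 hX.1.2 hX.1.1.2.2.1.r2_ne hX.2
  have hdeg : half.degree = 1 :=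
    degree_eq_one (X := half) (show FlagMap.halfedge.r2 false ≠ false by decide) rfl
  split_ifs with h
  · obtain ⟨h1, h2⟩ : n = 0 ∧ k = 0 := by omega
    subst h1 h2
    refine count_eq_one half ⟨⟨⟨half_darts, isDisk_halfedge, ?_, hdeg⟩, rfl⟩, rfl⟩ key
    exact fun g _ => (show ∀ g, FlagMap.halfedge.r1 g ≠ g ∧ FlagMap.halfedge.r2 g ≠ g by decide) g
  · refine count_eq_zero fun X hX => h ?_
    have h1 := (darts_congr (key X hX)).symm.trans hX.1.1.1
    have h2 := (degree_congr (key X hX)).symm.trans hX.1.1.2.2.2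
    rw [half_darts] at h1
    rw [hdeg] at h2
    omega

end RootedMap

/-! ### Sliding darts along the root edge -/

namespace FlagMap

variable {F : Type*} {M : FlagMap F} {f : F}

/-- The side at the beginning of the vertex of `f`, as seen from `f`, is on the boundary: no dart
follows `f`, or a boundary dart does. -/
def Blocked (M : FlagMap F) (f : F) : Prop := M.r1 f = f ∨ M.r2 (M.r1 f) = M.r1 f

theorem Blocked.not_interiorVertex (h : M.Blocked f) : ¬ M.InteriorVertex f := fun hi =>
  h.elim (fun h => hi.r1_ne h) fun h => (hi.of_sameVertex (sameVertex_r1 f)).r2_ne h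

theorem interiorVertex_of_leaf (h2 : M.r2 f ≠ f) (h : M.r1 f = M.r2 f) : M.InteriorVertex f := by
  intro g hg
  have h3 := M.r1_invol.eq_iff.1 h
  rcases (Orb.mem_iff M.r1_invol M.r2_invol (S := {f, M.r2 f}) (by
    rintro _ (rfl | rfl)
    exacts [Or.inr h, Or.inl h3.symm]) (by
    rintro _ (rfl | rfl)
    exacts [Or.inr rfl, Or.inl (M.r2_invol _)]) hg).1 (Or.inl rfl) with rfl | rfl
  · exact ⟨fun h' => h2 (h.symm.trans h'), h2⟩
  · exact ⟨fun h' => h2 (h'.symm.trans h3.symm), fun h' => h2 (h'.symm.trans (M.r2_invol _))⟩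

theorem not_sameVertex_of_leaf (h0 : M.r0 f ≠ f) (h : M.r1 f = M.r2 f) :
    ¬ M.SameVertex f (M.r0 f) := by
  intro hg
  have h3 := M.r1_invol.eq_iff.1 h
  rcases (Orb.mem_iff M.r1_invol M.r2_invol (S := {f, M.r2 f}) (by
    rintro _ (rfl | rfl)
    exacts [Or.inr h, Or.inl h3.symm]) (by
    rintro _ (rfl | rfl)
    exacts [Or.inr rfl, Or.inl (M.r2_invol _)]) hg).1 (Or.inl rfl) with h' | h'
  exacts [h0 h', M.r0_ne_r2 f h']

/-- If both sides of a dart are blocked, then it is the only inner dart at its vertex. -/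
theorem innerFlags_le_of_blocked [Finite F] (h : M.Blocked f) (h' : M.Blocked (M.r2 f)) :
    M.innerFlags f ≤ 2 := by
  classical
  have hsub : {g | M.SameVertex f g ∧ M.r2 g ≠ g} ⊆ {f, M.r2 f} := by
    rintro g ⟨hg, hg2⟩
    have := (Orb.mem_iff M.r1_invol M.r2_invol
      (S := {f, M.r2 f} ∪ {g | M.r2 g = g ∧ (M.r1 g = f ∨ M.r1 g = M.r2 f)}) ?_ ?_ hg).1
      (Or.inl (Or.inl rfl))
    · exact this.resolve_right fun h => hg2 h.1
    · rintro k (hk | hk)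
      · rcases hk with rfl | rfl
        · exact h.imp (fun h => Or.inl h) fun h => ⟨h, Or.inl (M.r1_invol _)⟩
        · exact h'.imp (fun h => Or.inr h) fun h => ⟨h, Or.inr (M.r1_invol _)⟩
      · exact Or.inl hk.2
    · rintro k (hk | hk)
      · rcases hk with rfl | rfl
        exacts [Or.inl (Or.inr rfl), Or.inl (Or.inl (M.r2_invol _))]
      · rw [hk.1]; exact Or.inr hk
  have := Set.ncard_le_ncard hsub (Set.toFinite _)
  exact this.trans ((Set.ncard_insert_le _ _).trans (by rw [Set.ncard_singleton]))

end FlagMap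

namespace RootedMap

open FlagMap

variable {X Y : RootedMap} {n k K : ℕ}

/-- The rooted map whose next dart is slid to the other end of the root edge. -/
noncomputable def slide (X : RootedMap) : RootedMap := ⟨X.F, X.fin, X.M.slide X.root, X.root⟩

/-- The rooted map where a dart is slid from the other end of the root edge to the root vertex. -/
noncomputable def slideBack (X : RootedMap) : RootedMap :=
  ⟨X.F, X.fin, X.M.slide (X.M.r0 X.root), X.root⟩

theorem slideBack_slide (h : X.M.Slidable X.root) : X.slide.slideBack = X := by
  obtain ⟨F, _, M, f⟩ := X
  simp only [slide, slideBack, slide_r0, h.slide_slide]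

theorem slide_slideBack (h : X.M.Slidable (X.M.r0 X.root)) : X.slideBack.slide = X := by
  obtain ⟨F, _, M, f⟩ := X
  have := h.slide_slide
  simp only [M.r0_invol f] at this
  simp only [slide, slideBack, this]

theorem slide_congr (h : X.cls = Y.cls) : X.slide.cls = Y.slide.cls := by
  obtain ⟨e, he⟩ := cls_eq_iff.1 h
  obtain ⟨e', he'⟩ := e.slide X.M X.root
  obtain ⟨e', he'⟩ : ∃ e' : Iso (X.M.slide X.root) (Y.M.slide Y.root),
    e'.toEquiv = e.toEquiv := by rw [← he]; exact ⟨e', he'⟩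
  exact cls_eq_iff.2 ⟨e', (congrArg (fun j => j X.root) he').trans he⟩

/-- The rooted maps on the disk with `n` darts whose root edge joins the root vertex, which is in
the interior and has degree `k`, to a different vertex; there are `K` inner darts at these two
vertices other than the two ends of the root edge. -/
def IsEdge (n k K : ℕ) (X : RootedMap) : Prop :=
  IsInner n k X ∧ (X.M.r0 X.root ≠ X.root ∧ ¬ X.M.SameVertex X.root (X.M.r0 X.root)) ∧
    X.reroot0.degree + k = K + 2

theorem slidable_root (h : IsEdge n k K X) (hk : 2 ≤ k) : X.M.Slidable X.root where
  complete := h.2.1.1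
  corner := h.1.2.2.1.r1_ne
  inner := (h.1.2.2.1.of_sameVertex (sameVertex_r1 X.root)).r2_ne
  next_ne h' := by
    have h1 := degree_eq_one h.1.2.2.1.r2_ne h'
    have h2 := h.1.2.2.2
    omega
  not_loop := h.2.1.2

theorem slide_degree (h : X.M.Slidable X.root) : X.slide.degree + 1 = X.degree := by
  have h1 : X.slide.M.innerFlags X.slide.root + 2 = X.M.innerFlags X.root := h.innerFlags_slide
  have h2 := X.slide.two_mul_degree
  have h3 := X.two_mul_degree
  omega

theorem slide_degree_other (h : X.M.Slidable X.root) :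
    X.slide.reroot0.degree = X.reroot0.degree + 1 := by
  have h1 := h.slidable_slide.innerFlags_slide
  rw [h.slide_slide] at h1
  have h1 : X.reroot0.M.innerFlags X.reroot0.root + 2 =
    X.slide.reroot0.M.innerFlags X.slide.reroot0.root := h1
  have h2 := X.slide.reroot0.two_mul_degree
  have h3 := X.reroot0.two_mul_degree
  omega

theorem not_sameVertex_slide (h : X.M.Slidable X.root) :
    ¬ X.slide.M.SameVertex X.slide.root (X.slide.M.r0 X.slide.root) := fun h' => by
  have := h.slidable_slide.not_loop
  rw [slide_r0, X.M.r0_invol] at this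
  exact this h'.symm

theorem isEdge_slide (h : IsEdge n (k + 1) K X) (hs : X.M.Slidable X.root) :
    IsEdge n k K X.slide := by
  obtain ⟨⟨hn, hd, hi, hk⟩, ⟨h0, -⟩, hK⟩ := h
  have h1 := slide_degree hs
  have h2 := slide_degree_other hs
  exact ⟨⟨hn, hs.isDisk_slide hd, hs.interiorVertex_slide hi, by omega⟩,
    ⟨h0, not_sameVertex_slide hs⟩, by omega⟩

theorem slidable_slideBack (h : X.M.Slidable (X.M.r0 X.root)) :
    X.slideBack.M.Slidable X.slideBack.root := by
  have := h.slidable_slide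
  rw [X.M.r0_invol] at this
  exact this

theorem isEdge_slideBack (h : IsEdge n k K X) (hs : X.M.Slidable (X.M.r0 X.root)) :
    IsEdge n (k + 1) K X.slideBack := by
  obtain ⟨⟨hn, hd, hi, hk⟩, ⟨h0, hl⟩, hK⟩ := h
  have hs' := slidable_slideBack hs
  have h1 := slide_degree hs'
  have h2 := slide_degree_other hs'
  rw [slide_slideBack hs] at h1 h2
  have hi' := hs.interiorVertex_other_slide (by rwa [X.M.r0_invol])
  rw [X.M.r0_invol] at hi'
  exact ⟨⟨hn, hs.isDisk_slide hd, hi', by omega⟩, ⟨h0, hs'.not_loop⟩, by omega⟩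

/-- Sliding is a bijection between the maps to which it can be applied and its results. -/
theorem count_slide {R R' : RootedMap → Prop} (hk : 1 ≤ k)
    (h₁ : ∀ X, IsEdge n (k + 1) K X → X.M.Slidable X.root → R X → R' X.slide)
    (h₂ : ∀ X, IsEdge n k K X → R' X → X.M.Slidable (X.M.r0 X.root) ∧
      (X.slideBack.M.Slidable X.slideBack.root → R X.slideBack)) :
    count (fun X => IsEdge n (k + 1) K X ∧ R X) = count (fun X => IsEdge n k K X ∧ R' X) := by
  refine count_eq_of_maps slide slideBack ?_ ?_ (fun _ _ => slide_congr) ?_ ?_ ?_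
  · rintro X ⟨hX, hR⟩
    have hs := slidable_root hX (by omega)
    exact ⟨isEdge_slide hX hs, h₁ X hX hs hR⟩
  · rintro X ⟨hX, hR⟩
    obtain ⟨hs, hR⟩ := h₂ X hX hR
    exact ⟨isEdge_slideBack hX hs, hR (slidable_slideBack hs)⟩
  · intro X Y h
    obtain ⟨e, he⟩ := cls_eq_iff.1 h
    obtain ⟨e', he'⟩ := e.slide X.M (X.M.r0 X.root)
    have hr : e.toEquiv (X.M.r0 X.root) = Y.M.r0 Y.root := by rw [e.map_r0, he]
    obtain ⟨e', he'⟩ : ∃ e' : Iso (X.M.slide (X.M.r0 X.root)) (Y.M.slide (Y.M.r0 Y.root)),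
      e'.toEquiv = e.toEquiv := by rw [← hr]; exact ⟨e', he'⟩
    exact cls_eq_iff.2 ⟨e', (congrArg (fun j => j X.root) he').trans he⟩
  · rintro X ⟨hX, hR⟩
    exact slideBack_slide (slidable_root hX (by omega))
  · rintro X ⟨hX, hR⟩
    exact slide_slideBack (h₂ X hX hR).1

theorem r2_r0_root_ne (h : IsEdge n k K X) : X.M.r2 (X.M.r0 X.root) ≠ X.M.r0 X.root := by
  rw [← X.M.r0_r2_comm]
  exact fun h' => h.1.2.2.1.r2_ne (X.M.r0_invol.injective h')

/-- If the other end of the root edge is in the interior, then the degree of the root vertex does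
not matter. -/
theorem count_isEdge_interior_succ (hk : 1 ≤ k) (hK : k ≤ K) :
    count (fun X => IsEdge n (k + 1) K X ∧ X.M.InteriorVertex (X.M.r0 X.root)) =
      count fun X => IsEdge n k K X ∧ X.M.InteriorVertex (X.M.r0 X.root) := by
  refine count_slide hk (fun X _ hs hi => hs.interiorVertex_other_slide hi) fun X hX hi => ?_
  have hs : X.M.Slidable (X.M.r0 X.root) :=
    { complete := by rw [X.M.r0_invol]; exact hX.2.1.1.symm
      corner := hi.r1_ne
      inner := (hi.of_sameVertex (sameVertex_r1 _)).r2_ne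
      next_ne := fun h' => by
        have h1 : X.reroot0.degree = 1 := degree_eq_one (X := X.reroot0) hi.r2_ne h'
        have h2 := hX.2.2
        omega
      not_loop := by rw [X.M.r0_invol]; exact fun h' => hX.2.1.2 h'.symm }
  exact ⟨hs, fun _ => hs.interiorVertex_slide hi⟩

/-- The darts at the root vertex other than the root are slid to the other end of the root edge,
until the root edge is pendant. -/
theorem count_isEdge_interior (hk : 1 ≤ k) (hK : k ≤ K + 1) :
    count (fun X => IsEdge n k K X ∧ X.M.InteriorVertex (X.M.r0 X.root)) =
      count fun X => IsEdge n 1 K X ∧ X.M.InteriorVertex (X.M.r0 X.root) := by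
  induction k, hk using Nat.le_induction with
  | base => rfl
  | succ k hk ih => rw [count_isEdge_interior_succ hk (by omega), ih (by omega)]

theorem not_interior_slide (hs : X.M.Slidable X.root) :
    X.slide.M.InteriorVertex (X.slide.M.r0 X.slide.root) ↔
      X.M.InteriorVertex (X.M.r0 X.root) := by
  refine ⟨fun h => ?_, hs.interiorVertex_other_slide⟩
  have := hs.slidable_slide.interiorVertex_slide h
  rwa [hs.slide_slide] at this

theorem slidable_of_not_blocked (hX : IsEdge n k K X)
    (hi : ¬ X.M.InteriorVertex (X.M.r0 X.root)) (hb : ¬ X.M.Blocked (X.M.r0 X.root)) :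
    X.M.Slidable (X.M.r0 X.root) where
  complete := by rw [X.M.r0_invol]; exact hX.2.1.1.symm
  corner h := hb (Or.inl h)
  inner h := hb (Or.inr h)
  next_ne h := hi (interiorVertex_of_leaf (r2_r0_root_ne hX) h)
  not_loop := by rw [X.M.r0_invol]; exact fun h' => hX.2.1.2 h'.symm

/-- If the other end of the root edge is on the boundary, then a dart can be slid from it to the
root vertex unless the boundary is in the way. -/
theorem count_isEdge_not_blocked (hk : 1 ≤ k) :
    count (fun X => (IsEdge n k K X ∧ ¬ X.M.InteriorVertex (X.M.r0 X.root)) ∧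
        ¬ X.M.Blocked (X.M.r0 X.root)) =
      count fun X => IsEdge n (k + 1) K X ∧ ¬ X.M.InteriorVertex (X.M.r0 X.root) := by
  refine Eq.trans (count_congr fun X => and_assoc) (count_slide hk ?_ ?_).symm
  · intro X _ hs hi
    refine ⟨fun h => hi ((not_interior_slide hs).1 h), fun h => ?_⟩
    have := hs.slidable_slide
    exact h.elim this.corner this.inner
  · intro X hX ⟨hi, hb⟩
    have hs := slidable_of_not_blocked hX hi hb
    refine ⟨hs, fun hs' h => hi ?_⟩
    have := (not_interior_slide hs').2 h
    rwa [slide_slideBack hs] at this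

/-- If the boundary is in the way on the far side of the root edge, then the degree of the root
vertex does not matter. -/
theorem count_isEdge_blocked_succ (hk : 1 ≤ k) (hK : k ≤ K) :
    count (fun X => IsEdge n (k + 1) K X ∧ X.M.Blocked (X.M.r2 (X.M.r0 X.root))) =
      count fun X => IsEdge n k K X ∧ X.M.Blocked (X.M.r2 (X.M.r0 X.root)) := by
  have key : ∀ {X : RootedMap}, X.M.Slidable X.root →
      X.M.r2 (X.M.r0 X.root) ≠ X.M.r0 X.root → X.M.r1 (X.M.r2 (X.M.r0 X.root)) ≠ X.M.r0 X.root →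
      X.slide.M.r1 (X.M.r2 (X.M.r0 X.root)) = X.M.r1 (X.M.r2 (X.M.r0 X.root)) := by
    intro X hs h2 hne
    have hw : X.M.SameVertex (X.M.r0 X.root) (X.M.r2 (X.M.r0 X.root)) := sameVertex_r2 _
    have hf : ∀ g, X.M.SameVertex X.root g → X.M.r2 (X.M.r0 X.root) ≠ g := fun g hg h =>
      hs.not_loop (hg.trans (h ▸ hw).symm)
    have hf' : ∀ g, X.M.SameVertex X.root g → X.M.r1 (X.M.r2 (X.M.r0 X.root)) ≠ g :=
      fun g hg h => hs.not_loop (hg.trans (h ▸ hw.trans (sameVertex_r1 _)).symm)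
    exact hs.r1_of_ne (hf _ (Orb.refl _)) (hf _ hs.sameVertex_next) (hf _ hs.sameVertex_next')
      h2 (hf' _ hs.sameVertex_next') hne
  refine count_slide hk ?_ ?_
  · intro X hX hs hb
    have h2 := r2_r0_root_ne hX
    have h1 := key hs h2 fun h => by
      rcases hb with hb | hb
      · exact h2 (hb.symm.trans h)
      · rw [h] at hb; exact h2 hb
    unfold Blocked
    change X.slide.M.r1 (X.M.r2 (X.M.r0 X.root)) = _ ∨
      X.M.r2 (X.slide.M.r1 (X.M.r2 (X.M.r0 X.root))) = X.slide.M.r1 (X.M.r2 (X.M.r0 X.root))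
    rw [h1]
    exact hb
  · intro X hX hb
    have hi : ¬ X.M.InteriorVertex (X.M.r0 X.root) := fun h =>
      hb.not_interiorVertex (h.of_sameVertex (sameVertex_r2 _))
    have hs := slidable_of_not_blocked hX hi fun hb' => by
      have h1 : X.reroot0.M.innerFlags X.reroot0.root ≤ 2 := innerFlags_le_of_blocked hb' hb
      have h2 := X.reroot0.two_mul_degree
      have h3 := hX.2.2
      omega
    refine ⟨hs, fun hs' => ?_⟩
    have h2 := r2_r0_root_ne hX
    have h1 := key hs' h2 fun h => hi (by
      have := (not_interior_slide hs').2 (interiorVertex_of_leaf h2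
        (X.slideBack.M.r1_invol.eq_iff.1 h).symm)
      rwa [slide_slideBack hs] at this)
    have hM := hs.slide_slide
    rw [X.M.r0_invol] at hM
    have h1 : ((X.M.slide (X.M.r0 X.root)).slide X.root).r1 (X.M.r2 (X.M.r0 X.root)) =
      X.slideBack.M.r1 (X.M.r2 (X.M.r0 X.root)) := h1
    rw [hM] at h1
    unfold Blocked at hb ⊢
    rw [h1] at hb
    exact hb

theorem reroot2_reroot0_degree (X : RootedMap) : X.reroot2.reroot0.degree = X.reroot0.degree := by
  have h : X.M.innerFlags (X.M.r0 (X.M.r2 X.root)) = X.M.innerFlags (X.M.r0 X.root) := by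
    rw [X.M.r0_r2_comm]
    exact (sameVertex_r2 (M := X.M) _).innerFlags_eq.symm
  exact congrArg (· / 2) h

theorem isEdge_reroot2 : IsEdge n k K X.reroot2 ↔ IsEdge n k K X := by
  rw [IsEdge, IsEdge, isInner_reroot2, reroot2_reroot0_degree]
  have h0 : X.M.r0 (X.M.r2 X.root) ≠ X.M.r2 X.root ↔ X.M.r0 X.root ≠ X.root := by
    rw [X.M.r0_r2_comm]; exact X.M.r2_invol.injective.ne_iff
  have h1 : X.M.SameVertex (X.M.r2 X.root) (X.M.r0 (X.M.r2 X.root)) ↔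
      X.M.SameVertex X.root (X.M.r0 X.root) := by
    rw [X.M.r0_r2_comm, sameVertex_r2_iff]
    exact ⟨fun h => (sameVertex_r2 _).trans h, fun h => (sameVertex_r2 _).symm.trans h⟩
  exact and_congr_right fun _ => and_congr_left' (and_congr h0 (not_congr h1))

theorem count_isEdge_blocked (hk : 1 ≤ k) (hK : k ≤ K + 1) :
    count (fun X => IsEdge n k K X ∧ X.M.Blocked (X.M.r0 X.root)) =
      count fun X => IsEdge n 1 K X ∧ X.M.Blocked (X.M.r0 X.root) := by
  have hr : ∀ k, count (fun X => IsEdge n k K X ∧ X.M.Blocked (X.M.r0 X.root)) =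
      count fun X => IsEdge n k K X ∧ X.M.Blocked (X.M.r2 (X.M.r0 X.root)) := by
    intro k
    rw [← count_reroot2]
    refine count_congr fun X => and_congr isEdge_reroot2 ?_
    change X.M.Blocked (X.M.r0 (X.M.r2 X.root)) ↔ _
    rw [X.M.r0_r2_comm]
  rw [hr, hr]
  induction k, hk using Nat.le_induction with
  | base => rfl
  | succ k hk ih => rw [count_isEdge_blocked_succ hk (by omega), ih (by omega)]

theorem invariant_blocked : Invariant fun X => X.M.Blocked (X.M.r0 X.root) :=
  (natural_root.r0.r1.eq natural_root.r0).or (natural_root.r0.r1.r2.eq natural_root.r0.r1)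

/-- Let the other end of the root edge be on the boundary and have degree `m`. The darts there are
slid to the root vertex one after the other until the boundary is in the way, which happens after at
most `m - 1` slides. For each of the `m` possible numbers of slides, the maps obtained are all those
that are blocked and whose root vertex has the appropriate degree, and their number does not depend
on this degree. -/
theorem count_isEdge_boundary (m : ℕ) (hk : 1 ≤ k) (hm : k + m = K + 2) :
    count (fun X => IsEdge n k K X ∧ ¬ X.M.InteriorVertex (X.M.r0 X.root)) =
      m * count fun X => IsEdge n 1 K X ∧ X.M.Blocked (X.M.r0 X.root) := by
  induction m generalizing k with
  | zero =>
    rw [zero_mul]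
    refine count_eq_zero fun X hX => ?_
    have h1 := degree_pos (X := X.reroot0) (r2_r0_root_ne hX.1)
    have h2 := hX.1.2.2
    omega
  | succ m ih =>
    rw [count_add (n := n) (fun X => X.M.Blocked (X.M.r0 X.root)) (fun X hX => hX.1.1.1)
      invariant_blocked, count_isEdge_not_blocked hk, ih (by omega) (by omega), add_mul, one_mul,
      add_comm, ← count_isEdge_blocked hk (by omega)]
    congr 1
    exact count_congr fun X =>
      ⟨fun h => ⟨h.1.1, h.2⟩, fun h => ⟨⟨h.1, h.2.not_interiorVertex⟩, h.2⟩⟩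

end RootedMap

/-! ### Counting the maps whose root edge is pendant -/

namespace RootedMap

open FlagMap

variable {X Y : RootedMap} {n m K : ℕ}

/-- The rooted maps on the disk with `n` darts whose root edge has an end of degree `1` in the
interior opposite to the root, and `K` inner darts at the root vertex other than the root. -/
def IsPendant (n K : ℕ) (X : RootedMap) : Prop :=
  X.darts = n ∧ X.M.IsDisk ∧ (X.M.r0 X.root ≠ X.root ∧ X.M.r2 X.root ≠ X.root ∧
    X.M.r1 (X.M.r0 X.root) = X.M.r2 (X.M.r0 X.root)) ∧ X.degree = K + 1

theorem isEdge_one_iff : IsEdge n 1 K X ↔ IsPendant n K X.reroot0 := by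
  have hr0 : X.reroot0.M.r0 X.reroot0.root = X.root := X.M.r0_invol _
  have h2 : X.M.r2 (X.M.r0 X.root) ≠ X.M.r0 X.root ↔ X.M.r2 X.root ≠ X.root := by
    rw [← X.M.r0_r2_comm]; exact X.M.r0_invol.injective.ne_iff
  rw [IsPendant, hr0]
  change _ ↔ X.darts = n ∧ X.M.IsDisk ∧ (X.root ≠ X.M.r0 X.root ∧
    X.M.r2 (X.M.r0 X.root) ≠ X.M.r0 X.root ∧ X.M.r1 X.root = X.M.r2 X.root) ∧ _
  rw [h2, IsEdge, IsInner]
  constructor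
  · rintro ⟨⟨h1, h2, h3, h4⟩, ⟨h5, -⟩, h7⟩
    exact ⟨h1, h2, ⟨h5.symm, h3.r2_ne, r1_eq_r2_of_degree h3 h4⟩, by omega⟩
  · rintro ⟨h1, h2, ⟨h3, h4, h5⟩, h6⟩
    exact ⟨⟨h1, h2, interiorVertex_of_leaf h4 h5, degree_eq_one h4 h5⟩,
      ⟨h3.symm, not_sameVertex_of_leaf h3.symm h5⟩, by omega⟩

theorem invariant_isPendant : Invariant (IsPendant n K) :=
  (invariant_darts n).and (invariant_isDisk.and
    ((((natural_root.r0.eq natural_root).not).and (((natural_root.r2.eq natural_root).not).and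
      (natural_root.r0.r1.eq natural_root.r0.r2))).and (invariant_degree (K + 1))))

theorem isPendant_glue (hY : Y.M.Connected) :
    IsPendant (m + 2) K (glue Y seg) ↔ Y.darts = m ∧ Y.M.IsDisk ∧ Y.degree = K := by
  rw [IsPendant, glue_seg_darts, glue_seg_degree, glue_seg_isDisk hY, Nat.add_right_cancel_iff,
    Nat.add_right_cancel_iff]
  exact and_congr_right fun _ => and_congr_right fun _ =>
    and_iff_right ⟨glue_seg_r0_ne, glue_seg_r2_ne, glue_seg_spec⟩

theorem exists_glue_of_isPendant (hX : IsPendant n K X) (h1 : X.M.r1 X.root ≠ X.root)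
    (h2 : X.M.r1 X.root ≠ X.M.r2 X.root) :
    ∃ Y : RootedMap, Y.M.Connected ∧ X.cls = (glue Y seg).cls :=
  exists_glue_seg hX.2.1.1 hX.2.2.1.1 hX.2.2.1.2.1 h1 h2 hX.2.2.1.2.2

/-- Removing a pendant edge, with a condition on the map that remains. -/
theorem count_isPendant {R Q : RootedMap → Prop} (hR : Invariant R)
    (h₁ : ∀ X, IsPendant (m + 2) K X → R X →
      X.M.r1 X.root ≠ X.root ∧ X.M.r1 X.root ≠ X.M.r2 X.root)
    (h₂ : ∀ Y, R (glue Y seg) ↔ Q Y) :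
    count (fun X => IsPendant (m + 2) K X ∧ R X) =
      count fun Y => (Y.darts = m ∧ Y.M.IsDisk ∧ Y.degree = K) ∧ Q Y := by
  refine count_glue_const seg loose_seg isSphere_segment.1 (Or.inr rfl)
    (invariant_isPendant.and hR) ?_ ?_ fun Y hY => hY.1.2.1.1
  · rintro X ⟨hX, hRX⟩
    obtain ⟨h1, h2⟩ := h₁ X hX hRX
    exact exists_glue_of_isPendant hX h1 h2
  · intro Y hY
    rw [isPendant_glue hY, h₂]

/-- Removing a pendant edge between two vertices in the interior. -/
theorem count_isEdge_one_interior :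
    count (fun X => IsEdge (m + 2) 1 K X ∧ X.M.InteriorVertex (X.M.r0 X.root)) =
      count (IsInner m K) := by
  have h1 : count (fun X => IsEdge (m + 2) 1 K X ∧ X.M.InteriorVertex (X.M.r0 X.root)) =
      count fun X => IsPendant (m + 2) K X ∧ X.M.InteriorVertex X.root := by
    rw [← count_reroot0 fun X => IsPendant (m + 2) K X ∧ X.M.InteriorVertex X.root]
    exact count_congr fun X => and_congr_left' isEdge_one_iff
  rw [h1, count_isPendant natural_root.interiorVertex ?_ fun Y => glue_seg_interior]
  · refine count_congr fun Y => ⟨fun h => ⟨h.1.1, h.1.2.1, h.2, h.1.2.2⟩,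
      fun h => ⟨⟨h.1, h.2.1, h.2.2.2⟩, h.2.2.1⟩⟩
  · rintro X hX hi
    refine ⟨hi.r1_ne, fun h => ?_⟩
    exact (invariant_isDisk _ _ (cls_eq_seg hX.2.1.1 hX.2.2.1.1 hX.2.2.1.2.1 h hX.2.2.1.2.2)
      hX.2.1).not_isSphere isSphere_segment

/-- The rooted maps on the disk with `n` darts whose root vertex is on the boundary and is incident
to `i` boundary darts, among them the root, and to `k` other darts. -/
def IsOuter (i n k : ℕ) (X : RootedMap) : Prop :=
  X.darts = n ∧ X.M.IsDisk ∧ X.M.r2 X.root = X.root ∧ X.M.boundaryDarts X.root = i ∧ X.degree = k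

theorem boundaryDarts_eq_ncard {F : Type*} (M : FlagMap F) (f : F) :
    M.boundaryDarts f = {g | M.SameVertex f g ∧ M.r2 g = g}.ncard := rfl

/-- A vertex with a boundary dart is incident to one or two boundary darts. In the first case, it
also has a side on the boundary that is inside a face. -/
theorem boundaryDarts_cases {F : Type*} [Finite F] {M : FlagMap F} {f : F} (h : M.r2 f = f) :
    M.boundaryDarts f = 2 ∨ M.boundaryDarts f = 1 ∧ ∃ g, M.SameVertex f g ∧ M.r1 g = g := by
  rw [boundaryDarts_eq_ncard]
  rcases Orb.exists_other_end M.r2_invol M.r1_invol h with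
    ⟨l, h1, h2, h3, -, h4⟩ | ⟨l, h1, h2, -, h4⟩
  · refine Or.inl ?_
    rw [← Set.ncard_pair h2.symm]
    congr 1
    ext g
    constructor
    · exact fun hg => h4 g (Orb.comm hg.1) hg.2
    · rintro (rfl | rfl)
      exacts [⟨Orb.refl _, h⟩, ⟨h1.comm, h3⟩]
  · refine Or.inr ⟨?_, l, h1.comm, h2⟩
    rw [← Set.ncard_singleton f]
    congr 1
    ext g
    constructor
    · exact fun hg => h4 g (Orb.comm hg.1) hg.2
    · rintro rfl
      exact ⟨Orb.refl _, h⟩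

/-- At a vertex that has a side on the boundary inside a face, there is at most one boundary dart.
-/
theorem eq_of_fixed {F : Type*} [Finite F] {M : FlagMap F} {f g k : F} (h : M.r1 f = f)
    (hg : M.SameVertex f g) (hg' : M.r2 g = g) (hk : M.SameVertex f k) (hk' : M.r2 k = k) :
    g = k := by
  rcases Orb.exists_other_end M.r1_invol M.r2_invol h with ⟨l, -, -, -, h4, -⟩ | ⟨l, -, -, h4, -⟩
  · exact absurd hg' (h4 g hg)
  · exact (h4 g hg hg').trans (h4 k hk hk').symm

/-- At a vertex with a boundary dart, at most one side on the boundary is inside a face. -/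
theorem eq_of_fixed' {F : Type*} [Finite F] {M : FlagMap F} {f g k : F} (h : M.r2 f = f)
    (hg : M.SameVertex f g) (hg' : M.r1 g = g) (hk : M.SameVertex f k) (hk' : M.r1 k = k) :
    g = k := by
  rcases Orb.exists_other_end M.r2_invol M.r1_invol h with ⟨l, -, -, -, h4, -⟩ | ⟨l, -, -, h4, -⟩
  · exact absurd hg' (h4 g (Orb.comm hg))
  · exact (h4 g (Orb.comm hg) hg').trans (h4 k (Orb.comm hk) hk').symm

theorem invariant_boundaryDarts (i : ℕ) : Invariant fun X => X.M.boundaryDarts X.root = i :=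
  natural_root.boundaryDarts i

/-- If there is a single boundary dart at the root vertex, then the root may be at either end of
the vertex. -/
theorem count_isOuter_one : count (fun X => (X.darts = n ∧ X.M.IsDisk ∧ X.degree = K) ∧
      X.M.r1 X.root = X.root ∧ X.M.boundaryDarts X.root ≠ 0) = count (IsOuter 1 n K) := by
  refine ncard_image_eq_of_rel cls cls
    (fun X Y => ∃ g, X.M.SameVertex X.root g ∧ Y = ⟨X.F, X.fin, X.M, g⟩) ?_ ?_ ?_
  · rintro X ⟨⟨hn, hd, hk⟩, hr, hb⟩
    obtain ⟨g, hg, hg2⟩ : ∃ g, X.M.SameVertex X.root g ∧ X.M.r2 g = g := by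
      by_contra! h
      exact hb (boundaryDarts_eq_zero_iff.2 h)
    refine ⟨⟨X.F, X.fin, X.M, g⟩, ⟨hn, hd, hg2, ?_, ?_⟩, g, hg, rfl⟩
    · have : X.M.boundaryDarts g = 1 := by
        rw [boundaryDarts_eq_ncard, Set.ncard_eq_one]
        refine ⟨g, Set.eq_singleton_iff_unique_mem.2 ⟨⟨Orb.refl _, hg2⟩, fun k hk => ?_⟩⟩
        exact eq_of_fixed hr (hg.trans hk.1) hk.2 hg hg2
      exact this
    · rw [← hk]
      exact congrArg (· / 2) hg.innerFlags_eq.symm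
  · rintro Y ⟨hn, hd, hr, hb, hk⟩
    obtain ⟨g, hg, hg1⟩ := ((boundaryDarts_cases hr).resolve_left (by omega)).2
    refine ⟨⟨Y.F, Y.fin, Y.M, g⟩, ⟨⟨hn, hd, ?_⟩, hg1, ?_⟩, Y.root, hg.symm, rfl⟩
    · rw [← hk]
      exact congrArg (· / 2) hg.innerFlags_eq.symm
    · change Y.M.boundaryDarts g ≠ 0
      rw [← hg.boundaryDarts_eq, hb]
      exact one_ne_zero
  · rintro X X' _ _ ⟨-, hr, -⟩ ⟨-, hr', -⟩ ⟨-, -, hY, -⟩ ⟨-, -, hY', -⟩ ⟨g, hg, rfl⟩ ⟨g', hg', rfl⟩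
    constructor
    · intro h
      obtain ⟨e, he⟩ := cls_eq_iff.1 h
      refine cls_eq_iff.2 ⟨e, ?_⟩
      refine eq_of_fixed hr' (he ▸ e.sameVertex hg) ?_ hg' hY'
      rw [← e.map_r2]; exact congrArg e.toEquiv hY
    · intro h
      obtain ⟨e, he⟩ := cls_eq_iff.1 h
      have he : e.toEquiv g = g' := he
      refine cls_eq_iff.2 ⟨e, ?_⟩
      refine eq_of_fixed' hY' (he ▸ e.sameVertex hg.symm) ?_ hg'.symm hr'
      rw [← e.map_r1]; exact congrArg e.toEquiv hr

/-- The rooted maps whose root vertex is on the boundary and whose root is next to a side of the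
boundary inside a face. -/
theorem count_r1_fixed : count (fun X => (X.darts = n ∧ X.M.IsDisk ∧ X.degree = K) ∧
      X.M.r1 X.root = X.root) = count (IsOuter0 n K) + count (IsOuter 1 n K) := by
  rw [count_add (n := n) (fun X => X.M.boundaryDarts X.root = 0) (fun X hX => hX.1.1)
    (invariant_boundaryDarts 0), ← count_isOuter_one]
  congr 1 <;> refine count_congr fun X => ?_
  · exact ⟨fun h => ⟨h.1.1.1, h.1.1.2.1, h.1.2, h.2, h.1.1.2.2⟩,
      fun h => ⟨⟨⟨h.1, h.2.1, h.2.2.2.2⟩, h.2.2.1⟩, h.2.2.2.1⟩⟩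
  · exact and_assoc

/-- The rooted maps whose root is a boundary dart. -/
theorem count_r2_fixed : count (fun X => (X.darts = n ∧ X.M.IsDisk ∧ X.degree = K) ∧
      X.M.r2 X.root = X.root) = count (IsOuter 1 n K) + count (IsOuter 2 n K) := by
  rw [count_add (n := n) (fun X => X.M.boundaryDarts X.root = 1) (fun X hX => hX.1.1)
    (invariant_boundaryDarts 1)]
  congr 1 <;> refine count_congr fun X => ?_
  · exact ⟨fun h => ⟨h.1.1.1, h.1.1.2.1, h.1.2, h.2, h.1.1.2.2⟩,
      fun h => ⟨⟨⟨h.1, h.2.1, h.2.2.2.2⟩, h.2.2.1⟩, h.2.2.2.1⟩⟩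
  · refine ⟨fun h => ⟨h.1.1.1, h.1.1.2.1, h.1.2, ?_, h.1.1.2.2⟩,
      fun h => ⟨⟨⟨h.1, h.2.1, h.2.2.2.2⟩, h.2.2.1⟩, by rw [h.2.2.2.1]; simp⟩⟩
    exact (boundaryDarts_cases h.1.2).resolve_right fun h' => h.2 h'.1

/-- The next dart at the root vertex is a boundary dart, which becomes the root when the pendant
edge is removed. The vertex may be incident to one more boundary dart. -/
theorem count_isPendant_r2 :
    count (fun X => IsPendant (m + 2) K X ∧ X.M.r1 X.root ≠ X.root ∧
      X.M.r2 (X.M.r1 X.root) = X.M.r1 X.root) = count (IsOuter 1 m K) + count (IsOuter 2 m K) := by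
  rw [count_isPendant (Q := fun Y => Y.M.r2 Y.root = Y.root)
    ((natural_root.r1.eq natural_root).not.and (natural_root.r1.r2.eq natural_root.r1)) ?_ ?_,
    count_r2_fixed]
  · rintro X hX ⟨h1, h2⟩
    exact ⟨h1, fun h => h1 (by rw [h, X.M.r2_invol] at h2; rw [h, ← h2])⟩
  · intro Y
    rw [glue_seg_r1]
    exact ⟨fun h => Sum.inl_injective h.2, fun h => ⟨Sum.inl_ne_inr, congrArg Sum.inl h⟩⟩

/-- The pendant edge is the first dart at the root vertex, next to a side of the boundary that is
inside a face. Removing it leaves a single vertex, or a map whose first dart is next to this side;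
its last dart may or may not be a boundary dart. -/
theorem count_isPendant_r1 :
    count (fun X => IsPendant (m + 2) K X ∧ X.M.r1 X.root = X.root) =
      outer0 m K + count (IsOuter 1 m K) := by
  rw [count_add (n := m + 2) (fun X => X.M.r1 (X.M.r2 X.root) = X.M.r2 X.root)
    (fun X hX => hX.1.1) (natural_root.r2.r1.eq natural_root.r2), outer0, add_right_comm,
    ← count_r1_fixed, add_comm]
  congr 1
  · have h1 : count (fun X => (IsPendant (m + 2) K X ∧ X.M.r1 X.root = X.root) ∧
        ¬ X.M.r1 (X.M.r2 X.root) = X.M.r2 X.root) =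
        count fun X => IsPendant (m + 2) K X ∧ X.M.r1 X.root ≠ X.root ∧
          X.M.r1 (X.M.r2 X.root) = X.M.r2 X.root := by
      rw [← count_reroot2]
      refine count_congr fun X => ?_
      have hr2 : X.reroot2.M.r2 X.reroot2.root = X.root := X.M.r2_invol _
      have hp : IsPendant (m + 2) K X.reroot2 ↔ IsPendant (m + 2) K X := by
        have h0 : X.M.r0 (X.M.r2 X.root) ≠ X.M.r2 X.root ↔ X.M.r0 X.root ≠ X.root := by
          rw [X.M.r0_r2_comm]; exact X.M.r2_invol.injective.ne_iff
        have h1 : X.M.r1 (X.M.r0 (X.M.r2 X.root)) = X.M.r2 (X.M.r0 (X.M.r2 X.root)) ↔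
            X.M.r1 (X.M.r0 X.root) = X.M.r2 (X.M.r0 X.root) := by
          rw [X.M.r0_r2_comm, X.M.r2_invol, X.M.r1_invol.eq_iff]
          exact eq_comm
        rw [IsPendant, IsPendant, hr2, degree_reroot2]
        refine and_congr_right fun _ => and_congr_right fun _ => and_congr_left' ?_
        exact and_congr h0 (and_congr ne_comm h1)
      rw [hp, hr2]
      exact ⟨fun h => ⟨h.1.1, h.2, h.1.2⟩, fun h => ⟨⟨h.1, h.2.2⟩, h.2.1⟩⟩
    rw [h1, count_isPendant (Q := fun Y => Y.M.r1 Y.root = Y.root)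
      ((natural_root.r1.eq natural_root).not.and (natural_root.r2.r1.eq natural_root.r2)) ?_ ?_]
    · rintro X hX ⟨h1, h2⟩
      exact ⟨h1, fun h => hX.2.2.1.2.1 ((X.M.r1_invol.eq_iff.1 h).trans h2).symm⟩
    · intro Y
      constructor
      · rintro ⟨-, h⟩
        by_contra h'
        have := glue_r1_other_of_ne (Y := Y) loose_seg h'
        exact Sum.inl_ne_inr (this.symm.trans h)
      · intro h
        exact ⟨by rw [glue_seg_r1]; exact Sum.inl_ne_inr, glue_r1_other_of_eq loose_seg h⟩
  · have key : ∀ X : RootedMap, ((IsPendant (m + 2) K X ∧ X.M.r1 X.root = X.root) ∧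
        X.M.r1 (X.M.r2 X.root) = X.M.r2 X.root) → X.reroot0.cls = spoke.cls := by
      rintro X ⟨⟨⟨-, hd, ⟨h0, h2, h3⟩, -⟩, h4⟩, h5⟩
      have hr0 : X.reroot0.M.r0 X.reroot0.root = X.root := X.M.r0_invol _
      refine cls_eq_spoke (X := X.reroot0) hd.1 (fun h => h0 (h.symm.trans hr0)) ?_ h3 ?_ ?_
      · change X.M.r2 (X.M.r0 X.root) ≠ X.M.r0 X.root
        rw [← X.M.r0_r2_comm]
        exact fun h => h2 (X.M.r0_invol.injective h)
      · rw [hr0]; exact h4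
      · rw [X.reroot0.M.r0_r2_comm, hr0]; exact h5
    have hdeg : ∀ X : RootedMap, X.M.r2 X.root ≠ X.root → X.M.r1 X.root = X.root →
        X.M.r1 (X.M.r2 X.root) = X.M.r2 X.root → X.degree = 1 := by
      intro X h2 h3 h4
      have h := innerFlags_le_of_blocked (M := X.M) (f := X.root) (Or.inl h3) (Or.inl h4)
      have h5 := X.two_mul_degree
      have := degree_pos h2
      omega
    -- if the pendant edge is the only dart at the root vertex, then the map is this edge
    split_ifs with h
    · obtain ⟨rfl, rfl⟩ := h
      have hs : spoke.reroot0.M.r2 spoke.reroot0.root ≠ spoke.reroot0.root :=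
        show (true, true) ≠ (true, false) by decide
      refine count_eq_one spoke.reroot0 ⟨⟨⟨spoke_darts, isDisk_spoke, ⟨?_, hs, rfl⟩,
        hdeg _ hs rfl rfl⟩, rfl⟩, rfl⟩ fun X hX => ?_
      · exact show (false, false) ≠ (true, false) by decide
      · obtain ⟨e, he⟩ := cls_eq_iff.1 (key X hX)
        have := natural_root.r0 X.reroot0 spoke e he
        exact cls_eq_iff.2 ⟨e, (congrArg e.toEquiv (X.M.r0_invol _)).symm.trans this⟩
    · refine count_eq_zero fun X hX => h ?_
      have h1 : X.darts = 2 := (darts_congr (key X hX)).trans spoke_darts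
      have h2 := hdeg X hX.1.1.2.2.1.2.1 hX.1.2 hX.2
      have h3 := hX.1.1.1
      have h4 := hX.1.1.2.2.2
      omega

/-- The root edge is pendant, with its leaf in the interior, and no dart precedes it at its end on
the boundary, or a boundary dart does. The sum is over whether the two sides of the boundary at
this vertex belong to edges. -/
theorem count_isEdge_one_blocked :
    count (fun X => IsEdge (m + 2) 1 K X ∧ X.M.Blocked (X.M.r0 X.root)) =
      outer0 m K + 2 * count (IsOuter 1 m K) + count (IsOuter 2 m K) := by
  have h1 : count (fun X => IsEdge (m + 2) 1 K X ∧ X.M.Blocked (X.M.r0 X.root)) =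
      count fun X => IsPendant (m + 2) K X ∧ X.M.Blocked X.root := by
    rw [← count_reroot0 fun X => IsPendant (m + 2) K X ∧ X.M.Blocked X.root]
    exact count_congr fun X => and_congr_left' isEdge_one_iff
  rw [h1, count_add (n := m + 2) (fun X => X.M.r1 X.root = X.root) (fun X hX => hX.1.1)
    (natural_root.r1.eq natural_root)]
  have h2 : count (fun X => (IsPendant (m + 2) K X ∧ X.M.Blocked X.root) ∧
      X.M.r1 X.root = X.root) = _ := (count_congr fun X =>
    ⟨fun h => ⟨h.1.1, h.2⟩, fun h => ⟨⟨h.1, Or.inl h.2⟩, h.2⟩⟩).trans count_isPendant_r1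
  have h3 : count (fun X => (IsPendant (m + 2) K X ∧ X.M.Blocked X.root) ∧
      ¬ X.M.r1 X.root = X.root) = _ := (count_congr fun X =>
    ⟨fun h => ⟨h.1.1, h.2, h.1.2.resolve_left h.2⟩,
      fun h => ⟨⟨h.1, Or.inr h.2.2⟩, h.2.1⟩⟩).trans count_isPendant_r2
  rw [h2, h3]
  ring

end RootedMap

/-! ### The recurrence -/

namespace RootedMap

open FlagMap

variable {X : RootedMap} {n k : ℕ}

theorem innerFlags_iff : X.M.innerFlags X.root = 2 * k ↔ X.degree = k := by
  have := X.two_mul_degree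
  omega

theorem diskMaps_eq (n k : ℕ) : diskMaps n k = count (IsInner n k) := by
  refine (numRooted_eq_count n (fun X => X.M.IsDisk ∧ X.M.InteriorVertex X.root ∧
    X.M.innerFlags X.root = 2 * k) ?_).trans (count_congr fun X => ?_)
  · exact invariant_isDisk.and (natural_root.interiorVertex.and (natural_root.innerFlags _))
  · rw [innerFlags_iff, IsInner]

theorem sphereMaps_eq (n k : ℕ) : sphereMaps n k = balls n k := by
  refine congrArg (· + _) ((numRooted_eq_count n (fun X => X.M.IsSphere ∧
    X.M.innerFlags X.root = 2 * k) ?_).trans (count_congr fun X => ?_))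
  · exact invariant_isSphere.and (natural_root.innerFlags _)
  · rw [innerFlags_iff, IsBall]

theorem diskBoundaryMaps_zero (n k : ℕ) : diskBoundaryMaps 0 n k = outer0 n k := by
  have h : numRooted n (fun M f => M.IsDisk ∧ (if 0 = 0 then M.r1 f = f else M.r2 f = f) ∧
      M.boundaryDarts f = 0 ∧ M.innerFlags f = 2 * k) = count (IsOuter0 n k) := by
    simp only [if_true]
    refine (numRooted_eq_count n (fun X => X.M.IsDisk ∧ X.M.r1 X.root = X.root ∧
      X.M.boundaryDarts X.root = 0 ∧ X.M.innerFlags X.root = 2 * k) ?_).trans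
      (count_congr fun X => ?_)
    · exact invariant_isDisk.and ((natural_root.r1.eq natural_root).and
        ((invariant_boundaryDarts 0).and (natural_root.innerFlags _)))
    · rw [innerFlags_iff, IsOuter0]
  rw [diskBoundaryMaps, h, outer0]
  simp

theorem diskBoundaryMaps_of_pos {i : ℕ} (hi : i ≠ 0) (n k : ℕ) :
    diskBoundaryMaps i n k = count (IsOuter i n k) := by
  rw [diskBoundaryMaps]
  simp only [hi, if_false, false_and, add_zero]
  refine (numRooted_eq_count n (fun X => X.M.IsDisk ∧ X.M.r2 X.root = X.root ∧
    X.M.boundaryDarts X.root = i ∧ X.M.innerFlags X.root = 2 * k) ?_).trans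
    (count_congr fun X => ?_)
  · exact invariant_isDisk.and ((natural_root.r2.eq natural_root).and
      ((invariant_boundaryDarts i).and (natural_root.innerFlags _)))
  · rw [innerFlags_iff, IsOuter]

/-- The darts at the two ends of an edge that is not a loop are all different. -/
theorem degree_add_degree_le (h : ¬ X.M.SameVertex X.root (X.M.r0 X.root)) :
    X.degree + X.reroot0.degree ≤ X.darts := by
  have h1 := X.two_mul_degree
  have h2 : 2 * X.reroot0.degree = X.M.innerFlags (X.M.r0 X.root) := X.reroot0.two_mul_degree
  have h3 := X.two_mul_darts
  have h4 : X.M.innerFlags X.root + X.M.innerFlags (X.M.r0 X.root) ≤ Nat.card X.F := by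
    rw [innerFlags, innerFlags, ← Nat.card_sum]
    refine Nat.card_le_card_of_injective (Sum.elim Subtype.val Subtype.val) ?_
    rintro (g | g) (g' | g') hgg
    · exact congrArg Sum.inl (Subtype.ext hgg)
    · have hgg : g.1 = g'.1 := hgg
      exact absurd (g.2.1.trans (hgg ▸ g'.2.1.symm)) h
    · have hgg : g.1 = g'.1 := hgg
      exact absurd (g'.2.1.trans (hgg ▸ g.2.1.symm)) h
    · exact congrArg Sum.inr (Subtype.ext hgg)
  omega

/-- The maps whose root edge has two different vertices at its ends. The summation index `k'` is the
degree of the other end, less the dart of the root edge. -/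
theorem count_isInner_edge (hk : 1 ≤ k) :
    count (fun X => IsInner n k X ∧ X.M.r0 X.root ≠ X.root ∧
        ¬ X.M.SameVertex X.root (X.M.r0 X.root)) =
      ∑ k' ∈ Finset.range (n - k), (count (IsInner (n - 2) (k + k' - 1)) +
        (k' + 1) * (outer0 (n - 2) (k + k' - 1) + 2 * count (IsOuter 1 (n - 2) (k + k' - 1)) +
          count (IsOuter 2 (n - 2) (k + k' - 1)))) := by
  have hpos : ∀ X : RootedMap, X.M.InteriorVertex X.root → 0 < X.reroot0.degree := by
    intro X hi
    refine degree_pos (X := X.reroot0) ?_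
    change X.M.r2 (X.M.r0 X.root) ≠ X.M.r0 X.root
    rw [← X.M.r0_r2_comm]
    exact fun h' => hi.r2_ne (X.M.r0_invol.injective h')
  rw [count_eq_sum (n := n) (Finset.range (n - k)) (fun X => X.reroot0.degree - 1)
    (fun X hX => hX.1.1) ?_ ?_]
  · refine Finset.sum_congr rfl fun k' hk' => ?_
    rw [Finset.mem_range] at hk'
    obtain ⟨m, rfl⟩ : ∃ m, n = m + 2 := ⟨n - 2, by omega⟩
    rw [Nat.add_sub_cancel]
    have h1 : count (fun X => (IsInner (m + 2) k X ∧ X.M.r0 X.root ≠ X.root ∧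
        ¬ X.M.SameVertex X.root (X.M.r0 X.root)) ∧ X.reroot0.degree - 1 = k') =
        count (IsEdge (m + 2) k (k + k' - 1)) := by
      refine count_congr fun X => ⟨fun h => ⟨h.1.1, h.1.2, ?_⟩, fun h => ⟨⟨h.1, h.2.1⟩, ?_⟩⟩
      · have := hpos X h.1.1.2.2.1
        have := h.2
        omega
      · have := h.2.2
        omega
    rw [h1, count_add (n := m + 2) (fun X => X.M.InteriorVertex (X.M.r0 X.root))
      (fun X hX => hX.1.1) natural_root.r0.interiorVertex, count_isEdge_interior hk (by omega),
      count_isEdge_one_interior, count_isEdge_boundary (k' + 1) hk (by omega),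
      count_isEdge_one_blocked]
  · rintro X ⟨⟨hn, -, hi, hk⟩, -, hl⟩
    have h1 := degree_add_degree_le hl
    have h2 := hpos X hi
    rw [Finset.mem_range]
    omega
  · intro X Y h
    obtain ⟨e, he⟩ := cls_eq_iff.1 h
    have : X.reroot0.cls = Y.reroot0.cls := cls_eq_iff.2 ⟨e, natural_root.r0 X Y e he⟩
    rw [degree_congr this]

/-- The root edge is a halfedge, an edge with different ends, or a loop. -/
theorem count_isInner (hn : 1 ≤ n) (hk : 1 ≤ k) :
    count (IsInner n k) = outer0 (n - 1) (k - 1) +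
      count (fun X => IsInner n k X ∧ X.M.r0 X.root ≠ X.root ∧
        ¬ X.M.SameVertex X.root (X.M.r0 X.root)) +
      count (fun X => IsInner n k X ∧ X.M.r0 X.root ≠ X.root ∧
        X.M.SameVertex X.root (X.M.r0 X.root)) := by
  rw [count_add (n := n) (fun X => X.M.r0 X.root = X.root) (fun X hX => hX.1)
    (natural_root.r0.eq natural_root), count_isInner_halfedge n k hn hk,
    count_add (P := fun X => IsInner n k X ∧ ¬ X.M.r0 X.root = X.root) (n := n)
    (fun X => X.M.SameVertex X.root (X.M.r0 X.root)) (fun X hX => hX.1.1)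
    (natural_root.sameVertex natural_root.r0), add_comm (count _) (count _), add_assoc]
  simp only [and_assoc, ne_eq]

end RootedMap

theorem mainTheorem11 (n k : ℕ) (hn : 1 ≤ n) (hk : 1 ≤ k) :
    diskMaps n k =
      diskBoundaryMaps 0 (n - 1) (k - 1)
      + ∑ k' ∈ Finset.range (n - k), diskMaps (n - 2) (k + k' - 1)
      + 2 * ∑ n' ∈ Finset.range (n - 1), ∑ k' ∈ Finset.range (k - 1),
          diskMaps n' k' * sphereMaps (n - n' - 2) (k - k' - 2)
      + ∑ k' ∈ Finset.range (n - k), ∑ i₁ ∈ Finset.range 2, ∑ i₂ ∈ Finset.range 2,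
          (k' + 1) * diskBoundaryMaps (i₁ + i₂) (n - 2) (k + k' - 1) := by
  rw [RootedMap.diskMaps_eq, RootedMap.count_isInner hn hk, RootedMap.count_isInner_sameVertex,
    RootedMap.count_isInner_edge hk, Finset.sum_add_distrib]
  simp only [Finset.sum_range_succ, Finset.sum_range_zero, zero_add, Nat.reduceAdd,
    RootedMap.diskBoundaryMaps_zero, RootedMap.diskBoundaryMaps_of_pos one_ne_zero,
    RootedMap.diskBoundaryMaps_of_pos two_ne_zero, RootedMap.diskMaps_eq,
    RootedMap.sphereMaps_eq]
  have h : ∀ a b c d : ℕ, a * b + a * c + (a * c + a * d) = a * (b + 2 * c + d) := by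
    intro a b c d
    ring
  simp only [h]
  ring
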